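/- **Theorem (Extension problem).** Let $n\ge 0$ be an integer and $0<\sigma<1$. Let $\mathbb{T}^n=\mathbb{R}^n/2\pi\mathbb{Z}^n$ with Lebesgue measure, and for a square integrable $v:\mathbb{T}^n\to\mathbb{R}$ write $c_k(v)=(2\pi)^{-n}\int_{\mathbb{T}^n}v(z)e^{-ik\cdot z}\,dz$, $k\in\mathbb{Z}^n$. Let $v\in\operatorname{Dom}((-\Delta_{\mathbb{T}^n})^\sigma)$, that is, $v\in L^2(\mathbb{T}^n)$ and $\sum_{k\in\mathbb{Z}^n}\big||k|^{2\sigma}c_k(v)\big|^2<\infty$, and let $$(-\Delta_{\mathbb{T}^n})^\sigma v=\sum_{k\in\mathbb{Z}^n}|k|^{2\sigma}c_k(v)e^{ik\cdot z}\quad\text{in }L^2(\mathbb{T}^n).$$ By a solution of the extension problem for $v$ we mean a function $V:\mathbb{T}^n\times(0,\infty)\to\mathbb{R}$ of class $C^2$ such that $$\Delta_{z}V+\frac{1-2\sigma}{y}V_y+V_{yy}=0\quad\text{in }\mathbb{T}^n\times(0,\infty),$$ $\sup_{y>0}\|V(\cdot,y)\|_{L^2(\mathbb{T}^n)}<\infty$,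 and $V(\cdot,0)=v$ in the sense that $V(\cdot,y)\to v$ weakly in $L^2(\mathbb{T}^n)$ as $y\to0^+$. Then there is exactly one such solution $V$, and, for $c_\sigma=\dfrac{\Gamma(1-\sigma)}{4^{\sigma-1/2}\Gamma(\sigma)}>0$, $$-\lim_{y\to0^+}y^{1-2\sigma}V_y(z,y)=c_\sigma(-\Delta_{\mathbb{T}^n})^\sigma v(z),$$ where the limit holds in $L^2(\mathbb{T}^n)$ and also pointwise for almost every $z\in\mathbb{T}^n$. -/

import Mathlib

open MeasureTheory Filter Topology InnerProductSpace
open scoped NNReal ENNReal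

noncomputable section

instance fractionalTorus_fact_two_pi_pos : Fact (0 < 2 * Real.pi) := ⟨Real.two_pi_pos⟩

/-- The `n`-dimensional torus `ℝⁿ / 2πℤⁿ`. Its `volume` is the Lebesgue measure on a period
cell, of total mass `(2π)ⁿ`. -/
abbrev Torus (n : ℕ) : Type := Fin n → AddCircle (2 * Real.pi)

/-- The quotient map `ℝⁿ → ℝⁿ / 2πℤⁿ`. -/
def Torus.mk {n : ℕ} (x : EuclideanSpace ℝ (Fin n)) : Torus n :=
  fun i => ((x i : ℝ) : AddCircle (2 * Real.pi))

/-- The exponential `z ↦ e^{i k · z}` on the torus, as a continuous function. -/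
def torusExp {n : ℕ} (k : Fin n → ℤ) : C(Torus n, ℂ) where
  toFun z := ∏ i, fourier (k i) (z i)
  continuous_toFun := by fun_prop

/-- The Fourier coefficient `c_k(v) = (2π)⁻ⁿ ∫ v(z) e^{-i k · z} dz`. -/
def torusCoeff {n : ℕ} (v : Torus n → ℝ) (k : Fin n → ℤ) : ℂ :=
  ((2 * Real.pi : ℝ) : ℂ)⁻¹ ^ n * ∫ z, (v z : ℂ) * torusExp (-k) z

/-- The multiplier `|k|^{2σ}`, with `|k|` the Euclidean length of `k`. -/
def freqPow {n : ℕ} (σ : ℝ) (k : Fin n → ℤ) : ℝ :=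
  Real.sqrt (∑ i, (k i : ℝ) ^ 2) ^ (2 * σ)

/-- `v ∈ Dom((-Δ)^σ)`: `v` is in `L²` and `(|k|^{2σ} c_k(v))_k` is square summable. -/
def MemDomFracLaplacian {n : ℕ} (σ : ℝ) (v : Torus n → ℝ) : Prop :=
  MemLp v 2 volume ∧ Summable fun k : Fin n → ℤ => ‖(freqPow σ k : ℂ) * torusCoeff v k‖ ^ 2

/-- The fractional Laplacian `(-Δ)^σ v = ∑_k |k|^{2σ} c_k(v) e^{i k · z}`, the series being
summed in `L²` of the torus. -/
def fracLaplacian {n : ℕ} (σ : ℝ) (v : Torus n → ℝ) : Lp ℂ 2 (volume : Measure (Torus n)) :=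
  ∑' k : Fin n → ℤ,
    ((freqPow σ k : ℂ) * torusCoeff v k) • ContinuousMap.toLp 2 volume ℂ (torusExp k)

/-- `V = V(z, y)` is the (`L²`-bounded, classical) solution of
`Δ_z V + ((1 - 2σ)/y) V_y + V_yy = 0` for `y > 0` with boundary value `V(·, 0) = v`.
The Laplacian in `z` is computed on the periodic lift to `ℝⁿ`; values of `V` at `y ≤ 0`
play no role. The boundary value is attained weakly in `L²`. -/
structure IsExtension {n : ℕ} (σ : ℝ) (v : Torus n → ℝ) (V : Torus n → ℝ → ℝ) : Prop where
  contDiffOn : ContDiffOn ℝ 2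
    (fun p : EuclideanSpace ℝ (Fin n) × ℝ => V (Torus.mk p.1) p.2) (Set.univ ×ˢ Set.Ioi 0)
  equation : ∀ (x : EuclideanSpace ℝ (Fin n)) (y : ℝ), 0 < y →
    Laplacian.laplacian (fun x' : EuclideanSpace ℝ (Fin n) => V (Torus.mk x') y) x
      + (1 - 2 * σ) / y * deriv (V (Torus.mk x)) y + iteratedDeriv 2 (V (Torus.mk x)) y = 0
  bounded : ∃ C : ℝ≥0, ∀ y : ℝ, 0 < y → eLpNorm (fun z => V z y) 2 volume ≤ C
  boundary : ∀ φ : Torus n → ℝ, MemLp φ 2 volume →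
    Tendsto (fun y => ∫ z, V z y * φ z) (𝓝[>] 0) (𝓝 (∫ z, v z * φ z))

/-- The constant `c_σ = Γ(1 - σ) / (4^{σ - 1/2} Γ(σ))`. -/
def extConst (σ : ℝ) : ℝ :=
  Real.Gamma (1 - σ) / ((4 : ℝ) ^ (σ - 1 / 2) * Real.Gamma σ)

end

open MeasureTheory Filter Topology InnerProductSpace
open scoped NNReal ENNReal
/-! ### Fourier series on the torus -/

section TorusExp

variable {n : ℕ}

/-! Fourier coefficients in `z` turn the extension equation into a Bessel type equation `e'' + ((1 -
2σ)/y) e' = |k|² e` for each frequency. A bounded solution with a prescribed limit at `0` is unique: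
`y^{1-2σ} (e²)'` is monotone, so a difference of two solutions that ever moved away from `0` would
be unbounded (`eq_zero_of_bounded_of_ode_real`). Hence the coefficients of any solution are `c_k(v)
· extProfile σ (|k| y)` (`IsExtension.coeff_eq`), and continuity of the slices gives uniqueness of
`V`.

For existence, the profile `Γ(σ)⁻¹ ∫ exp (-s - r²/(4s)) s^{σ-1} ds` decays exponentially in `r`, so
the series with these coefficients can be differentiated termwise for `y > 0`
(`contDiffOn_besselSeries`). The profile lies in `[0, 1]` and tends to `1` as `y → 0`, which gives
the bound and the boundary value.

The substitution `s ↦ r²/(4s)` yields the duality `-y^{1-2σ} ∂_y [extProfile σ (κy)] = c_σ κ^{2σ}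
extProfile (1-σ) (κy)` (`flux_extProfile`). Thus the conormal derivative at height `y` is `c_σ
(-Δ)^σ v` acted on by the multiplier `extProfile (1-σ) (|k| y)` (`IsExtension.coeff_conormal`). The
limit in `L²` follows from Parseval and dominated convergence (`tendsto_eLpNorm_of_multiplier`).

For the pointwise limit, this multiplier is the Fourier transform of the Poisson kernel `extKernel
(1-σ) y` on `ℝⁿ` (`integral_extKernel_mul_cexp`), so the conormal derivative is a periodic Poisson
integral of an integrable function. The kernel is a radially decreasing approximate identity and
converges at Lebesgue points (`ae_tendsto_torusPoisson`). The two sides agree only almost everywhere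
for each `y`; rational heights and continuity in `y` give one null set for all heights. -/

theorem torusExp_apply (k : Fin n → ℤ) (z : Torus n) :
    torusExp k z = ∏ i, fourier (k i) (z i) := rfl

theorem torusExp_neg (k : Fin n → ℤ) (z : Torus n) :
    torusExp (-k) z = starRingEnd ℂ (torusExp k z) := by
  simp only [torusExp_apply, Pi.neg_apply, fourier_neg, map_prod]

theorem torusExp_add (k l : Fin n → ℤ) (z : Torus n) :
    torusExp (k + l) z = torusExp k z * torusExp l z := by
  simp only [torusExp_apply, Pi.add_apply, fourier_add, ← Finset.prod_mul_distrib]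

theorem torusExp_zero (z : Torus n) : torusExp 0 z = 1 := by
  simp [torusExp_apply]

theorem norm_torusExp (k : Fin n → ℤ) (z : Torus n) : ‖torusExp k z‖ = 1 := by
  rw [torusExp_apply, norm_prod]
  exact Finset.prod_eq_one fun i _ => Circle.norm_coe _

theorem torusExp_add_right (k : Fin n → ℤ) (z w : Torus n) :
    torusExp k (z + w) = torusExp k z * torusExp k w := by
  simp only [torusExp_apply, Pi.add_apply, fourier_apply, smul_add, AddCircle.toCircle_add,
    Circle.coe_mul, ← Finset.prod_mul_distrib]

theorem torusExp_mk (k : Fin n → ℤ) (x : EuclideanSpace ℝ (Fin n)) :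
    torusExp k (Torus.mk x) = Complex.exp (((∑ i, (k i : ℝ) * x i : ℝ) : ℂ) * Complex.I) := by
  rw [torusExp_apply, Complex.ofReal_sum, Finset.sum_mul, Complex.exp_sum]
  refine Finset.prod_congr rfl fun i _ => ?_
  rw [Torus.mk, fourier_coe_apply]
  congr 1
  have : (Real.pi : ℂ) ≠ 0 := by exact_mod_cast Real.pi_ne_zero
  push_cast
  field_simp

theorem Torus.mk_add (x y : EuclideanSpace ℝ (Fin n)) :
    Torus.mk (x + y) = Torus.mk x + Torus.mk y := by
  ext i; simp [Torus.mk]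

theorem Torus.mk_sub (x y : EuclideanSpace ℝ (Fin n)) :
    Torus.mk (x - y) = Torus.mk x - Torus.mk y := by
  ext i; simp [Torus.mk]

theorem Torus.mk_zero : Torus.mk (0 : EuclideanSpace ℝ (Fin n)) = 0 := by
  ext i; simp [Torus.mk]

theorem Torus.isOpenQuotientMap_mk :
    IsOpenQuotientMap (Torus.mk : EuclideanSpace ℝ (Fin n) → Torus n) := by
  have h : IsOpenQuotientMap
      (Pi.map fun _ : Fin n => ((↑) : ℝ → AddCircle (2 * Real.pi))) :=
    IsOpenQuotientMap.piMap fun _ => QuotientAddGroup.isOpenQuotientMap_mk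
  exact h.comp (EuclideanSpace.equiv (Fin n) ℝ).toHomeomorph.isOpenQuotientMap

theorem Torus.continuous_mk : Continuous (Torus.mk : EuclideanSpace ℝ (Fin n) → Torus n) :=
  Torus.isOpenQuotientMap_mk.continuous

/-- Translation by such a point preserves the integral of the exponential and flips its sign, which
gives orthogonality without iterated integrals. -/
theorem exists_torusExp_eq_neg_one {k : Fin n → ℤ} (hk : k ≠ 0) :
    ∃ w : Torus n, torusExp k w = -1 := by
  obtain ⟨i, hi⟩ := Function.ne_iff.mp hk
  have hi' : (k i : ℝ) ≠ 0 := by exact_mod_cast hi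
  refine ⟨Torus.mk (EuclideanSpace.single i (Real.pi / k i)), ?_⟩
  rw [torusExp_mk, Finset.sum_eq_single i]
  · simp only [PiLp.single_apply, if_true]
    rw [mul_div_cancel₀ _ hi', Complex.exp_pi_mul_I]
  · intro j _ hj
    simp [hj]
  · simp

theorem integral_torusExp_of_ne {k : Fin n → ℤ} (hk : k ≠ 0) :
    ∫ z : Torus n, torusExp k z = 0 := by
  obtain ⟨w, hw⟩ := exists_torusExp_eq_neg_one hk
  have h := integral_add_right_eq_self (μ := (volume : Measure (Torus n)))
    (fun z => torusExp k z) w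
  simp only [torusExp_add_right, hw, mul_neg, mul_one, integral_neg] at h
  linear_combination (-1 / 2 : ℂ) * h

theorem measureReal_torus : (volume : Measure (Torus n)).real Set.univ = (2 * Real.pi) ^ n := by
  rw [Measure.real, volume_pi, Measure.pi_univ]
  simp only [AddCircle.measure_univ, Finset.prod_const, Finset.card_univ, Fintype.card_fin,
    ENNReal.toReal_pow, ENNReal.toReal_ofReal Real.two_pi_pos.le]

theorem integral_torusExp_zero :
    ∫ z : Torus n, torusExp 0 z = (((2 * Real.pi : ℝ) : ℂ)) ^ n := by
  simp only [torusExp_zero, integral_const, measureReal_torus]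
  simp

/-- The star subalgebra of `C(Torus n, ℂ)` generated by the exponentials. -/
noncomputable def torusExpSubalgebra (n : ℕ) : StarSubalgebra ℂ C(Torus n, ℂ) where
  toSubalgebra := Algebra.adjoin ℂ (Set.range torusExp)
  star_mem' := by
    change Algebra.adjoin ℂ (Set.range torusExp) ≤
      star (Algebra.adjoin ℂ (Set.range torusExp))
    refine Algebra.adjoin_le ?_
    rintro _ ⟨k, rfl⟩
    refine Algebra.subset_adjoin ⟨-k, ?_⟩
    ext1 x
    simp only [torusExp_neg, starRingEnd_apply, ContinuousMap.star_apply]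

/-- Products of exponentials are exponentials, so generating an algebra adds nothing to the linear
span; Stone–Weierstrass then speaks about the span. -/
theorem torusExpSubalgebra_coe :
    Subalgebra.toSubmodule (torusExpSubalgebra n).toSubalgebra =
      Submodule.span ℂ (Set.range torusExp) := by
  apply Algebra.adjoin_eq_span_of_subset
  refine .trans (fun x => Submonoid.closure_induction (fun _ => id) ⟨0, ?_⟩ ?_)
    Submodule.subset_span
  · ext z
    simp [torusExp_zero]
  · rintro _ _ _ _ ⟨m, rfl⟩ ⟨l, rfl⟩
    refine ⟨m + l, ?_⟩
    ext z
    simp [torusExp_add]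

theorem torusExpSubalgebra_separatesPoints :
    (torusExpSubalgebra n).SeparatesPoints := by
  classical
  intro x y hxy
  rw [Ne, funext_iff, not_forall] at hxy
  obtain ⟨i, hi⟩ := hxy
  have key (z : Torus n) : torusExp (Pi.single i 1) z = fourier 1 (z i) := by
    rw [torusExp_apply, Finset.prod_eq_single i]
    · simp
    · intro j _ hj
      simp [Pi.single_eq_of_ne hj]
    · simp
  refine ⟨_, ⟨torusExp (Pi.single i 1), Algebra.subset_adjoin ⟨Pi.single i 1, rfl⟩, rfl⟩, ?_⟩
  dsimp only
  rw [key, key, fourier_one, fourier_one]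
  contrapose hi
  exact AddCircle.injective_toCircle Real.two_pi_pos.ne' (Circle.ext hi)

theorem span_torusExp_closure_eq_top :
    (Submodule.span ℂ (Set.range (torusExp (n := n)))).topologicalClosure = ⊤ := by
  rw [← torusExpSubalgebra_coe]
  exact congr_arg (Subalgebra.toSubmodule <| StarSubalgebra.toSubalgebra ·)
    (ContinuousMap.starSubalgebra_topologicalClosure_eq_top_of_separatesPoints _
      torusExpSubalgebra_separatesPoints)

end TorusExp

/-! ### Fourier coefficients, Parseval's identity and multipliers in `L²`. -/

section Coefficients

variable {n : ℕ}

/-- The Fourier coefficient of a complex valued function on the torus. -/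
noncomputable def torusFourierCoeff (f : Torus n → ℂ) (k : Fin n → ℤ) : ℂ :=
  ((2 * Real.pi : ℝ) : ℂ)⁻¹ ^ n * ∫ z, f z * torusExp (-k) z

theorem torusCoeff_eq (v : Torus n → ℝ) (k : Fin n → ℤ) :
    torusCoeff v k = torusFourierCoeff (fun z => (v z : ℂ)) k := rfl

theorem two_pi_pow_ne_zero : (((2 * Real.pi : ℝ) : ℂ)⁻¹ ^ n) ≠ 0 :=
  pow_ne_zero _ (inv_ne_zero (by exact_mod_cast Real.two_pi_pos.ne'))

theorem integrable_mul_torusExp {f : Torus n → ℂ} (hf : Integrable f) (k : Fin n → ℤ) :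
    Integrable fun z => f z * torusExp k z :=
  hf.mul_bdd (c := 1) (torusExp k).continuous.aestronglyMeasurable
    (Eventually.of_forall fun z => (norm_torusExp k z).le)

theorem torusFourierCoeff_congr {f g : Torus n → ℂ} (h : f =ᵐ[volume] g) (k : Fin n → ℤ) :
    torusFourierCoeff f k = torusFourierCoeff g k := by
  unfold torusFourierCoeff
  congr 1
  refine integral_congr_ae ?_
  filter_upwards [h] with z hz
  rw [hz]

theorem torusFourierCoeff_sub {f g : Torus n → ℂ} (hf : Integrable f) (hg : Integrable g)
    (k : Fin n → ℤ) : torusFourierCoeff (fun z => f z - g z) k =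
      torusFourierCoeff f k - torusFourierCoeff g k := by
  simp only [torusFourierCoeff, sub_mul]
  rw [integral_sub (integrable_mul_torusExp hf _) (integrable_mul_torusExp hg _), mul_sub]

theorem torusFourierCoeff_add {f g : Torus n → ℂ} (hf : Integrable f) (hg : Integrable g)
    (k : Fin n → ℤ) : torusFourierCoeff (fun z => f z + g z) k =
      torusFourierCoeff f k + torusFourierCoeff g k := by
  simp only [torusFourierCoeff, add_mul]
  rw [integral_add (integrable_mul_torusExp hf _) (integrable_mul_torusExp hg _), mul_add]

theorem torusFourierCoeff_const_mul (a : ℂ) (f : Torus n → ℂ) (k : Fin n → ℤ) :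
    torusFourierCoeff (fun z => a * f z) k = a * torusFourierCoeff f k := by
  simp only [torusFourierCoeff, mul_assoc]
  rw [integral_const_mul]
  ring

theorem torusFourierCoeff_torusExp (k l : Fin n → ℤ) :
    torusFourierCoeff (torusExp l) k = if l = k then 1 else 0 := by
  unfold torusFourierCoeff
  simp only [← torusExp_add]
  split_ifs with h
  · rw [h, add_neg_cancel, integral_torusExp_zero, ← mul_pow, inv_mul_cancel₀, one_pow]
    exact_mod_cast Real.two_pi_pos.ne'
  · rw [integral_torusExp_of_ne, mul_zero]
    rwa [← sub_eq_add_neg, sub_ne_zero]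

/-- Pairing with an integrable `f` is continuous for the sup norm and vanishes on the exponentials,
whose span is dense. -/
theorem integral_mul_eq_zero_of_torusFourierCoeff {f : Torus n → ℂ} (hf : Integrable f)
    (h : ∀ k, torusFourierCoeff f k = 0) (φ : C(Torus n, ℂ)) : ∫ z, f z * φ z = 0 := by
  have hcoef (k : Fin n → ℤ) : ∫ z, f z * torusExp k z = 0 := by
    have := h (-k)
    rw [torusFourierCoeff, neg_neg, mul_eq_zero] at this
    exact this.resolve_left two_pi_pow_ne_zero
  have hint (φ : C(Torus n, ℂ)) : Integrable fun z => f z * φ z :=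
    hf.mul_bdd (c := ‖φ‖) φ.continuous.aestronglyMeasurable
      (Eventually.of_forall φ.norm_coe_le_norm)
  let Λ : C(Torus n, ℂ) →ₗ[ℂ] ℂ :=
    { toFun := fun φ => ∫ z, f z * φ z
      map_add' := fun φ ψ => by
        simp only [ContinuousMap.add_apply, mul_add]
        exact integral_add (hint φ) (hint ψ)
      map_smul' := fun c φ => by
        simp only [ContinuousMap.smul_apply, smul_eq_mul, mul_left_comm _ c, RingHom.id_apply]
        exact integral_const_mul c _ }
  have hΛ : Continuous Λ := by
    refine AddMonoidHomClass.continuous_of_bound Λ (∫ z, ‖f z‖) fun φ => ?_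
    rw [← integral_mul_const]
    refine (norm_integral_le_integral_norm _).trans
      (integral_mono (hint φ).norm (hf.norm.mul_const _) fun z => ?_)
    rw [norm_mul]
    exact mul_le_mul_of_nonneg_left (φ.norm_coe_le_norm z) (norm_nonneg _)
  have hle : (Submodule.span ℂ (Set.range (torusExp (n := n)))).topologicalClosure ≤
      LinearMap.ker Λ := by
    refine Submodule.topologicalClosure_minimal _ ?_ (isClosed_singleton.preimage hΛ)
    rw [Submodule.span_le]
    rintro _ ⟨k, rfl⟩
    exact hcoef k
  rw [span_torusExp_closure_eq_top] at hle
  exact hle (Submodule.mem_top (x := φ))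

/-- An integrable function on the torus is determined by its Fourier coefficients. -/
theorem ae_eq_zero_of_torusFourierCoeff {f : Torus n → ℂ} (hf : Integrable f)
    (h : ∀ k, torusFourierCoeff f k = 0) : f =ᵐ[volume] 0 := by
  refine ae_eq_zero_of_forall_setIntegral_isClosed_eq_zero hf fun s hs => ?_
  -- The indicator of a closed set is a bounded pointwise limit of continuous functions, so
  -- vanishing against continuous functions passes to closed sets.
  have hpos (m : ℕ) : (0 : ℝ) < 1 / ((m : ℝ) + 1) := by positivity
  have hlim := tendsto_pi_nhds.1 (thickenedIndicator_tendsto_indicator_closure hpos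
    tendsto_one_div_add_atTop_nhds_zero_nat s)
  rw [hs.closure_eq] at hlim
  let φ (m : ℕ) : C(Torus n, ℂ) :=
    ⟨fun z => ((thickenedIndicator (hpos m) s z : ℝ≥0) : ℂ), by fun_prop⟩
  have key : Tendsto (fun m => ∫ z, f z * φ m z) atTop (𝓝 (∫ z, s.indicator f z)) := by
    refine tendsto_integral_of_dominated_convergence (fun z => ‖f z‖) (fun m => ?_) hf.norm
      (fun m => ?_) ?_
    · exact hf.aestronglyMeasurable.mul (φ m).continuous.aestronglyMeasurable
    · refine Eventually.of_forall fun z => ?_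
      rw [norm_mul]
      refine mul_le_of_le_one_right (norm_nonneg _) ?_
      have h1 : thickenedIndicator (hpos m) s z ≤ 1 := thickenedIndicator_le_one (hpos m) s z
      simpa [φ] using h1
    · refine Eventually.of_forall fun z => ?_
      have h1 := (NNReal.continuous_coe.tendsto _).comp (hlim z)
      have h2 := ((Complex.continuous_ofReal.tendsto _).comp h1).const_mul (f z)
      have h3 : f z * (((s.indicator (fun _ => (1 : ℝ≥0)) z : ℝ≥0) : ℝ) : ℂ) = s.indicator f z := by
        by_cases hz : z ∈ s <;> simp [hz]
      rw [← h3]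
      exact h2
  simp only [integral_mul_eq_zero_of_torusFourierCoeff hf h] at key
  rw [← integral_indicator hs.measurableSet]
  exact (tendsto_nhds_unique key tendsto_const_nhds)

theorem ae_eq_of_torusFourierCoeff {f g : Torus n → ℂ} (hf : Integrable f) (hg : Integrable g)
    (h : ∀ k, torusFourierCoeff f k = torusFourierCoeff g k) : f =ᵐ[volume] g := by
  have := ae_eq_zero_of_torusFourierCoeff (hf.sub hg) fun k => by
    rw [← sub_eq_zero.2 (h k), ← torusFourierCoeff_sub hf hg]; rfl
  filter_upwards [this] with z hz
  exact sub_eq_zero.1 hz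

theorem integrable_of_continuous_torus {E : Type*} [NormedAddCommGroup E]
    {f : Torus n → E} (hf : Continuous f) : Integrable f :=
  hf.integrable_of_hasCompactSupport (HasCompactSupport.of_compactSpace f)

theorem memLp_of_continuous_torus {f : Torus n → ℂ} (hf : Continuous f) : MemLp f 2 :=
  hf.memLp_of_hasCompactSupport (HasCompactSupport.of_compactSpace f)

theorem eq_of_torusFourierCoeff {f g : Torus n → ℂ} (hf : Continuous f) (hg : Continuous g)
    (h : ∀ k, torusFourierCoeff f k = torusFourierCoeff g k) : f = g :=
  Continuous.ae_eq_iff_eq volume hf hg |>.1 <|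
    ae_eq_of_torusFourierCoeff (integrable_of_continuous_torus hf)
      (integrable_of_continuous_torus hg) h

/-- The normalised exponentials as elements of `L²`. -/
noncomputable def torusExpLp (k : Fin n → ℤ) : Lp ℂ 2 (volume : Measure (Torus n)) :=
  (((Real.sqrt ((2 * Real.pi) ^ n))⁻¹ : ℝ) : ℂ) • ContinuousMap.toLp 2 volume ℂ (torusExp k)

theorem inner_toLp_torusExp (k : Fin n → ℤ) (f : Lp ℂ 2 (volume : Measure (Torus n))) :
    inner ℂ (ContinuousMap.toLp 2 volume ℂ (torusExp k)) f =
      (((2 * Real.pi) ^ n : ℝ) : ℂ) * torusFourierCoeff f k := by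
  rw [L2.inner_def, torusFourierCoeff, ← mul_assoc]
  have h1 : (((2 * Real.pi) ^ n : ℝ) : ℂ) * ((2 * Real.pi : ℝ) : ℂ)⁻¹ ^ n = 1 := by
    rw [Complex.ofReal_pow, ← mul_pow, mul_inv_cancel₀, one_pow]
    exact_mod_cast Real.two_pi_pos.ne'
  rw [h1, one_mul]
  refine integral_congr_ae ?_
  filter_upwards [ContinuousMap.coeFn_toLp (p := 2) (𝕜 := ℂ) volume (torusExp k)] with z hz
  rw [hz, RCLike.inner_apply, torusExp_neg]

theorem inner_torusExpLp (k : Fin n → ℤ) (f : Lp ℂ 2 (volume : Measure (Torus n))) :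
    inner ℂ (torusExpLp k) f =
      ((Real.sqrt ((2 * Real.pi) ^ n) : ℝ) : ℂ) * torusFourierCoeff f k := by
  rw [torusExpLp, inner_smul_left, inner_toLp_torusExp, Complex.conj_ofReal, ← mul_assoc,
    ← Complex.ofReal_mul]
  congr 2
  have h0 : (0 : ℝ) < (2 * Real.pi) ^ n := by positivity
  have h1 := Real.mul_self_sqrt h0.le
  have h2 : Real.sqrt ((2 * Real.pi) ^ n) ≠ 0 := (Real.sqrt_pos.2 h0).ne'
  field_simp
  linarith

theorem orthonormal_torusExpLp : Orthonormal ℂ (torusExpLp (n := n)) := by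
  rw [orthonormal_iff_ite]
  intro k l
  rw [inner_torusExpLp, torusExpLp]
  rw [torusFourierCoeff_congr (g := fun z =>
    (((Real.sqrt ((2 * Real.pi) ^ n))⁻¹ : ℝ) : ℂ) * torusExp l z), torusFourierCoeff_const_mul,
    torusFourierCoeff_torusExp]
  · have h0 : (0 : ℝ) < (2 * Real.pi) ^ n := by positivity
    have h2 : ((Real.sqrt ((2 * Real.pi) ^ n) : ℝ) : ℂ) ≠ 0 := by
      exact_mod_cast (Real.sqrt_pos.2 h0).ne'
    rw [Complex.ofReal_inv, ← mul_assoc, mul_inv_cancel₀ h2, one_mul]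
    simp only [eq_comm]
  · filter_upwards [Lp.coeFn_smul (((Real.sqrt ((2 * Real.pi) ^ n))⁻¹ : ℝ) : ℂ)
      (ContinuousMap.toLp 2 volume ℂ (torusExp l)),
      ContinuousMap.coeFn_toLp (p := 2) (𝕜 := ℂ) volume (torusExp l)] with z h1 h2
    rw [h1, Pi.smul_apply, h2, smul_eq_mul]

/-- The Hilbert basis of exponentials. -/
noncomputable def torusBasis (n : ℕ) :
    HilbertBasis (Fin n → ℤ) ℂ (Lp ℂ 2 (volume : Measure (Torus n))) :=
  HilbertBasis.mkOfOrthogonalEqBot orthonormal_torusExpLp <| by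
    rw [Submodule.eq_bot_iff]
    intro f hf
    have hc (k : Fin n → ℤ) : torusFourierCoeff f k = 0 := by
      have h1 := (Submodule.mem_orthogonal _ _).1 hf _
        (Submodule.subset_span (Set.mem_range_self k))
      rw [inner_torusExpLp, mul_eq_zero] at h1
      refine h1.resolve_left ?_
      have h0 : (0 : ℝ) < (2 * Real.pi) ^ n := by positivity
      exact_mod_cast (Real.sqrt_pos.2 h0).ne'
    exact (Lp.eq_zero_iff_ae_eq_zero).2
      (ae_eq_zero_of_torusFourierCoeff ((Lp.memLp f).integrable (by norm_num)) hc)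

theorem torusBasis_apply (k : Fin n → ℤ) : torusBasis n k = torusExpLp k := by
  simp [torusBasis]

theorem torusBasis_repr (f : Lp ℂ 2 (volume : Measure (Torus n))) (k : Fin n → ℤ) :
    (torusBasis n).repr f k =
      ((Real.sqrt ((2 * Real.pi) ^ n) : ℝ) : ℂ) * torusFourierCoeff f k := by
  rw [HilbertBasis.repr_apply_apply, torusBasis_apply, inner_torusExpLp]

/-- Parseval's identity. -/
theorem hasSum_sq_torusFourierCoeff {f : Torus n → ℂ} (hf : MemLp f 2) :
    HasSum (fun k => (2 * Real.pi) ^ n * ‖torusFourierCoeff f k‖ ^ 2)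
      ((eLpNorm f 2 volume).toReal ^ 2) := by
  have h := lp.hasSum_norm (p := 2) (by norm_num) ((torusBasis n).repr (hf.toLp f))
  rw [LinearIsometryEquiv.norm_map, Lp.norm_toLp] at h
  have h0 : (0 : ℝ) ≤ (2 * Real.pi) ^ n := by positivity
  simp only [torusBasis_repr, torusFourierCoeff_congr hf.coeFn_toLp, norm_mul, Complex.norm_real,
    Real.norm_eq_abs, abs_of_nonneg (Real.sqrt_nonneg _), ENNReal.toReal_ofNat,
    Real.rpow_ofNat] at h
  simpa only [mul_pow _ _ 2, Real.sq_sqrt h0] using h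

/-- Applying Fourier multipliers that are bounded by one and tend to one gives an approximation
in `L²`. -/
theorem tendsto_eLpNorm_of_multiplier {ι : Type*} {l : Filter ι} {f : Torus n → ℂ}
    (hf : MemLp f 2) {F : ι → Torus n → ℂ} {m : ι → (Fin n → ℤ) → ℝ}
    (hF : ∀ᶠ y in l, MemLp (F y) 2)
    (hcoef : ∀ᶠ y in l, ∀ k, torusFourierCoeff (F y) k = m y k * torusFourierCoeff f k)
    (hm0 : ∀ᶠ y in l, ∀ k, 0 ≤ m y k) (hm1 : ∀ᶠ y in l, ∀ k, m y k ≤ 1)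
    (hlim : ∀ k, Tendsto (fun y => m y k) l (𝓝 1)) :
    Tendsto (fun y => eLpNorm (fun z => F y z - f z) 2 volume) l (𝓝 0) := by
  -- By Parseval this sum is the squared `L²` distance. Since `|m - 1| ≤ 1`, the terms are dominated
  -- by those of `f`.
  have key : Tendsto (fun y => ∑' k, (2 * Real.pi) ^ n *
      ‖((m y k - 1 : ℝ) : ℂ) * torusFourierCoeff f k‖ ^ 2) l
      (𝓝 (∑' k : Fin n → ℤ, (0 : ℝ))) := by
    refine tendsto_tsum_of_dominated_convergence
      (bound := fun k => (2 * Real.pi) ^ n * ‖torusFourierCoeff f k‖ ^ 2)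
      (hasSum_sq_torusFourierCoeff hf).summable (fun k => ?_) ?_
    · have h1 : Tendsto (fun y => (2 * Real.pi) ^ n *
          ‖((m y k - 1 : ℝ) : ℂ) * torusFourierCoeff f k‖ ^ 2) l
          (𝓝 ((2 * Real.pi) ^ n * ‖((1 - 1 : ℝ) : ℂ) * torusFourierCoeff f k‖ ^ 2)) := by
        have h2 : Continuous fun t : ℝ => (2 * Real.pi) ^ n *
          ‖((t - 1 : ℝ) : ℂ) * torusFourierCoeff f k‖ ^ 2 := by fun_prop
        exact (h2.tendsto 1).comp (hlim k)
      simpa using h1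
    · filter_upwards [hm0, hm1] with y h0 h1 k
      rw [Real.norm_of_nonneg (by positivity), norm_mul, Complex.norm_real, Real.norm_eq_abs]
      have h2 : |m y k - 1| ≤ 1 := by rw [abs_le]; constructor <;> linarith [h0 k, h1 k]
      have h3 : |m y k - 1| * ‖torusFourierCoeff f k‖ ≤ ‖torusFourierCoeff f k‖ :=
        mul_le_of_le_one_left (norm_nonneg _) h2
      gcongr
  rw [tsum_zero] at key
  have key2 := (Real.continuous_sqrt.tendsto _).comp key
  rw [Real.sqrt_zero] at key2
  have key3 := (ENNReal.continuous_ofReal.tendsto _).comp key2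
  rw [ENNReal.ofReal_zero] at key3
  refine key3.congr' ?_
  filter_upwards [hF, hcoef] with y h1 h2
  have h3 : MemLp (fun z => F y z - f z) 2 := h1.sub hf
  have h4 := (hasSum_sq_torusFourierCoeff h3).tsum_eq
  have h5 (k : Fin n → ℤ) : torusFourierCoeff (fun z => F y z - f z) k =
      ((m y k - 1 : ℝ) : ℂ) * torusFourierCoeff f k := by
    rw [torusFourierCoeff_sub (h1.integrable (by norm_num)) (hf.integrable (by norm_num)), h2]
    push_cast; ring
  simp only [h5] at h4
  simp only [Function.comp_apply]
  rw [h4, Real.sqrt_sq ENNReal.toReal_nonneg, ENNReal.ofReal_toReal h3.2.ne]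

/-- An unconditional sum that fails to converge would have the default value `0`. Membership in the
domain makes the coefficients square summable, so the series is an expansion in `torusBasis`; the
factor `s` compensates for the normalisation of that basis. -/
theorem torusFourierCoeff_fracLaplacian {σ : ℝ} {v : Torus n → ℝ}
    (hv : MemDomFracLaplacian σ v) (k : Fin n → ℤ) :
    torusFourierCoeff (fracLaplacian σ v) k = freqPow σ k * torusCoeff v k := by
  have h0 : (0 : ℝ) < (2 * Real.pi) ^ n := by positivity
  have hs : ((Real.sqrt ((2 * Real.pi) ^ n) : ℝ) : ℂ) ≠ 0 := by
    exact_mod_cast (Real.sqrt_pos.2 h0).ne'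
  set s : ℂ := ((Real.sqrt ((2 * Real.pi) ^ n) : ℝ) : ℂ) with hsdef
  have hmem : Memℓp (fun k : Fin n → ℤ => s * ((freqPow σ k : ℂ) * torusCoeff v k)) 2 := by
    refine memℓp_gen ?_
    simp only [norm_mul s, ENNReal.toReal_ofNat, Real.rpow_ofNat, mul_pow]
    exact hv.2.mul_left _
  let a : lp (fun _ : Fin n → ℤ => ℂ) 2 := ⟨_, hmem⟩
  have h1 := (torusBasis n).hasSum_repr_symm a
  have h2 : fracLaplacian σ v = (torusBasis n).repr.symm a := by
    rw [← h1.tsum_eq, fracLaplacian]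
    refine tsum_congr fun l => ?_
    rw [torusBasis_apply, torusExpLp, smul_smul]
    congr 1
    change _ = s * ((freqPow σ l : ℂ) * torusCoeff v l) * _
    rw [Complex.ofReal_inv, ← hsdef]
    field_simp
  have h3 := torusBasis_repr ((torusBasis n).repr.symm a) k
  rw [LinearIsometryEquiv.apply_symm_apply, ← h2] at h3
  exact mul_left_cancel₀ hs h3.symm

end Coefficients

/-! ### A Bessel type integral -/

section BesselInt

/-- The integrand of `besselInt`. -/
noncomputable def besselKernel (b r s : ℝ) : ℝ := Real.exp (-s - r ^ 2 / (4 * s)) * s ^ (b - 1)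

/-- The integral `∫₀^∞ exp (-s - r² / (4 s)) s ^ (b - 1) ds`, which is `2 (r / 2) ^ b K_b(r)` in
terms of the modified Bessel function `K_b`. -/
noncomputable def besselInt (b r : ℝ) : ℝ := ∫ s in Set.Ioi (0 : ℝ), besselKernel b r s

theorem besselKernel_nonneg (b r : ℝ) {s : ℝ} (hs : 0 < s) : 0 ≤ besselKernel b r s :=
  mul_nonneg (Real.exp_pos _).le (Real.rpow_nonneg hs.le _)

theorem besselInt_nonneg (b r : ℝ) : 0 ≤ besselInt b r :=
  setIntegral_nonneg measurableSet_Ioi fun _ hs => besselKernel_nonneg b r hs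

theorem aestronglyMeasurable_besselKernel (b r : ℝ) :
    AEStronglyMeasurable (besselKernel b r) (volume.restrict (Set.Ioi 0)) := by
  unfold besselKernel
  fun_prop

/-- Uniform domination for `r ≥ δ` and arbitrary real `b`. Half of the exponent gives `exp (-r/2)`
by `r ≤ s + r²/(4s)`. The other half leaves `exp (-s/2)` for large `s` and `exp (-δ²/(8s)) ≤ const ·
s^N`, where `N` is chosen large enough to make the singularity at `s = 0` integrable. -/
theorem exists_besselKernel_le (b : ℝ) {δ : ℝ} (hδ : 0 < δ) :
    ∃ C c : ℝ, 0 < C ∧ 0 < c ∧ 0 < c + b ∧ ∀ r, δ ≤ r → ∀ s, 0 < s →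
      besselKernel b r s ≤ C * Real.exp (-(r / 2)) * (s ^ (c + b - 1) * Real.exp (-(1 / 2) * s)) := by
  obtain ⟨N, hN⟩ := exists_nat_gt (max 0 (-b))
  have hN0 : (0 : ℝ) < N := lt_of_le_of_lt (le_max_left _ _) hN
  have hNb : 0 < (N : ℝ) + b := by linarith [lt_of_le_of_lt (le_max_right 0 (-b)) hN]
  refine ⟨N.factorial * (8 / δ ^ 2) ^ N, N, by positivity, hN0, hNb, fun r hr s hs => ?_⟩
  have hr0 : 0 < r := hδ.trans_le hr
  have h1 : r ≤ s + r ^ 2 / (4 * s) := by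
    have h : s + r ^ 2 / (4 * s) - r = (2 * s - r) ^ 2 / (4 * s) := by field_simp; ring
    have : 0 ≤ (2 * s - r) ^ 2 / (4 * s) := by positivity
    linarith
  have h2 : δ ^ 2 / (8 * s) ≤ r ^ 2 / (8 * s) := by gcongr
  have h3 : Real.exp (-s - r ^ 2 / (4 * s)) ≤
      Real.exp (-(r / 2)) * Real.exp (-(1 / 2) * s) * Real.exp (-(δ ^ 2 / (8 * s))) := by
    rw [← Real.exp_add, ← Real.exp_add]
    refine Real.exp_le_exp.2 ?_
    have h : r ^ 2 / (4 * s) = 2 * (r ^ 2 / (8 * s)) := by field_simp; ring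
    rw [h] at h1 ⊢
    linarith
  have h4 : Real.exp (-(δ ^ 2 / (8 * s))) ≤ N.factorial * (8 / δ ^ 2) ^ N * s ^ N := by
    rw [Real.exp_neg, inv_le_comm₀ (Real.exp_pos _) (by positivity)]
    refine le_trans (le_of_eq ?_)
      (Real.pow_div_factorial_le_exp (δ ^ 2 / (8 * s)) (by positivity) N)
    rw [div_pow, div_pow, mul_pow]
    field_simp
  have h5 : s ^ ((N : ℝ) + b - 1) = s ^ N * s ^ (b - 1) := by
    rw [add_sub_assoc, Real.rpow_add hs, Real.rpow_natCast]
  calc besselKernel b r s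
      ≤ Real.exp (-(r / 2)) * Real.exp (-(1 / 2) * s) *
          (N.factorial * (8 / δ ^ 2) ^ N * s ^ N) * s ^ (b - 1) := by
        unfold besselKernel
        have := Real.rpow_nonneg hs.le (b - 1)
        gcongr
        exact h3.trans (by gcongr)
    _ = _ := by rw [h5]; ring

theorem integrableOn_rpow_mul_exp_half {c : ℝ} (hc : 0 < c) :
    IntegrableOn (fun s : ℝ => s ^ (c - 1) * Real.exp (-(1 / 2) * s)) (Set.Ioi 0) := by
  simpa using integrableOn_rpow_mul_exp_neg_mul_rpow (p := 1) (s := c - 1) (b := 1 / 2)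
    (by linarith) one_pos (by norm_num)

theorem integrableOn_besselKernel (b : ℝ) {r : ℝ} (hr : 0 < r) :
    IntegrableOn (besselKernel b r) (Set.Ioi 0) := by
  obtain ⟨C, c, hC, hc, hcb, h⟩ := exists_besselKernel_le b hr
  refine Integrable.mono' ((integrableOn_rpow_mul_exp_half hcb).const_mul
    (C * Real.exp (-(r / 2)))) (aestronglyMeasurable_besselKernel b r) ?_
  filter_upwards [ae_restrict_mem measurableSet_Ioi] with s hs
  rw [Real.norm_of_nonneg (besselKernel_nonneg b r hs)]
  exact h r le_rfl s hs

theorem exists_besselInt_le (b : ℝ) {δ : ℝ} (hδ : 0 < δ) :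
    ∃ C : ℝ, 0 < C ∧ ∀ r, δ ≤ r → besselInt b r ≤ C * Real.exp (-(r / 2)) := by
  obtain ⟨C, c, hC, hc, hcb, h⟩ := exists_besselKernel_le b hδ
  set J := ∫ s in Set.Ioi (0 : ℝ), s ^ (c + b - 1) * Real.exp (-(1 / 2) * s) with hJ
  have hJ0 : 0 ≤ J := setIntegral_nonneg measurableSet_Ioi fun s hs =>
    mul_nonneg (Real.rpow_nonneg (le_of_lt hs) _) (Real.exp_pos _).le
  refine ⟨C * (J + 1), by positivity, fun r hr => ?_⟩
  have h1 : besselInt b r ≤ C * Real.exp (-(r / 2)) * J := by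
    rw [hJ, ← integral_const_mul]
    exact setIntegral_mono_on (integrableOn_besselKernel b (hδ.trans_le hr))
      ((integrableOn_rpow_mul_exp_half hcb).const_mul _) measurableSet_Ioi
      fun s hs => h r hr s hs
  have : 0 < C * Real.exp (-(r / 2)) := by positivity
  nlinarith

/-- Differentiating the exponential in `r` brings down `-r/(2s)`, which lowers the exponent `b` by
one. -/
theorem hasDerivAt_besselInt (b : ℝ) {r : ℝ} (hr : 0 < r) :
    HasDerivAt (besselInt b) (-(r / 2) * besselInt (b - 1) r) r := by
  obtain ⟨C, c, hC, hc, hcb, h⟩ := exists_besselKernel_le (b - 1) (half_pos hr)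
  have hder := (hasDerivAt_integral_of_dominated_loc_of_deriv_le
    (μ := volume.restrict (Set.Ioi (0 : ℝ))) (F := fun r s => besselKernel b r s)
    (F' := fun r s => -(r / 2) * besselKernel (b - 1) r s) (x₀ := r)
    (s := Set.Ioo (r / 2) (2 * r))
    (bound := fun s => r * (C * (s ^ (c + (b - 1) - 1) * Real.exp (-(1 / 2) * s))))
    (Ioo_mem_nhds (by linarith) (by linarith))
    (Eventually.of_forall fun r => aestronglyMeasurable_besselKernel b r)
    (integrableOn_besselKernel b hr)
    ((aestronglyMeasurable_besselKernel (b - 1) r).const_mul _) ?_ ?_ ?_).2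
  · rw [integral_const_mul] at hder
    exact hder
  · filter_upwards [ae_restrict_mem measurableSet_Ioi] with s hs x hx
    have hx0 : 0 < x := (half_pos hr).trans hx.1
    have hk := besselKernel_nonneg (b - 1) x hs
    rw [norm_mul, Real.norm_of_nonneg hk, norm_neg, Real.norm_of_nonneg (by positivity)]
    have hs0 : 0 ≤ s ^ (c + (b - 1) - 1) * Real.exp (-(1 / 2) * s) :=
      mul_nonneg (Real.rpow_nonneg (le_of_lt hs) _) (Real.exp_pos _).le
    have h1 : besselKernel (b - 1) x s ≤ C * (s ^ (c + (b - 1) - 1) * Real.exp (-(1 / 2) * s)) := by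
      refine (h x hx.1.le s hs).trans ?_
      have : Real.exp (-(x / 2)) ≤ 1 := Real.exp_le_one_iff.2 (by linarith)
      have : C * Real.exp (-(x / 2)) ≤ C := mul_le_of_le_one_right hC.le this
      gcongr
    have h2 : x / 2 ≤ r := by linarith [hx.2]
    gcongr
  · exact ((integrableOn_rpow_mul_exp_half hcb).const_mul _).const_mul _
  · filter_upwards [ae_restrict_mem measurableSet_Ioi] with s hs x hx
    have hs' : 0 < s := hs
    have h1 : HasDerivAt (fun x : ℝ => -s - x ^ 2 / (4 * s)) (-(2 * x / (4 * s))) x := by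
      simpa using ((hasDerivAt_pow 2 x).div_const (4 * s)).const_sub (-s)
    have h2 := h1.exp.mul_const (s ^ (b - 1))
    refine h2.congr_deriv ?_
    unfold besselKernel
    rw [Real.rpow_sub_one hs'.ne' (b - 1)]
    field_simp
    ring

/-- Integrate the derivative of `exp (-s - r²/(4s)) s^b` over `(0, ∞)`; both boundary terms vanish.
This is the three-term recurrence of the Bessel functions. -/
theorem besselInt_add_one (b : ℝ) {r : ℝ} (hr : 0 < r) :
    besselInt (b + 1) r = r ^ 2 / 4 * besselInt (b - 1) r + b * besselInt b r := by
  obtain ⟨C, c, hC, hc, hcb, h⟩ := exists_besselKernel_le b hr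
  have hi := fun b => integrableOn_besselKernel b hr
  have hd (s : ℝ) (hs : s ∈ Set.Ioi (0 : ℝ)) : HasDerivAt (besselKernel (b + 1) r)
      (-besselKernel (b + 1) r s + r ^ 2 / 4 * besselKernel (b - 1) r s
        + b * besselKernel b r s) s := by
    have hs' : 0 < s := hs
    have h1 : HasDerivAt (fun s : ℝ => -s - r ^ 2 / (4 * s))
        (-1 - (0 * (4 * s) - r ^ 2 * (4 * 1)) / (4 * s) ^ 2) s :=
      (hasDerivAt_id s).neg.sub ((hasDerivAt_const s (r ^ 2)).div
        ((hasDerivAt_id s).const_mul 4) (by positivity))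
    have h2 := h1.exp.mul (Real.hasDerivAt_rpow_const (p := b + 1 - 1) (Or.inl hs'.ne'))
    refine h2.congr_deriv ?_
    unfold besselKernel
    rw [Real.rpow_sub_one hs'.ne' (b - 1), Real.rpow_sub_one hs'.ne' b, add_sub_cancel_right,
      Real.rpow_sub_one hs'.ne' b]
    field_simp
    ring
  have hi' : IntegrableOn (fun s => -besselKernel (b + 1) r s + r ^ 2 / 4 * besselKernel (b - 1) r s
      + b * besselKernel b r s) (Set.Ioi 0) :=
    ((hi _).neg.add ((hi _).const_mul _)).add ((hi _).const_mul _)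
  have h0 : Tendsto (besselKernel (b + 1) r) (𝓝[>] 0) (𝓝 0) := by
    have h1 : Tendsto (fun s : ℝ => C * Real.exp (-(r / 2)) * s ^ (c + b)) (𝓝[>] 0) (𝓝 0) := by
      have h2 : ContinuousAt (fun s : ℝ => C * Real.exp (-(r / 2)) * s ^ (c + b)) 0 :=
        (Real.continuousAt_rpow_const 0 (c + b) (Or.inr hcb.le)).const_mul _
      have h3 := h2.tendsto
      rw [Real.zero_rpow hcb.ne', mul_zero] at h3
      exact h3.mono_left nhdsWithin_le_nhds
    refine tendsto_of_tendsto_of_tendsto_of_le_of_le' tendsto_const_nhds h1 ?_ ?_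
    · filter_upwards [self_mem_nhdsWithin] with s hs using besselKernel_nonneg _ _ hs
    · filter_upwards [self_mem_nhdsWithin] with s hs
      have hs' : 0 < s := hs
      have h2 : besselKernel (b + 1) r s = besselKernel b r s * s := by
        unfold besselKernel
        rw [add_sub_cancel_right, Real.rpow_sub_one hs'.ne']
        field_simp
      have h3 : s ^ (c + b) = s ^ (c + b - 1) * s := by
        rw [Real.rpow_sub_one hs'.ne']
        field_simp
      have h4 : Real.exp (-(1 / 2) * s) ≤ 1 := Real.exp_le_one_iff.2 (by linarith)
      have h5 := Real.rpow_nonneg hs'.le (c + b - 1)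
      rw [h2, h3, ← mul_assoc]
      refine mul_le_mul_of_nonneg_right ((h r le_rfl s hs').trans ?_) hs'.le
      exact mul_le_mul_of_nonneg_left (mul_le_of_le_one_right h5 h4) (by positivity)
  have htop := tendsto_zero_of_hasDerivAt_of_integrableOn_Ioi hd hi' (hi (b + 1))
  -- Division by zero makes the kernel equal to `0 ^ b` at `s = 0`, which is `1` when `b = 0`.
  -- Resetting this value to `0` makes the primitive continuous from the right.
  have heq {s : ℝ} (hs : 0 < s) :
      Function.update (besselKernel (b + 1) r) 0 0 =ᶠ[𝓝 s] besselKernel (b + 1) r := by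
    filter_upwards [Ioi_mem_nhds hs] with t ht
    exact Function.update_of_ne (ne_of_gt ht) _ _
  have hint := integral_Ioi_of_hasDerivAt_of_tendsto (a := 0) (m := 0)
    (f := Function.update (besselKernel (b + 1) r) 0 0) (f' := fun s => -besselKernel (b + 1) r s
      + r ^ 2 / 4 * besselKernel (b - 1) r s + b * besselKernel b r s) ?_
    (fun s hs => (hd s hs).congr_of_eventuallyEq (heq hs)) hi' ?_
  · have hA : IntegrableOn (fun s => -besselKernel (b + 1) r s + r ^ 2 / 4 * besselKernel (b - 1) r s)
        (Set.Ioi 0) := (hi _).neg.add ((hi _).const_mul _)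
    have hB : IntegrableOn (fun s => -besselKernel (b + 1) r s) (Set.Ioi 0) := (hi _).neg
    rw [Function.update_self, sub_zero, integral_add hA ((hi _).const_mul _),
      integral_add hB ((hi _).const_mul _), integral_neg,
      integral_const_mul, integral_const_mul] at hint
    simp only [besselInt]
    linarith
  · rw [← Set.Ioi_insert, continuousWithinAt_insert_self]
    have : ContinuousWithinAt (Function.update (besselKernel (b + 1) r) 0 0) (Set.Ioi 0) 0 := by
      rw [ContinuousWithinAt, Function.update_self]
      refine h0.congr' ?_
      filter_upwards [self_mem_nhdsWithin] with t ht
      exact (Function.update_of_ne (ne_of_gt ht) _ _).symm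
    exact this
  · refine htop.congr' ?_
    filter_upwards [Ioi_mem_atTop 0] with t ht
    exact (Function.update_of_ne (ne_of_gt ht) _ _).symm

/-- The substitution `s ↦ r²/(4s)` interchanges the two terms of the exponent. This is the symmetry
`K_b = K_{-b}`. -/
theorem besselInt_reflect (b : ℝ) {r : ℝ} (hr : 0 < r) :
    besselInt b r = (r / 2) ^ (2 * b) * besselInt (-b) r := by
  have hd : ∀ s ∈ Set.Ioi (0 : ℝ), HasDerivWithinAt (fun s : ℝ => r ^ 2 / 4 * s⁻¹)
      (r ^ 2 / 4 * -(s ^ 2)⁻¹) (Set.Ioi 0) s := fun s hs =>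
    ((hasDerivAt_inv (ne_of_gt hs)).const_mul _).hasDerivWithinAt
  have hinj : Set.InjOn (fun s : ℝ => r ^ 2 / 4 * s⁻¹) (Set.Ioi 0) := by
    intro s _ t _ hst
    have h4 : r ^ 2 / 4 ≠ 0 := by positivity
    exact inv_injective (mul_left_cancel₀ h4 hst)
  have himg : (fun s : ℝ => r ^ 2 / 4 * s⁻¹) '' Set.Ioi 0 = Set.Ioi 0 := by
    ext t
    constructor
    · rintro ⟨s, hs, rfl⟩
      have hs' : 0 < s := hs
      exact Set.mem_Ioi.2 (by positivity)
    · intro ht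
      have ht' : 0 < t := ht
      refine ⟨r ^ 2 / 4 * t⁻¹, Set.mem_Ioi.2 (by positivity), ?_⟩
      field_simp
  have h := integral_image_eq_integral_abs_deriv_smul measurableSet_Ioi hd hinj (besselKernel b r)
  rw [himg] at h
  rw [besselInt, h, besselInt, ← integral_const_mul]
  refine setIntegral_congr_fun measurableSet_Ioi fun s hs => ?_
  have hs' : 0 < s := hs
  have h1 : |r ^ 2 / 4 * -(s ^ 2)⁻¹| = r ^ 2 / 4 / s ^ 2 := by
    rw [mul_neg, abs_neg, abs_of_pos (by positivity), div_eq_mul_inv _ (s ^ 2)]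
  have h2 : (r ^ 2 / 4 * s⁻¹) ^ (b - 1) = (r / 2) ^ (2 * b) * (r ^ 2 / 4)⁻¹ * (s * s ^ (-b)) := by
    rw [Real.mul_rpow (by positivity) (by positivity), Real.rpow_sub_one (by positivity),
      Real.inv_rpow hs'.le, Real.rpow_sub_one hs'.ne', Real.rpow_mul (by positivity),
      Real.rpow_neg hs'.le]
    have h3 : (r / 2) ^ (2 : ℝ) = r ^ 2 / 4 := by
      rw [Real.rpow_two]; ring
    rw [h3]
    field_simp
  have h3 : s ^ (-b - 1) = s ^ (-b) / s := Real.rpow_sub_one hs'.ne' _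
  simp only [smul_eq_mul, besselKernel]
  rw [h1, h2, h3]
  have h4 : -(r ^ 2 / 4 * s⁻¹) - r ^ 2 / (4 * (r ^ 2 / 4 * s⁻¹)) = -s - r ^ 2 / (4 * s) := by
    field_simp
    ring
  rw [h4]
  field_simp

theorem besselKernel_le (b r : ℝ) {s : ℝ} (hs : 0 < s) :
    besselKernel b r s ≤ Real.exp (-s) * s ^ (b - 1) := by
  unfold besselKernel
  have h1 : 0 ≤ r ^ 2 / (4 * s) := by positivity
  have h2 := Real.rpow_nonneg hs.le (b - 1)
  gcongr
  linarith

theorem besselInt_zero_right {b : ℝ} (hb : 0 < b) : besselInt b 0 = Real.Gamma b := by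
  rw [Real.Gamma_eq_integral hb, besselInt]
  simp [besselKernel]

theorem besselInt_le_Gamma {b : ℝ} (hb : 0 < b) (r : ℝ) : besselInt b r ≤ Real.Gamma b := by
  rw [Real.Gamma_eq_integral hb, besselInt]
  refine integral_mono_of_nonneg ?_ (Real.GammaIntegral_convergent hb) ?_
  · filter_upwards [ae_restrict_mem measurableSet_Ioi] with s hs
    exact besselKernel_nonneg b r hs
  · filter_upwards [ae_restrict_mem measurableSet_Ioi] with s hs
    exact besselKernel_le b r hs

theorem continuous_besselInt {b : ℝ} (hb : 0 < b) : Continuous (besselInt b) := by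
  refine continuous_of_dominated (bound := fun s => Real.exp (-s) * s ^ (b - 1))
    (fun r => aestronglyMeasurable_besselKernel b r) (fun r => ?_)
    (Real.GammaIntegral_convergent hb) ?_
  · filter_upwards [ae_restrict_mem measurableSet_Ioi] with s hs
    rw [Real.norm_of_nonneg (besselKernel_nonneg b r hs)]
    exact besselKernel_le b r hs
  · filter_upwards [ae_restrict_mem measurableSet_Ioi] with s hs
    unfold besselKernel
    fun_prop

theorem hasDerivAt_besselInt_mul (b : ℝ) {κ y : ℝ} (hκ : 0 ≤ κ) (hy : 0 < y) :
    HasDerivAt (fun y => besselInt b (κ * y)) (-(κ ^ 2 * y / 2) * besselInt (b - 1) (κ * y)) y := by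
  -- For `κ = 0` the function is constant, whatever value the possibly divergent integral at `r = 0`
  -- is given.
  rcases hκ.eq_or_lt with rfl | hκ
  · simpa using hasDerivAt_const y (besselInt b 0)
  · have h := (hasDerivAt_besselInt b (mul_pos hκ hy)).comp y ((hasDerivAt_id y).const_mul κ)
    refine h.congr_deriv ?_
    ring

/-- The second derivative involves parameter `b - 2`; the recurrence at `b - 1` trades it for `b`
and `b - 1`, which produces the ordinary differential equation. -/
theorem hasDerivAt_deriv_besselInt_mul (b : ℝ) {κ y : ℝ} (hκ : 0 ≤ κ) (hy : 0 < y) :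
    HasDerivAt (fun y => -(κ ^ 2 * y / 2) * besselInt (b - 1) (κ * y))
      (κ ^ 2 * besselInt b (κ * y)
        - (1 - 2 * b) / y * (-(κ ^ 2 * y / 2) * besselInt (b - 1) (κ * y))) y := by
  rcases hκ.eq_or_lt with rfl | hκ
  · simpa using hasDerivAt_const y (0 : ℝ)
  · have h1 : HasDerivAt (fun y : ℝ => -(κ ^ 2 * y / 2)) (-(κ ^ 2 * 1 / 2)) y :=
      (((hasDerivAt_id y).const_mul (κ ^ 2)).div_const 2).neg
    refine (h1.mul (hasDerivAt_besselInt_mul (b - 1) hκ.le hy)).congr_deriv ?_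
    have h2 := besselInt_add_one (b - 1) (mul_pos hκ hy)
    rw [sub_add_cancel] at h2
    rw [h2]
    field_simp
    ring

/-- Reflection replaces the parameter `σ - 1`, singular at the origin, by `1 - σ`, for which the
integral is continuous up to `0`. The powers of `y` outside the integral cancel exactly. -/
theorem flux_besselInt {σ : ℝ} (hσ0 : 0 < σ) {κ y : ℝ} (hκ : 0 ≤ κ) (hy : 0 < y) :
    -(y ^ (1 - 2 * σ) * (-(κ ^ 2 * y / 2) * besselInt (σ - 1) (κ * y))) =
      (4 : ℝ) ^ (1 / 2 - σ) * κ ^ (2 * σ) * besselInt (1 - σ) (κ * y) := by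
  rcases hκ.eq_or_lt with rfl | hκ
  · rw [Real.zero_rpow (by positivity)]
    simp
  · rw [besselInt_reflect (σ - 1) (mul_pos hκ hy), neg_sub, Real.div_rpow (by positivity) (by norm_num),
      Real.mul_rpow hκ.le hy.le]
    have h4 : (4 : ℝ) ^ (1 / 2 - σ) = 2 * 2 ^ (-(2 * σ)) := by
      rw [show (4 : ℝ) = 2 ^ (2 : ℝ) by norm_num, ← Real.rpow_mul (by norm_num),
        show 2 * (1 / 2 - σ) = -(2 * σ) + 1 by ring, Real.rpow_add_one (by norm_num)]
      ring
    have e (x : ℝ) (hx : 0 < x) : x ^ (2 * (σ - 1)) = x ^ (2 * σ) / x ^ 2 := by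
      rw [mul_sub, mul_one, Real.rpow_sub hx, Real.rpow_two]
    have e' : y ^ (1 - 2 * σ) = y / y ^ (2 * σ) := by rw [Real.rpow_sub hy, Real.rpow_one]
    rw [h4, e κ hκ, e y hy, e 2 (by norm_num), e', Real.rpow_neg (by norm_num)]
    have := Real.rpow_pos_of_pos hy (2 * σ)
    have := Real.rpow_pos_of_pos hκ (2 * σ)
    have := Real.rpow_pos_of_pos (show (0 : ℝ) < 2 by norm_num) (2 * σ)
    field_simp

/-- The profile `Γ(σ)⁻¹ ∫₀^∞ exp (-s - r² / (4 s)) s ^ (σ - 1) ds`, equal to one at the origin. -/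
noncomputable def extProfile (σ r : ℝ) : ℝ := besselInt σ r / Real.Gamma σ

theorem extProfile_nonneg {σ : ℝ} (hσ : 0 < σ) (r : ℝ) : 0 ≤ extProfile σ r :=
  div_nonneg (besselInt_nonneg σ r) (Real.Gamma_pos_of_pos hσ).le

theorem extProfile_le_one {σ : ℝ} (hσ : 0 < σ) (r : ℝ) : extProfile σ r ≤ 1 :=
  div_le_one_of_le₀ (besselInt_le_Gamma hσ r) (Real.Gamma_pos_of_pos hσ).le

theorem tendsto_extProfile {σ : ℝ} (hσ : 0 < σ) (κ : ℝ) :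
    Tendsto (fun y => extProfile σ (κ * y)) (𝓝[>] 0) (𝓝 1) := by
  have h1 : Continuous fun y => extProfile σ (κ * y) :=
    ((continuous_besselInt hσ).comp (continuous_const.mul continuous_id)).div_const _
  have h2 := h1.tendsto 0
  rw [mul_zero, extProfile, besselInt_zero_right hσ, div_self (Real.Gamma_pos_of_pos hσ).ne'] at h2
  exact h2.mono_left nhdsWithin_le_nhds

/-- The first derivative of `y ↦ extProfile σ (κ y)`. -/
noncomputable def extProfileDeriv (σ κ y : ℝ) : ℝ :=
  -(κ ^ 2 * y / 2) * besselInt (σ - 1) (κ * y) / Real.Gamma σ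

theorem hasDerivAt_extProfile (σ : ℝ) {κ y : ℝ} (hκ : 0 ≤ κ) (hy : 0 < y) :
    HasDerivAt (fun y => extProfile σ (κ * y)) (extProfileDeriv σ κ y) y :=
  (hasDerivAt_besselInt_mul σ hκ hy).div_const _

theorem hasDerivAt_extProfileDeriv (σ : ℝ) {κ y : ℝ} (hκ : 0 ≤ κ) (hy : 0 < y) :
    HasDerivAt (extProfileDeriv σ κ)
      (κ ^ 2 * extProfile σ (κ * y) - (1 - 2 * σ) / y * extProfileDeriv σ κ y) y := by
  refine ((hasDerivAt_deriv_besselInt_mul σ hκ hy).div_const (Real.Gamma σ)).congr_deriv ?_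
  unfold extProfile extProfileDeriv
  ring

/-- `extConst` is what remains of `flux_besselInt` once `besselInt (1 - σ)` is normalised by `Γ(1 -
σ)` and `besselInt σ` by `Γ(σ)`. -/
theorem flux_extProfile {σ : ℝ} (hσ0 : 0 < σ) (hσ1 : σ < 1) {κ y : ℝ} (hκ : 0 ≤ κ) (hy : 0 < y) :
    -(y ^ (1 - 2 * σ) * extProfileDeriv σ κ y) =
      extConst σ * (κ ^ (2 * σ) * extProfile (1 - σ) (κ * y)) := by
  have h := flux_besselInt hσ0 hκ hy
  have h1 := Real.Gamma_pos_of_pos (show 0 < 1 - σ by linarith)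
  have h2 := Real.Gamma_pos_of_pos hσ0
  have h4 : (4 : ℝ) ^ (1 / 2 - σ) = ((4 : ℝ) ^ (σ - 1 / 2))⁻¹ := by
    rw [← Real.rpow_neg (by norm_num), neg_sub]
  rw [h4] at h
  have h5 := Real.rpow_pos_of_pos (show (0 : ℝ) < 4 by norm_num) (σ - 1 / 2)
  unfold extProfileDeriv extProfile extConst
  rw [mul_div_assoc', ← neg_div, h]
  field_simp

theorem extConst_pos {σ : ℝ} (hσ0 : 0 < σ) (hσ1 : σ < 1) : 0 < extConst σ :=
  div_pos (Real.Gamma_pos_of_pos (by linarith))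
    (mul_pos (Real.rpow_pos_of_pos (by norm_num) _) (Real.Gamma_pos_of_pos hσ0))

end BesselInt

/-! ### Uniqueness for the ordinary differential equation -/

section ODE

/-- The flux `p = y^{1-2σ} (e²)'` has derivative `2 y^{1-2σ} (e'² + κ² e²) ≥ 0`. If it were positive
somewhere, `e²` would grow at least like `y^{2σ}`, against boundedness. Hence `p ≤ 0`, so `e²` is
nonincreasing, and it starts from the limit `0`. The case `κ = 0` is covered. -/
theorem eq_zero_of_bounded_of_ode_real {σ κ : ℝ} (hσ : 0 < σ) {e e' : ℝ → ℝ}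
    (h1 : ∀ y, 0 < y → HasDerivAt e (e' y) y)
    (h2 : ∀ y, 0 < y → HasDerivAt e' (κ ^ 2 * e y - (1 - 2 * σ) / y * e' y) y)
    {C : ℝ} (hC : ∀ y, 0 < y → |e y| ≤ C) (h0 : Tendsto e (𝓝[>] 0) (𝓝 0)) :
    ∀ y, 0 < y → e y = 0 := by
  set p : ℝ → ℝ := fun y => y ^ (1 - 2 * σ) * (2 * (e y * e' y)) with hp
  have hpd (y : ℝ) (hy : 0 < y) :
      HasDerivAt p (2 * y ^ (1 - 2 * σ) * (e' y ^ 2 + κ ^ 2 * e y ^ 2)) y := by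
    have := (Real.hasDerivAt_rpow_const (p := 1 - 2 * σ) (Or.inl hy.ne')).mul
      (((h1 y hy).mul (h2 y hy)).const_mul 2)
    refine this.congr_deriv ?_
    simp only [Pi.mul_apply]
    rw [Real.rpow_sub_one hy.ne']
    field_simp
    ring
  have hpm : MonotoneOn p (Set.Ioi 0) := by
    refine monotoneOn_of_deriv_nonneg (convex_Ioi 0)
      (fun y hy => (hpd y hy).continuousAt.continuousWithinAt)
      (fun y hy => ((hpd y (interior_subset hy)).differentiableAt).differentiableWithinAt)
      fun y hy => ?_
    have hy' : 0 < y := interior_subset hy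
    rw [(hpd y hy').deriv]
    positivity
  have hqd (y : ℝ) (hy : 0 < y) : HasDerivAt (fun y => e y ^ 2) (y ^ (2 * σ - 1) * p y) y := by
    refine ((h1 y hy).pow 2).congr_deriv ?_
    have : y ^ (2 * σ - 1) * y ^ (1 - 2 * σ) = 1 := by
      rw [← Real.rpow_add hy]; simp
    simp only [hp]
    linear_combination (-(2 * (e y * e' y))) * this
  have hpn (y₀ : ℝ) (hy₀ : 0 < y₀) : p y₀ ≤ 0 := by
    by_contra! hpos
    -- The subtracted term is a primitive of `p y₀ · y^{2σ-1}`, the lower bound for `(e²)'` beyond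
    -- `y₀`.
    set q : ℝ → ℝ := fun y => e y ^ 2 - p y₀ / (2 * σ) * y ^ (2 * σ) with hq
    have hqd' (y : ℝ) (hy : 0 < y) : HasDerivAt q (y ^ (2 * σ - 1) * (p y - p y₀)) y := by
      refine ((hqd y hy).sub ((Real.hasDerivAt_rpow_const (p := 2 * σ)
        (Or.inl hy.ne')).const_mul _)).congr_deriv ?_
      field_simp
    have hqm : MonotoneOn q (Set.Ici y₀) := by
      refine monotoneOn_of_deriv_nonneg (convex_Ici y₀)
        (fun y hy => (hqd' y (hy₀.trans_le hy)).continuousAt.continuousWithinAt)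
        (fun y hy => (hqd' y (hy₀.trans_le (interior_subset hy))).differentiableAt.differentiableWithinAt)
        fun y hy => ?_
      have hy1 : y₀ ≤ y := interior_subset hy
      have hy' : 0 < y := hy₀.trans_le hy1
      rw [(hqd' y hy').deriv]
      exact mul_nonneg (Real.rpow_nonneg hy'.le _) (sub_nonneg.2 (hpm hy₀ hy' hy1))
    have htop : Tendsto (fun y : ℝ => q y₀ + p y₀ / (2 * σ) * y ^ (2 * σ)) atTop atTop :=
      tendsto_atTop_add_const_left _ _
        ((tendsto_rpow_atTop (by positivity)).const_mul_atTop (by positivity))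
    obtain ⟨y, hy1, hy2⟩ := ((htop.eventually_gt_atTop (C ^ 2)).and (eventually_ge_atTop y₀)).exists
    have h3 := hqm Set.self_mem_Ici hy2 hy2
    have h4 : e y ^ 2 ≤ C ^ 2 := sq_le_sq' (abs_le.1 (hC y (hy₀.trans_le hy2))).1
      (abs_le.1 (hC y (hy₀.trans_le hy2))).2
    simp only [hq] at h3 hy1
    linarith
  have hqa : AntitoneOn (fun y => e y ^ 2) (Set.Ioi 0) := by
    refine antitoneOn_of_deriv_nonpos (convex_Ioi 0)
      (fun y hy => (hqd y hy).continuousAt.continuousWithinAt)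
      (fun y hy => ((hqd y (interior_subset hy)).differentiableAt).differentiableWithinAt)
      fun y hy => ?_
    have hy' : 0 < y := interior_subset hy
    rw [(hqd y hy').deriv]
    exact mul_nonpos_of_nonneg_of_nonpos (Real.rpow_nonneg hy'.le _) (hpn y hy')
  intro y hy
  have h3 : Tendsto (fun t => e t ^ 2) (𝓝[>] 0) (𝓝 0) := by simpa using h0.pow 2
  have h4 : e y ^ 2 ≤ 0 := by
    refine ge_of_tendsto h3 ?_
    filter_upwards [Ioo_mem_nhdsGT hy] with t ht
    exact hqa ht.1 hy ht.2.le
  exact pow_eq_zero_iff (two_ne_zero) |>.1 (le_antisymm h4 (sq_nonneg _))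

theorem eq_zero_of_bounded_of_ode {σ κ : ℝ} (hσ : 0 < σ) {e e' : ℝ → ℂ}
    (h1 : ∀ y, 0 < y → HasDerivAt e (e' y) y)
    (h2 : ∀ y, 0 < y → HasDerivAt e'
      (((κ ^ 2 : ℝ) : ℂ) * e y - (((1 - 2 * σ) / y : ℝ) : ℂ) * e' y) y)
    {C : ℝ} (hC : ∀ y, 0 < y → ‖e y‖ ≤ C) (h0 : Tendsto e (𝓝[>] 0) (𝓝 0)) :
    ∀ y, 0 < y → e y = 0 := by
  intro y hy
  refine Complex.ext ?_ ?_
  · refine eq_zero_of_bounded_of_ode_real (κ := κ) hσ (e := fun y => (e y).re)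
      (e' := fun y => (e' y).re)
      (fun y hy => Complex.reCLM.hasFDerivAt.comp_hasDerivAt y (h1 y hy)) (fun y hy => ?_)
      (fun y hy => (Complex.abs_re_le_norm _).trans (hC y hy))
      ((Complex.continuous_re.tendsto _).comp h0) y hy
    refine (Complex.reCLM.hasFDerivAt.comp_hasDerivAt y (h2 y hy)).congr_deriv ?_
    simp only [Complex.reCLM_apply, Complex.sub_re, Complex.re_ofReal_mul]
  · refine eq_zero_of_bounded_of_ode_real (κ := κ) hσ (e := fun y => (e y).im)
      (e' := fun y => (e' y).im)
      (fun y hy => Complex.imCLM.hasFDerivAt.comp_hasDerivAt y (h1 y hy)) (fun y hy => ?_)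
      (fun y hy => (Complex.abs_im_le_norm _).trans (hC y hy))
      ((Complex.continuous_im.tendsto _).comp h0) y hy
    refine (Complex.imCLM.hasFDerivAt.comp_hasDerivAt y (h2 y hy)).congr_deriv ?_
    simp only [Complex.imCLM_apply, Complex.sub_im, Complex.im_ofReal_mul]

end ODE

/-! ### Fourier coefficients of twice differentiable functions -/

section LineDerivatives

variable {F : Type*} [NormedAddCommGroup F] [NormedSpace ℝ F]

theorem ContDiffOn.hasDerivAt_line {f : F → ℝ} {Ω : Set F} (hf : ContDiffOn ℝ 2 f Ω)
    (hΩ : IsOpen Ω) (p h : F) {t : ℝ} (ht : p + t • h ∈ Ω) :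
    HasDerivAt (fun t : ℝ => f (p + t • h)) (fderiv ℝ f (p + t • h) h) t := by
  have h1 : HasFDerivAt f (fderiv ℝ f (p + t • h)) (p + t • h) :=
    ((hf.contDiffAt (hΩ.mem_nhds ht)).differentiableAt (by norm_num)).hasFDerivAt
  have h2 : HasDerivAt (fun t : ℝ => p + t • h) h t := by
    simpa using ((hasDerivAt_id t).smul_const h).const_add p
  exact h1.comp_hasDerivAt t h2

theorem ContDiffOn.hasDerivAt_fderiv_line {f : F → ℝ} {Ω : Set F} (hf : ContDiffOn ℝ 2 f Ω)
    (hΩ : IsOpen Ω) (p h : F) {t : ℝ} (ht : p + t • h ∈ Ω) :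
    HasDerivAt (fun t : ℝ => fderiv ℝ f (p + t • h) h)
      (fderiv ℝ (fderiv ℝ f) (p + t • h) h h) t := by
  have h0 : ContDiffOn ℝ 1 (fderiv ℝ f) Ω := hf.fderiv_of_isOpen hΩ (by norm_num)
  have h1 : HasFDerivAt (fderiv ℝ f) (fderiv ℝ (fderiv ℝ f) (p + t • h)) (p + t • h) :=
    ((h0.contDiffAt (hΩ.mem_nhds ht)).differentiableAt (by norm_num)).hasFDerivAt
  have h2 : HasDerivAt (fun t : ℝ => p + t • h) h t := by
    simpa using ((hasDerivAt_id t).smul_const h).const_add p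
  have h3 : HasDerivAt (fun t : ℝ => fderiv ℝ f (p + t • h))
      (fderiv ℝ (fderiv ℝ f) (p + t • h) h) t := h1.comp_hasDerivAt t h2
  exact (ContinuousLinearMap.apply ℝ ℝ h).hasFDerivAt.comp_hasDerivAt t h3

theorem fderiv_add_of_periodic {G : Type*} [NormedAddCommGroup G] [NormedSpace ℝ G] {f : F → G}
    {m : F} (hf : ∀ p, f (p + m) = f p) (p : F) : fderiv ℝ f (p + m) = fderiv ℝ f p := by
  rw [← fderiv_comp_add_right]
  simp only [hf]

end LineDerivatives

/-! ### Derivatives of the periodic lift as functions on the torus, and their Fourier coefficients.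
-/

section TorusDerivatives

variable {n : ℕ}

/-- A section of the quotient map `ℝⁿ → ℝⁿ / 2πℤⁿ`. -/
noncomputable def Torus.lift (z : Torus n) : EuclideanSpace ℝ (Fin n) :=
  Function.surjInv Torus.isOpenQuotientMap_mk.surjective z

theorem Torus.mk_lift (z : Torus n) : Torus.mk z.lift = z :=
  Function.surjInv_eq Torus.isOpenQuotientMap_mk.surjective z

/-- The first derivative in direction `h` of the periodic lift of `V`. -/
noncomputable def torusDeriv (V : Torus n → ℝ → ℝ) (h : EuclideanSpace ℝ (Fin n) × ℝ)
    (z : Torus n) (y : ℝ) : ℝ :=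
  fderiv ℝ (fun p : EuclideanSpace ℝ (Fin n) × ℝ => V (Torus.mk p.1) p.2) (z.lift, y) h

/-- The second derivative in direction `h` of the periodic lift of `V`. -/
noncomputable def torusDeriv₂ (V : Torus n → ℝ → ℝ) (h : EuclideanSpace ℝ (Fin n) × ℝ)
    (z : Torus n) (y : ℝ) : ℝ :=
  fderiv ℝ (fderiv ℝ fun p : EuclideanSpace ℝ (Fin n) × ℝ => V (Torus.mk p.1) p.2) (z.lift, y) h h

/-- The half space `ℝⁿ × (0, ∞)`. -/
def halfSpace (n : ℕ) : Set (EuclideanSpace ℝ (Fin n) × ℝ) := Set.univ ×ˢ Set.Ioi 0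

theorem isOpen_halfSpace : IsOpen (halfSpace n) := isOpen_univ.prod isOpen_Ioi

theorem mem_halfSpace {p : EuclideanSpace ℝ (Fin n) × ℝ} : p ∈ halfSpace n ↔ 0 < p.2 := by
  simp [halfSpace]

theorem periodic_lift (V : Torus n → ℝ → ℝ) {x x' : EuclideanSpace ℝ (Fin n)}
    (h : Torus.mk x = Torus.mk x') (p : EuclideanSpace ℝ (Fin n) × ℝ) :
    V (Torus.mk (p + (x' - x, 0)).1) (p + (x' - x, 0)).2 = V (Torus.mk p.1) p.2 := by
  simp [Torus.mk_add, Torus.mk_sub, h]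

/-- `Torus.lift` is an arbitrary section, with no continuity. Periodicity makes the derivative
independent of the chosen representative. -/
theorem torusDeriv_mk (V : Torus n → ℝ → ℝ) (h : EuclideanSpace ℝ (Fin n) × ℝ)
    (x : EuclideanSpace ℝ (Fin n)) (y : ℝ) : torusDeriv V h (Torus.mk x) y =
      fderiv ℝ (fun p : EuclideanSpace ℝ (Fin n) × ℝ => V (Torus.mk p.1) p.2) (x, y) h := by
  have h1 := fderiv_add_of_periodic
    (f := fun p : EuclideanSpace ℝ (Fin n) × ℝ => V (Torus.mk p.1) p.2) (periodic_lift V (Torus.mk_lift (Torus.mk x))) ((Torus.mk x).lift, y)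
  have h2 : ((Torus.mk x).lift, y) + (x - (Torus.mk x).lift, 0) = (x, y) := by simp
  rw [h2] at h1
  rw [torusDeriv, h1]

theorem torusDeriv₂_mk (V : Torus n → ℝ → ℝ) (h : EuclideanSpace ℝ (Fin n) × ℝ)
    (x : EuclideanSpace ℝ (Fin n)) (y : ℝ) : torusDeriv₂ V h (Torus.mk x) y =
      fderiv ℝ (fderiv ℝ fun p : EuclideanSpace ℝ (Fin n) × ℝ => V (Torus.mk p.1) p.2)
        (x, y) h h := by
  have h1 := fderiv_add_of_periodic (fderiv_add_of_periodic
    (f := fun p : EuclideanSpace ℝ (Fin n) × ℝ => V (Torus.mk p.1) p.2) (periodic_lift V (Torus.mk_lift (Torus.mk x)))) ((Torus.mk x).lift, y)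
  have h2 : ((Torus.mk x).lift, y) + (x - (Torus.mk x).lift, 0) = (x, y) := by simp
  rw [h2] at h1
  rw [torusDeriv₂, h1]

/-- Continuity descends because the covering map is an open quotient map, and remains one after
taking the product with `ℝ`. -/
theorem continuousAt_torus_of_comp {G : Torus n → ℝ → ℝ}
    (hG : ContinuousOn (fun p : EuclideanSpace ℝ (Fin n) × ℝ => G (Torus.mk p.1) p.2) (halfSpace n))
    (z : Torus n) {y : ℝ} (hy : 0 < y) :
    ContinuousAt (fun q : Torus n × ℝ => G q.1 q.2) (z, y) := by
  have h1 := (Torus.isOpenQuotientMap_mk (n := n)).prodMap (IsOpenQuotientMap.id (X := ℝ))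
  have h2 := h1.continuousAt_comp_iff (g := fun q : Torus n × ℝ => G q.1 q.2) (x := (z.lift, y))
  rw [Prod.map_apply, Torus.mk_lift] at h2
  exact h2.1 (hG.continuousAt (isOpen_halfSpace.mem_nhds (mem_halfSpace.2 hy)))

variable {V : Torus n → ℝ → ℝ}
  (hV : ContDiffOn ℝ 2 (fun p : EuclideanSpace ℝ (Fin n) × ℝ => V (Torus.mk p.1) p.2) (halfSpace n))

include hV

theorem continuousAt_torus (z : Torus n) {y : ℝ} (hy : 0 < y) :
    ContinuousAt (fun q : Torus n × ℝ => V q.1 q.2) (z, y) :=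
  continuousAt_torus_of_comp hV.continuousOn z hy

theorem continuousAt_torusDeriv (h : EuclideanSpace ℝ (Fin n) × ℝ) (z : Torus n) {y : ℝ}
    (hy : 0 < y) : ContinuousAt (fun q : Torus n × ℝ => torusDeriv V h q.1 q.2) (z, y) := by
  refine continuousAt_torus_of_comp ?_ z hy
  simp only [torusDeriv_mk]
  exact (hV.continuousOn_fderiv_of_isOpen isOpen_halfSpace (by norm_num)).clm_apply
    continuousOn_const

theorem continuousAt_torusDeriv₂ (h : EuclideanSpace ℝ (Fin n) × ℝ) (z : Torus n) {y : ℝ}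
    (hy : 0 < y) : ContinuousAt (fun q : Torus n × ℝ => torusDeriv₂ V h q.1 q.2) (z, y) := by
  refine continuousAt_torus_of_comp ?_ z hy
  simp only [torusDeriv₂_mk]
  exact (((hV.fderiv_of_isOpen isOpen_halfSpace (m := 1) (by norm_num)).continuousOn_fderiv_of_isOpen
    isOpen_halfSpace le_rfl).clm_apply continuousOn_const).clm_apply continuousOn_const

theorem hasDerivAt_torus_snd (z : Torus n) {y : ℝ} (hy : 0 < y) :
    HasDerivAt (V z) (torusDeriv V (0, 1) z y) y := by
  have h := hV.hasDerivAt_line isOpen_halfSpace (z.lift, 0) (0, 1) (t := y)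
    (mem_halfSpace.2 (by simpa using hy))
  unfold torusDeriv
  simpa [Torus.mk_lift] using h

theorem hasDerivAt_torusDeriv_snd (z : Torus n) {y : ℝ} (hy : 0 < y) :
    HasDerivAt (torusDeriv V (0, 1) z) (torusDeriv₂ V (0, 1) z y) y := by
  have h := hV.hasDerivAt_fderiv_line isOpen_halfSpace (z.lift, 0) (0, 1) (t := y)
    (mem_halfSpace.2 (by simpa using hy))
  unfold torusDeriv torusDeriv₂
  simpa using h

theorem iteratedDeriv_two_torus (z : Torus n) {y : ℝ} (hy : 0 < y) :
    iteratedDeriv 2 (V z) y = torusDeriv₂ V (0, 1) z y := by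
  rw [iteratedDeriv_succ, iteratedDeriv_one]
  refine HasDerivAt.deriv ((hasDerivAt_torusDeriv_snd hV z hy).congr_of_eventuallyEq ?_)
  filter_upwards [Ioi_mem_nhds hy] with t ht using (hasDerivAt_torus_snd hV z ht).deriv

theorem hasDerivAt_torus_fst (e : EuclideanSpace ℝ (Fin n)) (z : Torus n) {y : ℝ} (hy : 0 < y) :
    HasDerivAt (fun t : ℝ => V (z + Torus.mk (t • e)) y) (torusDeriv V (e, 0) z y) 0 := by
  have h := hV.hasDerivAt_line isOpen_halfSpace (z.lift, y) (e, 0) (t := 0)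
    (mem_halfSpace.2 (by simpa using hy))
  unfold torusDeriv
  simpa [Torus.mk_lift, Torus.mk_add] using h

theorem hasDerivAt_torusDeriv_fst (e : EuclideanSpace ℝ (Fin n)) (z : Torus n) {y : ℝ}
    (hy : 0 < y) : HasDerivAt (fun t : ℝ => torusDeriv V (e, 0) (z + Torus.mk (t • e)) y)
      (torusDeriv₂ V (e, 0) z y) 0 := by
  have h := hV.hasDerivAt_fderiv_line isOpen_halfSpace (z.lift, y) (e, 0) (t := 0)
    (mem_halfSpace.2 (by simpa using hy))
  have h2 (t : ℝ) : torusDeriv V (e, 0) (z + Torus.mk (t • e)) y =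
      fderiv ℝ (fun p : EuclideanSpace ℝ (Fin n) × ℝ => V (Torus.mk p.1) p.2)
        ((z.lift, y) + t • (e, 0)) (e, 0) := by
    conv_lhs => rw [← Torus.mk_lift z, ← Torus.mk_add, torusDeriv_mk]
    simp
  simp only [h2]
  unfold torusDeriv₂
  simpa using h

theorem laplacian_torus (x : EuclideanSpace ℝ (Fin n)) {y : ℝ} (hy : 0 < y) :
    Laplacian.laplacian (fun x' : EuclideanSpace ℝ (Fin n) => V (Torus.mk x') y) x =
      ∑ i, torusDeriv₂ V (EuclideanSpace.single i 1, 0) (Torus.mk x) y := by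
  have hg : ContDiffOn ℝ 2 (fun x' : EuclideanSpace ℝ (Fin n) => V (Torus.mk x') y) Set.univ :=
    hV.comp (f := fun x' : EuclideanSpace ℝ (Fin n) => (x', y)) (by fun_prop)
      fun x' _ => mem_halfSpace.2 hy
  rw [laplacian_eq_iteratedFDeriv_orthonormalBasis _ (EuclideanSpace.basisFun (Fin n) ℝ)]
  refine Finset.sum_congr rfl fun i _ => ?_
  rw [iteratedFDeriv_two_apply]
  simp only [EuclideanSpace.basisFun_apply, Matrix.cons_val_zero, Matrix.cons_val_one]
  set e : EuclideanSpace ℝ (Fin n) := EuclideanSpace.single i 1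
  have h1 := hg.hasDerivAt_fderiv_line isOpen_univ x e (t := 0) trivial
  have h2 := hasDerivAt_torusDeriv_fst hV e (Torus.mk x) hy
  rw [zero_smul, add_zero] at h1
  -- Both are second derivatives at `t = 0` of the one-variable function `t ↦ V (Torus.mk (x + t •
  -- e)) y`.
  refine h1.unique (h2.congr_of_eventuallyEq (Eventually.of_forall fun t => ?_))
  have h3 := hg.hasDerivAt_line isOpen_univ (x + t • e) e (t := 0) trivial
  have h4 := hasDerivAt_torus_fst hV e (Torus.mk x + Torus.mk (t • e)) hy
  rw [zero_smul, add_zero] at h3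
  simp only [Torus.mk_add] at h3
  exact h3.unique h4

omit hV

/-- Compactness of the torus times a closed ball bounds `G'`, and this constant dominates when
differentiating under the integral. -/
theorem hasDerivAt_torusFourierCoeff {G G' : Torus n → ℝ → ℝ} {U : Set ℝ} (hU : IsOpen U)
    (hG : ∀ t ∈ U, Continuous fun z => G z t)
    (hG' : ∀ z, ∀ t ∈ U, ContinuousAt (fun q : Torus n × ℝ => G' q.1 q.2) (z, t))
    (hd : ∀ z, ∀ t ∈ U, HasDerivAt (G z) (G' z t) t) (k : Fin n → ℤ) {t : ℝ} (ht : t ∈ U) :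
    HasDerivAt (fun t => torusFourierCoeff (fun z => (G z t : ℂ)) k)
      (torusFourierCoeff (fun z => (G' z t : ℂ)) k) t := by
  obtain ⟨ε, hε, hεU⟩ := Metric.nhds_basis_closedBall.mem_iff.1 (hU.mem_nhds ht)
  have hc : ContinuousOn (fun q : Torus n × ℝ => G' q.1 q.2)
      (Set.univ ×ˢ Metric.closedBall t ε) := fun q hq =>
    (hG' q.1 q.2 (hεU hq.2)).continuousWithinAt
  obtain ⟨C, hC⟩ := (isCompact_univ.prod (isCompact_closedBall t ε)).exists_bound_of_continuousOn hc
  have hG't : Continuous fun z => G' z t := continuous_iff_continuousAt.2 fun z =>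
    (hG' z t ht).comp (f := fun z : Torus n => (z, t)) (by fun_prop)
  refine HasDerivAt.const_mul _ ?_
  refine (hasDerivAt_integral_of_dominated_loc_of_deriv_le (s := Metric.closedBall t ε)
    (F := fun t z => (G z t : ℂ) * torusExp (-k) z)
    (F' := fun t z => (G' z t : ℂ) * torusExp (-k) z) (bound := fun _ => C)
    (Metric.closedBall_mem_nhds t hε) ?_ ?_ ?_ ?_ (integrable_const C) ?_).2
  · filter_upwards [hU.mem_nhds ht] with s hs
    have := hG s hs
    exact Continuous.aestronglyMeasurable (by fun_prop)
  · have := hG t ht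
    exact integrable_of_continuous_torus (by fun_prop)
  · exact Continuous.aestronglyMeasurable (by fun_prop)
  · refine Eventually.of_forall fun z s hs => ?_
    rw [norm_mul, norm_torusExp, mul_one, Complex.norm_real]
    exact hC (z, s) ⟨trivial, hs⟩
  · exact Eventually.of_forall fun z s hs => ((hd z s (hεU hs)).ofReal_comp).mul_const _

theorem torusFourierCoeff_comp_add_right (f : Torus n → ℂ) (w : Torus n) (k : Fin n → ℤ) :
    torusFourierCoeff (fun z => f (z + w)) k = torusExp k w * torusFourierCoeff f k := by
  have h1 (z : Torus n) :
      f (z + w) * torusExp (-k) z = torusExp k w * (f (z + w) * torusExp (-k) (z + w)) := by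
    rw [torusExp_add_right]
    have : torusExp k w * torusExp (-k) w = 1 := by
      rw [← torusExp_add, add_neg_cancel, torusExp_zero]
    linear_combination (-(f (z + w) * torusExp (-k) z)) * this
  unfold torusFourierCoeff
  simp only [h1]
  rw [integral_const_mul, integral_add_right_eq_self (fun z => f z * torusExp (-k) z) w]
  ring

/-- Translation replaces integration by parts: shifting by `t` in direction `i` multiplies the
coefficient by `exp (i k_i t)`, and this is differentiated at `t = 0`. -/
theorem torusFourierCoeff_deriv {G G' : Torus n → ℝ} (hG : Continuous G) (hG' : Continuous G')
    (i : Fin n) (hd : ∀ z, HasDerivAt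
      (fun t : ℝ => G (z + Torus.mk (t • EuclideanSpace.single i 1))) (G' z) 0) (k : Fin n → ℤ) :
    torusFourierCoeff (fun z => (G' z : ℂ)) k =
      (k i : ℂ) * Complex.I * torusFourierCoeff (fun z => (G z : ℂ)) k := by
  have hmk : Continuous fun q : Torus n × ℝ =>
      q.1 + Torus.mk (q.2 • EuclideanSpace.single i (1 : ℝ)) :=
    continuous_fst.add (Torus.continuous_mk.comp (by fun_prop))
  have h1 := hasDerivAt_torusFourierCoeff isOpen_univ
    (G := fun z t => G (z + Torus.mk (t • EuclideanSpace.single i 1)))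
    (G' := fun z t => G' (z + Torus.mk (t • EuclideanSpace.single i 1)))
    (fun t _ => hG.comp (continuous_id.add continuous_const))
    (fun z t _ => (hG'.comp hmk).continuousAt) (fun z t _ => ?_) k (Set.mem_univ 0)
  · have h2 (t : ℝ) : torusFourierCoeff
        (fun z => (G (z + Torus.mk (t • EuclideanSpace.single i 1)) : ℂ)) k =
        Complex.exp ((k i : ℂ) * Complex.I * t) * torusFourierCoeff (fun z => (G z : ℂ)) k := by
      rw [torusFourierCoeff_comp_add_right (fun z => (G z : ℂ)), torusExp_mk,
        Finset.sum_eq_single i]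
      · congr 2
        simp
        ring
      · intro j _ hj
        simp [hj]
      · simp
    simp only [h2] at h1
    have h3 : HasDerivAt (fun t : ℝ => Complex.exp ((k i : ℂ) * Complex.I * t) *
        torusFourierCoeff (fun z => (G z : ℂ)) k)
        (Complex.exp ((k i : ℂ) * Complex.I * (0 : ℝ)) * ((k i : ℂ) * Complex.I * 1) *
          torusFourierCoeff (fun z => (G z : ℂ)) k) 0 :=
      (((hasDerivAt_id (0 : ℝ)).ofReal_comp.const_mul _).cexp).mul_const _
    have h4 := h1.unique h3
    simpa [Torus.mk_zero] using h4
  · have h2 := hd (z + Torus.mk (t • EuclideanSpace.single i 1))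
    have h3 : HasDerivAt (fun s : ℝ => s - t) 1 t := (hasDerivAt_id t).sub_const t
    have h4 := HasDerivAt.scomp_of_eq t h2 h3 (by simp)
    refine (h4.congr_deriv (by simp)).congr_of_eventuallyEq (Eventually.of_forall fun s => ?_)
    simp only [Function.comp_apply]
    rw [add_assoc, ← Torus.mk_add, ← add_smul]
    simp

end TorusDerivatives

/-! ### Fourier coefficients of solutions of the extension problem -/

section ExtensionCoefficients

variable {n : ℕ}

/-- The Euclidean length `|k|` of a frequency. -/
noncomputable def freqNorm (k : Fin n → ℤ) : ℝ := Real.sqrt (∑ i, (k i : ℝ) ^ 2)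

theorem freqNorm_nonneg (k : Fin n → ℤ) : 0 ≤ freqNorm k := Real.sqrt_nonneg _

theorem sq_freqNorm (k : Fin n → ℤ) : freqNorm k ^ 2 = ∑ i, (k i : ℝ) ^ 2 :=
  Real.sq_sqrt (Finset.sum_nonneg fun _ _ => sq_nonneg _)

theorem freqPow_eq (σ : ℝ) (k : Fin n → ℤ) : freqPow σ k = freqNorm k ^ (2 * σ) := rfl

theorem torusFourierCoeff_sum {ι : Type*} (s : Finset ι) {f : ι → Torus n → ℂ}
    (hf : ∀ i ∈ s, Integrable (f i)) (k : Fin n → ℤ) :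
    torusFourierCoeff (fun z => ∑ i ∈ s, f i z) k = ∑ i ∈ s, torusFourierCoeff (f i) k := by
  simp only [torusFourierCoeff, Finset.sum_mul]
  rw [integral_finsetSum s fun i hi => integrable_mul_torusExp (hf i hi) _, Finset.mul_sum]

/-- The left-hand side of the extension equation, as a function on `Torus n × (0, ∞)`. -/
noncomputable def extensionOperator (σ : ℝ) (V : Torus n → ℝ → ℝ) (z : Torus n) (y : ℝ) : ℝ :=
  ∑ i, torusDeriv₂ V (EuclideanSpace.single i 1, 0) z y
    + (1 - 2 * σ) / y * torusDeriv V (0, 1) z y + torusDeriv₂ V (0, 1) z y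

section

variable {V : Torus n → ℝ → ℝ}
  (hV : ContDiffOn ℝ 2 (fun p : EuclideanSpace ℝ (Fin n) × ℝ => V (Torus.mk p.1) p.2) (halfSpace n))

include hV

theorem extensionOperator_mk (σ : ℝ) (x : EuclideanSpace ℝ (Fin n)) {y : ℝ} (hy : 0 < y) :
    extensionOperator σ V (Torus.mk x) y =
      Laplacian.laplacian (fun x' : EuclideanSpace ℝ (Fin n) => V (Torus.mk x') y) x
      + (1 - 2 * σ) / y * deriv (V (Torus.mk x)) y + iteratedDeriv 2 (V (Torus.mk x)) y := by
  rw [laplacian_torus hV x hy, (hasDerivAt_torus_snd hV _ hy).deriv,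
    iteratedDeriv_two_torus hV _ hy, extensionOperator]

theorem continuous_torus_slice {y : ℝ} (hy : 0 < y) : Continuous fun z => V z y :=
  continuous_iff_continuousAt.2 fun z =>
    (continuousAt_torus hV z hy).comp (f := fun z : Torus n => (z, y)) (by fun_prop)

theorem continuous_torusDeriv_slice (h : EuclideanSpace ℝ (Fin n) × ℝ) {y : ℝ} (hy : 0 < y) :
    Continuous fun z => torusDeriv V h z y :=
  continuous_iff_continuousAt.2 fun z =>
    (continuousAt_torusDeriv hV h z hy).comp (f := fun z : Torus n => (z, y)) (by fun_prop)

theorem continuous_torusDeriv₂_slice (h : EuclideanSpace ℝ (Fin n) × ℝ) {y : ℝ} (hy : 0 < y) :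
    Continuous fun z => torusDeriv₂ V h z y :=
  continuous_iff_continuousAt.2 fun z =>
    (continuousAt_torusDeriv₂ hV h z hy).comp (f := fun z : Torus n => (z, y)) (by fun_prop)

theorem continuous_extensionOperator (σ : ℝ) {y : ℝ} (hy : 0 < y) :
    Continuous fun z => extensionOperator σ V z y := by
  have h1 := fun h => continuous_torusDeriv₂_slice hV h hy
  have h2 := continuous_torusDeriv_slice hV (0, 1) hy
  unfold extensionOperator
  exact ((continuous_finsetSum _ fun i _ => h1 _).add (h2.const_mul _)).add (h1 _)

theorem hasDerivAt_coeff (k : Fin n → ℤ) {y : ℝ} (hy : 0 < y) :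
    HasDerivAt (fun y => torusFourierCoeff (fun z => (V z y : ℂ)) k)
      (torusFourierCoeff (fun z => (torusDeriv V (0, 1) z y : ℂ)) k) y :=
  hasDerivAt_torusFourierCoeff isOpen_Ioi (fun _ ht => continuous_torus_slice hV ht)
    (fun z _ ht => continuousAt_torusDeriv hV _ z ht)
    (fun z _ ht => hasDerivAt_torus_snd hV z ht) k hy

theorem hasDerivAt_coeff_torusDeriv (k : Fin n → ℤ) {y : ℝ} (hy : 0 < y) :
    HasDerivAt (fun y => torusFourierCoeff (fun z => (torusDeriv V (0, 1) z y : ℂ)) k)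
      (torusFourierCoeff (fun z => (torusDeriv₂ V (0, 1) z y : ℂ)) k) y :=
  hasDerivAt_torusFourierCoeff isOpen_Ioi (fun _ ht => continuous_torusDeriv_slice hV _ ht)
    (fun z _ ht => continuousAt_torusDeriv₂ hV _ z ht)
    (fun z _ ht => hasDerivAt_torusDeriv_snd hV z ht) k hy

theorem coeff_torusDeriv₂_fst (i : Fin n) (k : Fin n → ℤ) {y : ℝ} (hy : 0 < y) :
    torusFourierCoeff (fun z => (torusDeriv₂ V (EuclideanSpace.single i 1, 0) z y : ℂ)) k =
      -((k i : ℝ) ^ 2 : ℝ) * torusFourierCoeff (fun z => (V z y : ℂ)) k := by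
  rw [torusFourierCoeff_deriv (continuous_torusDeriv_slice hV _ hy)
      (continuous_torusDeriv₂_slice hV _ hy) i (fun z => hasDerivAt_torusDeriv_fst hV _ z hy) k,
    torusFourierCoeff_deriv (continuous_torus_slice hV hy)
      (continuous_torusDeriv_slice hV _ hy) i (fun z => hasDerivAt_torus_fst hV _ z hy) k]
  push_cast
  linear_combination (k i : ℂ) ^ 2 * torusFourierCoeff (fun z => (V z y : ℂ)) k * Complex.I_sq

theorem coeff_extensionOperator (σ : ℝ) (k : Fin n → ℤ) {y : ℝ} (hy : 0 < y) :
    torusFourierCoeff (fun z => (extensionOperator σ V z y : ℂ)) k =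
      -((freqNorm k ^ 2 : ℝ) : ℂ) * torusFourierCoeff (fun z => (V z y : ℂ)) k
        + (((1 - 2 * σ) / y : ℝ) : ℂ) *
          torusFourierCoeff (fun z => (torusDeriv V (0, 1) z y : ℂ)) k
        + torusFourierCoeff (fun z => (torusDeriv₂ V (0, 1) z y : ℂ)) k := by
  have h1 (h) : Continuous fun z => (torusDeriv₂ V h z y : ℂ) :=
    Complex.continuous_ofReal.comp (continuous_torusDeriv₂_slice hV h hy)
  have h2 : Continuous fun z => (torusDeriv V (0, 1) z y : ℂ) :=
    Complex.continuous_ofReal.comp (continuous_torusDeriv_slice hV (0, 1) hy)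
  have h3 : Continuous fun z =>
      ∑ i : Fin n, (torusDeriv₂ V (EuclideanSpace.single i 1, 0) z y : ℂ) :=
    continuous_finsetSum _ fun i _ => h1 _
  have h4 : Continuous fun z => (((1 - 2 * σ) / y : ℝ) : ℂ) * (torusDeriv V (0, 1) z y : ℂ) :=
    h2.const_mul _
  have h5 : Continuous fun z =>
      ∑ i : Fin n, (torusDeriv₂ V (EuclideanSpace.single i 1, 0) z y : ℂ) +
        (((1 - 2 * σ) / y : ℝ) : ℂ) * (torusDeriv V (0, 1) z y : ℂ) := h3.add h4
  simp only [extensionOperator, Complex.ofReal_add, Complex.ofReal_sum, Complex.ofReal_mul]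
  rw [torusFourierCoeff_add (integrable_of_continuous_torus h5)
      (integrable_of_continuous_torus (h1 _)),
    torusFourierCoeff_add (integrable_of_continuous_torus h3) (integrable_of_continuous_torus h4),
    torusFourierCoeff_const_mul,
    torusFourierCoeff_sum _ (fun i _ => integrable_of_continuous_torus (h1 _)),
    sq_freqNorm]
  simp only [coeff_torusDeriv₂_fst hV _ _ hy, ← Finset.sum_mul, Finset.sum_neg_distrib,
    Complex.ofReal_sum]

end

/-- The boundary condition in `IsExtension` is tested only against real functions, so exponentials
must be split into real and imaginary parts. -/
theorem integral_ofReal_mul_torusExp {f : Torus n → ℝ} (hf : Integrable f) (k : Fin n → ℤ) :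
    ∫ z, (f z : ℂ) * torusExp k z = ((∫ z, f z * (torusExp k z).re : ℝ) : ℂ)
      + ((∫ z, f z * (torusExp k z).im : ℝ) : ℂ) * Complex.I := by
  have h1 : Integrable fun z => f z * (torusExp k z).re :=
    hf.mul_bdd (c := 1) (Complex.continuous_re.comp (torusExp k).continuous).aestronglyMeasurable
      (Eventually.of_forall fun z => (Complex.abs_re_le_norm _).trans (norm_torusExp k z).le)
  have h2 : Integrable fun z => f z * (torusExp k z).im :=
    hf.mul_bdd (c := 1) (Complex.continuous_im.comp (torusExp k).continuous).aestronglyMeasurable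
      (Eventually.of_forall fun z => (Complex.abs_im_le_norm _).trans (norm_torusExp k z).le)
  rw [← integral_complex_ofReal, ← integral_complex_ofReal, ← integral_mul_const,
    ← integral_add h1.ofReal (h2.ofReal.mul_const _)]
  refine integral_congr_ae (Eventually.of_forall fun z => ?_)
  simp only [Complex.ofReal_mul]
  linear_combination (-(f z : ℂ)) * Complex.re_add_im (torusExp k z)

theorem norm_torusFourierCoeff_le {f : Torus n → ℂ} (hf : MemLp f 2) (k : Fin n → ℤ) :
    ‖torusFourierCoeff f k‖ ≤ (Real.sqrt ((2 * Real.pi) ^ n))⁻¹ * (eLpNorm f 2 volume).toReal := by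
  have h0 : (0 : ℝ) < (2 * Real.pi) ^ n := by positivity
  have h1 := hasSum_sq_torusFourierCoeff hf
  have h2 := le_hasSum h1 k fun _ _ => by positivity
  rw [← div_eq_inv_mul, le_div_iff₀ (Real.sqrt_pos.2 h0)]
  refine abs_le_of_sq_le_sq' ?_ ENNReal.toReal_nonneg |>.2
  rw [mul_pow, Real.sq_sqrt h0.le]
  linarith

variable {σ : ℝ} {v : Torus n → ℝ} {V : Torus n → ℝ → ℝ}

theorem IsExtension.extensionOperator_eq_zero (hV : IsExtension σ v V) (z : Torus n) {y : ℝ}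
    (hy : 0 < y) : extensionOperator σ V z y = 0 := by
  rw [← Torus.mk_lift z, extensionOperator_mk hV.contDiffOn σ _ hy]
  exact hV.equation _ y hy

theorem IsExtension.tendsto_coeff (hV : IsExtension σ v V) (hv : MemLp v 2) (k : Fin n → ℤ) :
    Tendsto (fun y => torusFourierCoeff (fun z => (V z y : ℂ)) k) (𝓝[>] 0)
      (𝓝 (torusCoeff v k)) := by
  have hmem (u : ℂ →L[ℝ] ℝ) : MemLp (fun z : Torus n => u (torusExp (-k) z)) 2 :=
    (u.continuous.comp (torusExp (-k)).continuous).memLp_of_hasCompactSupport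
      (HasCompactSupport.of_compactSpace _)
  have h1 := hV.boundary _ (hmem Complex.reCLM)
  have h2 := hV.boundary _ (hmem Complex.imCLM)
  have h3 := ((Complex.continuous_ofReal.tendsto _).comp h1).add
    (((Complex.continuous_ofReal.tendsto _).comp h2).mul_const Complex.I)
  have h4 := h3.const_mul (((2 * Real.pi : ℝ) : ℂ)⁻¹ ^ n)
  simp only [Complex.reCLM_apply, Complex.imCLM_apply] at h4
  rw [← integral_ofReal_mul_torusExp (hv.integrable (by norm_num))] at h4
  refine h4.congr' ?_
  filter_upwards [self_mem_nhdsWithin] with y hy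
  have h5 := integrable_of_continuous_torus (continuous_torus_slice hV.contDiffOn hy)
  rw [torusFourierCoeff, integral_ofReal_mul_torusExp h5]
  rfl

/-- The Fourier coefficients of a solution of the extension problem. -/
theorem IsExtension.coeff_eq (hV : IsExtension σ v V) (hσ : 0 < σ) (hv : MemLp v 2)
    (k : Fin n → ℤ) {y : ℝ} (hy : 0 < y) :
    torusFourierCoeff (fun z => (V z y : ℂ)) k =
      torusCoeff v k * extProfile σ (freqNorm k * y) := by
  obtain ⟨C, hC⟩ := hV.bounded
  have hκ := freqNorm_nonneg k
  set κ := freqNorm k with hκdef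
  -- The difference from the explicit solution satisfies the same linear equation, is bounded, and
  -- tends to `0` at the boundary.
  refine sub_eq_zero.1 (eq_zero_of_bounded_of_ode (σ := σ) (κ := κ) hσ
    (e := fun y => torusFourierCoeff (fun z => (V z y : ℂ)) k -
      torusCoeff v k * extProfile σ (κ * y))
    (e' := fun y => torusFourierCoeff (fun z => (torusDeriv V (0, 1) z y : ℂ)) k -
      torusCoeff v k * extProfileDeriv σ κ y)
    (C := (Real.sqrt ((2 * Real.pi) ^ n))⁻¹ * C + ‖torusCoeff v k‖) ?_ ?_ ?_ ?_ y hy)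
  · exact fun y hy => (hasDerivAt_coeff hV.contDiffOn k hy).sub
      ((hasDerivAt_extProfile σ hκ hy).ofReal_comp.const_mul _)
  · intro y hy
    refine ((hasDerivAt_coeff_torusDeriv hV.contDiffOn k hy).sub
      ((hasDerivAt_extProfileDeriv σ hκ hy).ofReal_comp.const_mul _)).congr_deriv ?_
    have h1 := coeff_extensionOperator hV.contDiffOn σ k hy
    simp only [hV.extensionOperator_eq_zero _ hy] at h1
    have h2 : torusFourierCoeff (fun _ : Torus n => ((0 : ℝ) : ℂ)) k = 0 := by
      simp [torusFourierCoeff]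
    rw [h2, ← hκdef] at h1
    push_cast at h1 ⊢
    linear_combination -h1
  · intro y hy
    have h1 : MemLp (fun z => (V z y : ℂ)) 2 := memLp_of_continuous_torus
      (Complex.continuous_ofReal.comp (continuous_torus_slice hV.contDiffOn hy))
    have h2 : eLpNorm (fun z => (V z y : ℂ)) 2 volume = eLpNorm (fun z => V z y) 2 volume :=
      eLpNorm_congr_norm_ae (Eventually.of_forall fun z => by simp)
    have h3 : (eLpNorm (fun z => (V z y : ℂ)) 2 volume).toReal ≤ C := by
      rw [h2]
      exact ENNReal.toReal_le_of_le_ofReal C.2 (by simpa using hC y hy)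
    refine (norm_sub_le _ _).trans (add_le_add ((norm_torusFourierCoeff_le h1 k).trans ?_) ?_)
    · gcongr
    · rw [norm_mul, Complex.norm_real, Real.norm_of_nonneg (extProfile_nonneg hσ _)]
      exact mul_le_of_le_one_right (norm_nonneg _) (extProfile_le_one hσ _)
  · have h1 := (hV.tendsto_coeff hv k).sub
      (((Complex.continuous_ofReal.tendsto _).comp (tendsto_extProfile hσ κ)).const_mul
        (torusCoeff v k))
    simpa using h1

theorem IsExtension.coeff_deriv_eq (hV : IsExtension σ v V) (hσ : 0 < σ) (hv : MemLp v 2)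
    (k : Fin n → ℤ) {y : ℝ} (hy : 0 < y) :
    torusFourierCoeff (fun z => ((deriv (V z) y : ℝ) : ℂ)) k =
      torusCoeff v k * extProfileDeriv σ (freqNorm k) y := by
  have h1 (z : Torus n) : deriv (V z) y = torusDeriv V (0, 1) z y :=
    (hasDerivAt_torus_snd hV.contDiffOn z hy).deriv
  simp only [h1]
  refine (hasDerivAt_coeff hV.contDiffOn k hy).unique
    (((hasDerivAt_extProfile σ (freqNorm_nonneg k) hy).ofReal_comp.const_mul
      (torusCoeff v k)).congr_of_eventuallyEq ?_)
  filter_upwards [Ioi_mem_nhds hy] with t ht using hV.coeff_eq hσ hv k ht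

theorem IsExtension.unique {W : Torus n → ℝ → ℝ} (hV : IsExtension σ v V)
    (hW : IsExtension σ v W) (hσ : 0 < σ) (hv : MemLp v 2) (z : Torus n) {y : ℝ} (hy : 0 < y) :
    V z y = W z y := by
  have h1 := eq_of_torusFourierCoeff
    (Complex.continuous_ofReal.comp (continuous_torus_slice hV.contDiffOn hy))
    (Complex.continuous_ofReal.comp (continuous_torus_slice hW.contDiffOn hy)) fun k =>
      (hV.coeff_eq hσ hv k hy).trans (hW.coeff_eq hσ hv k hy).symm
  exact Complex.ofReal_injective (congrFun h1 z)

/-- The weighted normal derivative `-y ^ (1 - 2 σ) V_y`. -/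
noncomputable def conormal (σ : ℝ) (V : Torus n → ℝ → ℝ) (y : ℝ) (z : Torus n) : ℂ :=
  ((-(y ^ (1 - 2 * σ) * deriv (V z) y) : ℝ) : ℂ)

theorem IsExtension.continuous_conormal (hV : IsExtension σ v V) {y : ℝ} (hy : 0 < y) :
    Continuous (conormal σ V y) := by
  have h1 (z : Torus n) : deriv (V z) y = torusDeriv V (0, 1) z y :=
    (hasDerivAt_torus_snd hV.contDiffOn z hy).deriv
  unfold conormal
  simp only [h1]
  have := continuous_torusDeriv_slice hV.contDiffOn (0, 1) hy
  fun_prop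

theorem IsExtension.continuousOn_conormal (hV : IsExtension σ v V) (z : Torus n) :
    ContinuousOn (fun y => conormal σ V y z) (Set.Ioi 0) := by
  unfold conormal
  have h1 : ContinuousOn (fun y => deriv (V z) y) (Set.Ioi 0) :=
    ContinuousOn.congr (fun y hy =>
      (hasDerivAt_torusDeriv_snd hV.contDiffOn z hy).continuousAt.continuousWithinAt)
      fun y hy => (hasDerivAt_torus_snd hV.contDiffOn z hy).deriv
  have h2 : ContinuousOn (fun y : ℝ => y ^ (1 - 2 * σ)) (Set.Ioi 0) := fun y hy =>
    (Real.continuousAt_rpow_const y _ (Or.inl (ne_of_gt hy))).continuousWithinAt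
  exact Complex.continuous_ofReal.comp_continuousOn (h2.mul h1).neg

/-- The flux identity turns the conormal derivative into a multiplier acting on its own expected
limit. Both modes of convergence rest on this formula. -/
theorem IsExtension.coeff_conormal (hV : IsExtension σ v V) (hσ0 : 0 < σ) (hσ1 : σ < 1)
    (hv : MemDomFracLaplacian σ v) (k : Fin n → ℤ) {y : ℝ} (hy : 0 < y) :
    torusFourierCoeff (conormal σ V y) k = (extProfile (1 - σ) (freqNorm k * y) : ℂ) *
      torusFourierCoeff (fun z => (extConst σ : ℂ) * fracLaplacian σ v z) k := by
  have h1 : conormal σ V y = fun z => ((-(y ^ (1 - 2 * σ)) : ℝ) : ℂ) * ((deriv (V z) y : ℝ) : ℂ) := by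
    ext z
    simp [conormal]
  have h2 := flux_extProfile hσ0 hσ1 (freqNorm_nonneg k) hy
  rw [h1, torusFourierCoeff_const_mul, hV.coeff_deriv_eq hσ0 hv.1 k hy,
    torusFourierCoeff_const_mul, torusFourierCoeff_fracLaplacian hv, freqPow_eq]
  have h3 := congrArg Complex.ofReal h2
  push_cast at h3 ⊢
  linear_combination torusCoeff v k * h3

theorem IsExtension.tendsto_eLpNorm_conormal (hV : IsExtension σ v V) (hσ0 : 0 < σ) (hσ1 : σ < 1)
    (hv : MemDomFracLaplacian σ v) : Tendsto (fun y => eLpNorm (fun z =>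
      conormal σ V y z - (extConst σ : ℂ) * fracLaplacian σ v z) 2 volume) (𝓝[>] 0) (𝓝 0) := by
  have hσ' : 0 < 1 - σ := by linarith
  refine tendsto_eLpNorm_of_multiplier
    (m := fun y k => extProfile (1 - σ) (freqNorm k * y))
    ((Lp.memLp (fracLaplacian σ v)).const_mul _) ?_ ?_ ?_ ?_
    fun k => tendsto_extProfile hσ' (freqNorm k)
  · filter_upwards [self_mem_nhdsWithin] with y hy
    exact memLp_of_continuous_torus (hV.continuous_conormal hy)
  · filter_upwards [self_mem_nhdsWithin] with y hy k
    exact hV.coeff_conormal hσ0 hσ1 hv k hy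
  · exact Eventually.of_forall fun y k => extProfile_nonneg hσ' _
  · exact Eventually.of_forall fun y k => extProfile_le_one hσ' _

end ExtensionCoefficients

/-! ### Smoothness of Bessel type series -/

section BesselSeries

variable {n : ℕ}

theorem abs_le_freqNorm (k : Fin n → ℤ) (i : Fin n) : |(k i : ℝ)| ≤ freqNorm k := by
  refine Real.abs_le_sqrt ?_
  exact Finset.single_le_sum (f := fun i => (k i : ℝ) ^ 2) (fun _ _ => sq_nonneg _)
    (Finset.mem_univ i)

theorem freqNorm_eq_zero_or_one_le (k : Fin n → ℤ) : freqNorm k = 0 ∨ 1 ≤ freqNorm k := by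
  by_cases hk : k = 0
  · left; simp [hk, freqNorm]
  · right
    obtain ⟨i, hi⟩ := Function.ne_iff.mp hk
    refine le_trans ?_ (abs_le_freqNorm k i)
    exact_mod_cast Int.one_le_abs hi

theorem summable_int_exp_neg {c : ℝ} (hc : 0 < c) :
    Summable fun m : ℤ => Real.exp (-(c * |(m : ℝ)|)) := by
  have h1 : Summable fun m : ℕ => Real.exp (-(c * m)) := by
    have := Real.summable_exp_nat_mul_iff.2 (neg_lt_zero.2 hc)
    refine this.congr fun m => ?_
    congr 1; ring
  refine Summable.of_nat_of_neg ?_ ?_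
  · simpa using h1
  · simpa using h1

theorem summable_pi_prod {g : ℤ → ℝ} (hg0 : ∀ m, 0 ≤ g m) (hg : Summable g) (n : ℕ) :
    Summable fun k : Fin n → ℤ => ∏ i, g (k i) := by
  induction n with
  | zero => exact Summable.of_finite
  | succ n ih =>
    rw [← (Fin.consEquiv fun _ : Fin (n + 1) => ℤ).summable_iff]
    refine (hg.mul_of_nonneg ih hg0 fun k => Finset.prod_nonneg fun i _ => hg0 _).congr fun q => ?_
    simp [Fin.consEquiv, Fin.prod_univ_succ]

/-- Since `∑ |k_i| ≤ n |k|`, the exponential is dominated by a product of one-dimensional summable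
terms. -/
theorem summable_exp_neg_freqNorm {c : ℝ} (hc : 0 < c) :
    Summable fun k : Fin n → ℤ => Real.exp (-(c * freqNorm k)) := by
  rcases n.eq_zero_or_pos with rfl | hn
  · exact Summable.of_finite
  have hn' : (0 : ℝ) < n := by exact_mod_cast hn
  refine Summable.of_nonneg_of_le (fun _ => (Real.exp_pos _).le) (fun k => ?_)
    (summable_pi_prod (g := fun m => Real.exp (-(c / n * |(m : ℝ)|)))
      (fun _ => (Real.exp_pos _).le) (summable_int_exp_neg (by positivity)) n)
  rw [← Real.exp_sum, Real.exp_le_exp, Finset.sum_neg_distrib, neg_le_neg_iff, ← Finset.mul_sum]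
  have h1 : ∑ i, |(k i : ℝ)| ≤ n * freqNorm k := by
    simpa using Finset.sum_le_card_nsmul Finset.univ _ _ fun i _ => abs_le_freqNorm k i
  calc c / n * ∑ i, |(k i : ℝ)| ≤ c / n * (n * freqNorm k) := by gcongr
    _ = c * freqNorm k := by field_simp

/-- Coefficients of subexponential growth. -/
def SubexpGrowth (a : (Fin n → ℤ) → ℂ) : Prop :=
  ∀ c : ℝ, 0 < c → Summable fun k => ‖a k‖ * Real.exp (-(c * freqNorm k))

theorem SubexpGrowth.of_bounded {a : (Fin n → ℤ) → ℂ} {C : ℝ} (h : ∀ k, ‖a k‖ ≤ C) :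
    SubexpGrowth a := fun c hc =>
  Summable.of_nonneg_of_le (fun _ => by positivity)
    (fun k => mul_le_mul_of_nonneg_right (h k) (Real.exp_pos _).le)
    ((summable_exp_neg_freqNorm hc).mul_left C)

/-- Half of the exponential absorbs any power of `|k|`, so the class is stable under the factors
produced by differentiation. -/
theorem SubexpGrowth.of_le {a a' : (Fin n → ℤ) → ℂ} (ha : SubexpGrowth a) (N : ℕ)
    (h : ∀ k, ‖a' k‖ ≤ freqNorm k ^ N * ‖a k‖) : SubexpGrowth a' := by
  intro c hc
  refine Summable.of_nonneg_of_le (fun _ => by positivity) (fun k => ?_)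
    ((ha (c / 2) (half_pos hc)).mul_left (N.factorial * (2 / c) ^ N))
  have hκ := freqNorm_nonneg k
  have h1 := Real.pow_div_factorial_le_exp (c / 2 * freqNorm k) (by positivity) N
  have h2 : freqNorm k ^ N ≤ N.factorial * (2 / c) ^ N * Real.exp (c / 2 * freqNorm k) := by
    rw [div_le_iff₀ (by positivity), mul_pow] at h1
    have h3 : (2 / c) ^ N * (c / 2) ^ N = 1 := by
      rw [← mul_pow, div_mul_div_cancel₀ hc.ne', div_self two_ne_zero, one_pow]
    calc freqNorm k ^ N = (2 / c) ^ N * ((c / 2) ^ N * freqNorm k ^ N) := by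
          rw [← mul_assoc, h3, one_mul]
      _ ≤ (2 / c) ^ N * (Real.exp (c / 2 * freqNorm k) * N.factorial) := by gcongr
      _ = _ := by ring
  have h4 : Real.exp (-(c * freqNorm k)) =
      Real.exp (-(c / 2 * freqNorm k)) * (Real.exp (c / 2 * freqNorm k))⁻¹ := by
    rw [← Real.exp_neg, ← Real.exp_add]; congr 1; ring
  have h5 : freqNorm k ^ N * (Real.exp (c / 2 * freqNorm k))⁻¹ ≤ N.factorial * (2 / c) ^ N := by
    rwa [← div_eq_mul_inv, div_le_iff₀ (Real.exp_pos _)]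
  calc ‖a' k‖ * Real.exp (-(c * freqNorm k))
      ≤ (freqNorm k ^ N * ‖a k‖) * Real.exp (-(c * freqNorm k)) := by gcongr; exact h k
    _ = (freqNorm k ^ N * (Real.exp (c / 2 * freqNorm k))⁻¹) *
          (‖a k‖ * Real.exp (-(c / 2 * freqNorm k))) := by rw [h4]; ring
    _ ≤ _ := by gcongr

/-- Nonzero frequencies have `|k| ≥ 1`, hence `|k| y ≥ δ` and the exponential bound applies. The
frequency `0` contributes only the constant `besselInt b 0`, added to `C`. -/
theorem exists_besselInt_freqNorm_le (b : ℝ) {δ : ℝ} (hδ : 0 < δ) :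
    ∃ C : ℝ, 0 < C ∧ ∀ (k : Fin n → ℤ) (y : ℝ), δ ≤ y →
      besselInt b (freqNorm k * y) ≤ C * Real.exp (-(δ / 2 * freqNorm k)) := by
  obtain ⟨C, hC, h⟩ := exists_besselInt_le b hδ
  refine ⟨C + besselInt b 0, by have := besselInt_nonneg b 0; positivity, fun k y hy => ?_⟩
  have h0 := besselInt_nonneg b 0
  rcases freqNorm_eq_zero_or_one_le k with hk | hk
  · simp only [hk, zero_mul, mul_zero, neg_zero, Real.exp_zero, mul_one]
    linarith
  · have h1 : δ ≤ freqNorm k * y := by nlinarith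
    refine (h _ h1).trans ?_
    have h2 : Real.exp (-(freqNorm k * y / 2)) ≤ Real.exp (-(δ / 2 * freqNorm k)) := by
      rw [Real.exp_le_exp]; nlinarith
    have := Real.exp_pos (-(δ / 2 * freqNorm k))
    calc C * Real.exp (-(freqNorm k * y / 2)) ≤ C * Real.exp (-(δ / 2 * freqNorm k)) := by gcongr
      _ ≤ _ := by gcongr; linarith

/-- The general term of `besselSeries`. -/
noncomputable def besselTerm (a : (Fin n → ℤ) → ℂ) (b : ℝ) (k : Fin n → ℤ) (z : Torus n) (y : ℝ) :
    ℂ := a k * (besselInt b (freqNorm k * y) : ℂ) * torusExp k z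

/-- The series `∑ a_k I_b(|k| y) e^{i k · z}` with `I_b` the function `besselInt b`. -/
noncomputable def besselSeries (a : (Fin n → ℤ) → ℂ) (b : ℝ) (z : Torus n) (y : ℝ) : ℂ :=
  ∑' k, besselTerm a b k z y

theorem norm_besselTerm (a : (Fin n → ℤ) → ℂ) (b : ℝ) (k : Fin n → ℤ) (z : Torus n) (y : ℝ) :
    ‖besselTerm a b k z y‖ = ‖a k‖ * besselInt b (freqNorm k * y) := by
  rw [besselTerm, norm_mul, norm_mul, norm_torusExp, mul_one, Complex.norm_real,
    Real.norm_of_nonneg (besselInt_nonneg _ _)]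

theorem exists_summable_besselTerm_le {a : (Fin n → ℤ) → ℂ} (ha : SubexpGrowth a) (b : ℝ) {δ : ℝ}
    (hδ : 0 < δ) : ∃ u : (Fin n → ℤ) → ℝ, Summable u ∧ ∀ k z y, δ ≤ y →
      ‖besselTerm a b k z y‖ ≤ u k := by
  obtain ⟨C, hC, h⟩ := exists_besselInt_freqNorm_le (n := n) b hδ
  refine ⟨_, (ha (δ / 2) (half_pos hδ)).mul_left C, fun k z y hy => ?_⟩
  rw [norm_besselTerm]
  calc ‖a k‖ * besselInt b (freqNorm k * y)
      ≤ ‖a k‖ * (C * Real.exp (-(δ / 2 * freqNorm k))) := by gcongr; exact h k y hy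
    _ = _ := by ring

theorem summable_besselTerm {a : (Fin n → ℤ) → ℂ} (ha : SubexpGrowth a) (b : ℝ) (z : Torus n)
    {y : ℝ} (hy : 0 < y) : Summable fun k => besselTerm a b k z y := by
  obtain ⟨u, hu, h⟩ := exists_summable_besselTerm_le ha b hy
  exact Summable.of_norm_bounded hu fun k => h k z y le_rfl

/-- The projection of `ℝⁿ × ℝ` to the last factor, complex valued. -/
noncomputable def sndCLM (n : ℕ) : EuclideanSpace ℝ (Fin n) × ℝ →L[ℝ] ℂ :=
  Complex.ofRealCLM.comp (ContinuousLinearMap.snd ℝ _ _)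

/-- The coordinates of the first factor of `ℝⁿ × ℝ`, complex valued. -/
noncomputable def fstCLM (i : Fin n) : EuclideanSpace ℝ (Fin n) × ℝ →L[ℝ] ℂ :=
  Complex.ofRealCLM.comp ((EuclideanSpace.proj i).comp (ContinuousLinearMap.fst ℝ _ _))

/-- The derivative of the general term of `besselSeries`. -/
noncomputable def besselTermDeriv (a : (Fin n → ℤ) → ℂ) (b : ℝ) (k : Fin n → ℤ)
    (p : EuclideanSpace ℝ (Fin n) × ℝ) : EuclideanSpace ℝ (Fin n) × ℝ →L[ℝ] ℂ :=
  (-(p.2 / 2 : ℂ) * besselTerm (fun k => (freqNorm k ^ 2 : ℂ) * a k) (b - 1) k (Torus.mk p.1) p.2) •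
      sndCLM n
    + ∑ i, besselTerm (fun k => (k i : ℂ) * Complex.I * a k) b k (Torus.mk p.1) p.2 • fstCLM i

/-- Differentiation in `y` lowers `b` by one and multiplies the coefficients by `|k|²`;
differentiation in `z` multiplies them by `i k_i`. The derivative is thus assembled from terms of
the same kind. -/
theorem hasFDerivAt_besselTerm (a : (Fin n → ℤ) → ℂ) (b : ℝ) (k : Fin n → ℤ)
    {p : EuclideanSpace ℝ (Fin n) × ℝ} (hp : 0 < p.2) :
    HasFDerivAt (fun p : EuclideanSpace ℝ (Fin n) × ℝ => besselTerm a b k (Torus.mk p.1) p.2)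
      (besselTermDeriv a b k p) p := by
  have h0 : HasFDerivAt (fun p : EuclideanSpace ℝ (Fin n) × ℝ => p.2)
      (ContinuousLinearMap.snd ℝ (EuclideanSpace ℝ (Fin n)) ℝ) p := hasFDerivAt_snd
  have h1 : HasFDerivAt (fun p : EuclideanSpace ℝ (Fin n) × ℝ => besselInt b (freqNorm k * p.2))
      _ p := (hasDerivAt_besselInt_mul b (freqNorm_nonneg k) hp).comp_hasFDerivAt p h0
  have h2 : HasFDerivAt (fun p : EuclideanSpace ℝ (Fin n) × ℝ =>
      (besselInt b (freqNorm k * p.2) : ℂ)) _ p := Complex.ofRealCLM.hasFDerivAt.comp p h1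
  let ℓ : EuclideanSpace ℝ (Fin n) × ℝ →L[ℝ] ℂ := ∑ i, (k i : ℂ) • fstCLM i
  have hℓ (p : EuclideanSpace ℝ (Fin n) × ℝ) :
      torusExp k (Torus.mk p.1) = Complex.exp (ℓ p * Complex.I) := by
    rw [torusExp_mk]
    simp [ℓ, fstCLM]
  have h3 : HasFDerivAt (fun p : EuclideanSpace ℝ (Fin n) × ℝ => torusExp k (Torus.mk p.1))
      (Complex.exp (ℓ p * Complex.I) • (Complex.I • ℓ)) p := by
    simp only [hℓ]
    exact (ℓ.hasFDerivAt.mul_const Complex.I).cexp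
  refine ((h2.const_mul (a k)).mul h3).congr_fderiv ?_
  ext h
  · simp [besselTermDeriv, besselTerm, sndCLM, fstCLM, ℓ, hℓ, Finset.mul_sum, Finset.sum_mul]
    refine Finset.sum_congr rfl fun i _ => ?_
    ring
  · simp [besselTermDeriv, besselTerm, sndCLM, fstCLM, ℓ, hℓ]
    ring

theorem SubexpGrowth.sq_mul {a : (Fin n → ℤ) → ℂ} (ha : SubexpGrowth a) :
    SubexpGrowth fun k => (freqNorm k ^ 2 : ℂ) * a k :=
  ha.of_le 2 fun k => by
    rw [norm_mul, norm_pow, Complex.norm_real, Real.norm_of_nonneg (freqNorm_nonneg k)]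

theorem SubexpGrowth.coord_mul {a : (Fin n → ℤ) → ℂ} (ha : SubexpGrowth a) (i : Fin n) :
    SubexpGrowth fun k => (k i : ℂ) * Complex.I * a k :=
  ha.of_le 1 fun k => by
    rw [norm_mul, norm_mul, Complex.norm_I, mul_one, Complex.norm_intCast, pow_one]
    exact mul_le_mul_of_nonneg_right (abs_le_freqNorm k i) (norm_nonneg _)

theorem hasFDerivAt_besselSeries {a : (Fin n → ℤ) → ℂ} (ha : SubexpGrowth a) (b : ℝ)
    {p : EuclideanSpace ℝ (Fin n) × ℝ} (hp : 0 < p.2) :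
    HasFDerivAt (fun p : EuclideanSpace ℝ (Fin n) × ℝ => besselSeries a b (Torus.mk p.1) p.2)
      ((-(p.2 / 2 : ℂ) * besselSeries (fun k => (freqNorm k ^ 2 : ℂ) * a k) (b - 1)
          (Torus.mk p.1) p.2) • sndCLM n
        + ∑ i, besselSeries (fun k => (k i : ℂ) * Complex.I * a k) b (Torus.mk p.1) p.2 • fstCLM i)
      p := by
  have hδ : 0 < p.2 / 2 := half_pos hp
  obtain ⟨u, hu, hu'⟩ := exists_summable_besselTerm_le ha.sq_mul (b - 1) hδ
  choose w hw hw' using fun i => exists_summable_besselTerm_le (ha.coord_mul i) b hδ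
  -- On this slab `y` is bounded below, for the exponential decay, and above, for the factor `y / 2`
  -- in the derivative.
  let s : Set (EuclideanSpace ℝ (Fin n) × ℝ) := Set.univ ×ˢ Set.Ioo (p.2 / 2) (2 * p.2)
  have hs : IsOpen s := isOpen_univ.prod isOpen_Ioo
  have hs' : IsPreconnected s := (convex_univ.prod (convex_Ioo _ _)).isPreconnected
  have hps : p ∈ s := ⟨trivial, by linarith, by linarith⟩
  have hsum : Summable fun k => p.2 * u k * ‖sndCLM n‖ + ∑ i, w i k * ‖fstCLM i‖ :=
    ((hu.mul_left _).mul_right _).add (summable_sum fun i _ => (hw i).mul_right _)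
  have key := hasFDerivAt_tsum_of_isPreconnected hsum hs hs'
    (fun k q hq => hasFDerivAt_besselTerm a b k (hδ.trans hq.2.1)) (fun k q hq => ?_) hps
    (summable_besselTerm ha b _ hp) hps
  · refine key.congr_fderiv ?_
    have h1 := summable_besselTerm ha.sq_mul (b - 1) (Torus.mk p.1) hp
    have h2 := fun i => summable_besselTerm (ha.coord_mul i) b (Torus.mk p.1) hp
    unfold besselTermDeriv besselSeries
    rw [Summable.tsum_add ((h1.mul_left _).smul_const _)
      (summable_sum fun i _ => (h2 i).smul_const _), (h1.mul_left _).tsum_smul_const,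
      tsum_mul_left, Summable.tsum_finsetSum fun i _ => (h2 i).smul_const _]
    simp only [fun i => (h2 i).tsum_smul_const (fstCLM i)]
  · have hq0 : 0 < q.2 := hδ.trans hq.2.1
    refine (norm_add_le _ _).trans (add_le_add ?_ ((norm_sum_le _ _).trans
      (Finset.sum_le_sum fun i _ => ?_)))
    · rw [norm_smul, norm_mul]
      have h1 : ‖-(q.2 / 2 : ℂ)‖ ≤ p.2 := by
        rw [norm_neg, norm_div, Complex.norm_real, Real.norm_of_nonneg hq0.le]
        simp only [Complex.norm_ofNat]
        linarith [hq.2.2]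
      have h2 := hu' k (Torus.mk q.1) q.2 hq.2.1.le
      gcongr
    · rw [norm_smul]
      have h2 := hw' i k (Torus.mk q.1) q.2 hq.2.1.le
      gcongr

/-- The derivative is a combination of series of the same family with other `a` and `b`, so the
induction runs over all of them at once. -/
theorem contDiffOn_besselSeries (m : ℕ) {a : (Fin n → ℤ) → ℂ} (ha : SubexpGrowth a) (b : ℝ) :
    ContDiffOn ℝ m (fun p : EuclideanSpace ℝ (Fin n) × ℝ => besselSeries a b (Torus.mk p.1) p.2)
      (halfSpace n) := by
  induction m generalizing a b with
  | zero =>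
    exact contDiffOn_zero.2 fun p hp =>
      (hasFDerivAt_besselSeries ha b (mem_halfSpace.1 hp)).continuousAt.continuousWithinAt
  | succ m ih =>
    push_cast
    rw [contDiffOn_succ_iff_fderiv_of_isOpen isOpen_halfSpace]
    refine ⟨fun p hp => (hasFDerivAt_besselSeries ha b
      (mem_halfSpace.1 hp)).differentiableAt.differentiableWithinAt, fun h => by simp at h, ?_⟩
    refine ContDiffOn.congr ?_ fun p hp =>
      (hasFDerivAt_besselSeries ha b (mem_halfSpace.1 hp)).fderiv
    have h1 : ContDiffOn ℝ m (fun p : EuclideanSpace ℝ (Fin n) × ℝ => (-(p.2 / 2 : ℂ)))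
        (halfSpace n) := by
      have : ContDiff ℝ m fun p : EuclideanSpace ℝ (Fin n) × ℝ => (p.2 : ℂ) :=
        Complex.ofRealCLM.contDiff.comp contDiff_snd
      exact (this.div_const 2).neg.contDiffOn
    refine ((h1.mul (ih ha.sq_mul (b - 1))).smul contDiffOn_const).add
      (ContDiffOn.sum fun i _ => (ih (ha.coord_mul i) b).smul contDiffOn_const)

theorem torusFourierCoeff_besselSeries {a : (Fin n → ℤ) → ℂ} (ha : SubexpGrowth a) (b : ℝ)
    (k : Fin n → ℤ) {y : ℝ} (hy : 0 < y) :
    torusFourierCoeff (fun z => besselSeries a b z y) k =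
      a k * (besselInt b (freqNorm k * y) : ℂ) := by
  obtain ⟨u, hu, h⟩ := exists_summable_besselTerm_le ha b hy
  have h1 (l : Fin n → ℤ) : Integrable fun z => besselTerm a b l z y * torusExp (-k) z := by
    refine integrable_of_continuous_torus ?_
    unfold besselTerm
    fun_prop
  have h2 (l : Fin n → ℤ) : ∫ z, ‖besselTerm a b l z y * torusExp (-k) z‖ =
      (2 * Real.pi) ^ n * (‖a l‖ * besselInt b (freqNorm l * y)) := by
    simp only [norm_mul _ (torusExp (-k) _), norm_torusExp, mul_one, norm_besselTerm,
      integral_const, measureReal_torus, smul_eq_mul]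
  have h3 : Summable fun l => ∫ z, ‖besselTerm a b l z y * torusExp (-k) z‖ := by
    simp only [h2]
    refine Summable.mul_left _ ?_
    have := (summable_besselTerm ha b 0 hy).norm
    simpa only [norm_besselTerm] using this
  have h4 := integral_tsum_of_summable_integral_norm h1 h3
  rw [torusFourierCoeff]
  simp only [besselSeries, ← tsum_mul_right]
  rw [← h4, ← tsum_mul_left, tsum_eq_single k]
  · change torusFourierCoeff (fun z => besselTerm a b k z y) k = _
    unfold besselTerm
    rw [torusFourierCoeff_const_mul, torusFourierCoeff_torusExp, if_pos rfl, mul_one]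
  · intro l hl
    change torusFourierCoeff (fun z => besselTerm a b l z y) k = _
    unfold besselTerm
    rw [torusFourierCoeff_const_mul, torusFourierCoeff_torusExp, if_neg hl, mul_zero]

end BesselSeries

/-! ### Existence of a solution of the extension problem -/

section Existence

variable {n : ℕ}

theorem torusCoeff_neg (v : Torus n → ℝ) (k : Fin n → ℤ) :
    torusCoeff v (-k) = starRingEnd ℂ (torusCoeff v k) := by
  rw [torusCoeff, torusCoeff, map_mul, map_pow, map_inv₀, Complex.conj_ofReal, ← integral_conj]
  congr 2
  ext z
  rw [map_mul, Complex.conj_ofReal, torusExp_neg (-k)]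

theorem freqNorm_neg (k : Fin n → ℤ) : freqNorm (-k) = freqNorm k := by
  simp [freqNorm]

/-- The coefficients of the solution of the extension problem as a Bessel series. -/
noncomputable def extCoeff (σ : ℝ) (v : Torus n → ℝ) (k : Fin n → ℤ) : ℂ :=
  torusCoeff v k / (Real.Gamma σ : ℂ)

theorem extCoeff_mul (σ : ℝ) (v : Torus n → ℝ) (k : Fin n → ℤ) (r : ℝ) :
    extCoeff σ v k * (besselInt σ r : ℂ) = torusCoeff v k * (extProfile σ r : ℂ) := by
  rw [extCoeff, extProfile, Complex.ofReal_div]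
  ring

/-- The solution of the extension problem. -/
noncomputable def extension (σ : ℝ) (v : Torus n → ℝ) (z : Torus n) (y : ℝ) : ℝ :=
  (besselSeries (extCoeff σ v) σ z y).re

/-- The coefficients of a real function satisfy `c_{-k} = conj c_k`, so conjugating the series
amounts to reindexing by `k ↦ -k`. -/
theorem ofReal_extension (σ : ℝ) (v : Torus n → ℝ) (z : Torus n) (y : ℝ) :
    (extension σ v z y : ℂ) = besselSeries (extCoeff σ v) σ z y := by
  refine Complex.conj_eq_iff_re.1 ?_
  rw [besselSeries, Complex.conj_tsum, ← (Equiv.neg (Fin n → ℤ)).tsum_eq]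
  refine tsum_congr fun k => ?_
  simp only [Equiv.neg_apply, besselTerm, extCoeff, map_mul, map_div₀, Complex.conj_ofReal,
    torusCoeff_neg, freqNorm_neg, torusExp_neg, Complex.conj_conj]

theorem memLp_ofReal {v : Torus n → ℝ} (hv : MemLp v 2) : MemLp (fun z => (v z : ℂ)) 2 :=
  hv.ofReal

variable {σ : ℝ} {v : Torus n → ℝ}

theorem subexpGrowth_extCoeff (hv : MemLp v 2) : SubexpGrowth (extCoeff σ v) :=
  SubexpGrowth.of_bounded (C := (Real.sqrt ((2 * Real.pi) ^ n))⁻¹ *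
    (eLpNorm (fun z => (v z : ℂ)) 2 volume).toReal / ‖(Real.Gamma σ : ℂ)‖) fun k => by
    rw [extCoeff, norm_div]
    exact div_le_div_of_nonneg_right (norm_torusFourierCoeff_le (memLp_ofReal hv) k)
      (norm_nonneg _)

theorem contDiffOn_extension (hv : MemLp v 2) : ContDiffOn ℝ 2
    (fun p : EuclideanSpace ℝ (Fin n) × ℝ => extension σ v (Torus.mk p.1) p.2) (halfSpace n) :=
  Complex.reCLM.contDiff.comp_contDiffOn
    (contDiffOn_besselSeries 2 (subexpGrowth_extCoeff hv) σ)

theorem coeff_extension (hv : MemLp v 2) (k : Fin n → ℤ) {y : ℝ} (hy : 0 < y) :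
    torusFourierCoeff (fun z => (extension σ v z y : ℂ)) k =
      torusCoeff v k * (extProfile σ (freqNorm k * y) : ℂ) := by
  simp only [ofReal_extension]
  rw [torusFourierCoeff_besselSeries (subexpGrowth_extCoeff hv) σ k hy, extCoeff_mul]

theorem coeff_torusDeriv_extension (hv : MemLp v 2) (k : Fin n → ℤ) {y : ℝ} (hy : 0 < y) :
    torusFourierCoeff (fun z => (torusDeriv (extension σ v) (0, 1) z y : ℂ)) k =
      torusCoeff v k * (extProfileDeriv σ (freqNorm k) y : ℂ) := by
  refine (hasDerivAt_coeff (contDiffOn_extension hv) k hy).unique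
    (((hasDerivAt_extProfile σ (freqNorm_nonneg k) hy).ofReal_comp.const_mul
      (torusCoeff v k)).congr_of_eventuallyEq ?_)
  filter_upwards [Ioi_mem_nhds hy] with t ht using coeff_extension hv k ht

/-- The left-hand side is continuous in `z` and its Fourier coefficients vanish by the equation for
the profile, so no second derivative of the series has to be computed. -/
theorem extensionOperator_extension (hv : MemLp v 2) (z : Torus n) {y : ℝ} (hy : 0 < y) :
    extensionOperator σ (extension σ v) z y = 0 := by
  have hC := contDiffOn_extension (σ := σ) hv
  have h0 (k : Fin n → ℤ) : torusFourierCoeff (fun _ : Torus n => ((0 : ℝ) : ℂ)) k = 0 := by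
    simp [torusFourierCoeff]
  have h1 := eq_of_torusFourierCoeff
    (Complex.continuous_ofReal.comp (continuous_extensionOperator hC σ hy))
    (continuous_const (y := ((0 : ℝ) : ℂ))) fun k => by
      refine (coeff_extensionOperator hC σ k hy).trans ?_
      have h2 := (hasDerivAt_coeff_torusDeriv hC k hy).unique
        (((hasDerivAt_extProfileDeriv σ (freqNorm_nonneg k) hy).ofReal_comp.const_mul
          (torusCoeff v k)).congr_of_eventuallyEq (by
            filter_upwards [Ioi_mem_nhds hy] with t ht using coeff_torusDeriv_extension hv k ht))
      rw [h0, h2, coeff_extension hv k hy, coeff_torusDeriv_extension hv k hy]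
      push_cast
      ring
  exact Complex.ofReal_injective (congrFun h1 z)

theorem memLp_extension (hv : MemLp v 2) {y : ℝ} (hy : 0 < y) :
    MemLp (fun z => (extension σ v z y : ℂ)) 2 :=
  memLp_of_continuous_torus
    (Complex.continuous_ofReal.comp (continuous_torus_slice (contDiffOn_extension hv) hy))

theorem eLpNorm_complex_ofReal (f : Torus n → ℝ) :
    eLpNorm (fun z => (f z : ℂ)) 2 volume = eLpNorm f 2 volume :=
  eLpNorm_congr_norm_ae (Eventually.of_forall fun z => by simp)

theorem eLpNorm_extension_le (hσ : 0 < σ) (hv : MemLp v 2) {y : ℝ} (hy : 0 < y) :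
    eLpNorm (fun z => extension σ v z y) 2 volume ≤ eLpNorm v 2 volume := by
  rw [← eLpNorm_complex_ofReal, ← eLpNorm_complex_ofReal v]
  have h1 := memLp_extension (σ := σ) hv hy
  have h2 := memLp_ofReal hv
  rw [← ENNReal.toReal_le_toReal h1.2.ne h2.2.ne]
  refine abs_le_of_sq_le_sq' ?_ ENNReal.toReal_nonneg |>.2
  refine hasSum_le (fun k => ?_) (hasSum_sq_torusFourierCoeff h1) (hasSum_sq_torusFourierCoeff h2)
  rw [coeff_extension hv k hy, norm_mul, Complex.norm_real,
    Real.norm_of_nonneg (extProfile_nonneg hσ _), torusCoeff_eq]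
  have h3 := mul_le_of_le_one_right (norm_nonneg (torusFourierCoeff (fun z => (v z : ℂ)) k))
    (extProfile_le_one hσ (freqNorm k * y))
  have h4 := extProfile_nonneg hσ (freqNorm k * y)
  gcongr

theorem tendsto_eLpNorm_extension (hσ : 0 < σ) (hv : MemLp v 2) :
    Tendsto (fun y => eLpNorm (fun z => extension σ v z y - v z) 2 volume) (𝓝[>] 0) (𝓝 0) := by
  have h := tendsto_eLpNorm_of_multiplier (l := 𝓝[>] (0 : ℝ)) (memLp_ofReal hv)
    (F := fun y z => (extension σ v z y : ℂ)) (m := fun y k => extProfile σ (freqNorm k * y))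
    ?_ ?_ ?_ ?_ fun k => tendsto_extProfile hσ (freqNorm k)
  · refine h.congr fun y => ?_
    rw [← eLpNorm_complex_ofReal]
    simp only [Complex.ofReal_sub]
  · filter_upwards [self_mem_nhdsWithin] with y hy using memLp_extension hv hy
  · filter_upwards [self_mem_nhdsWithin] with y hy k
    rw [coeff_extension hv k hy, torusCoeff_eq, mul_comm]
  · exact Eventually.of_forall fun y k => extProfile_nonneg hσ _
  · exact Eventually.of_forall fun y k => extProfile_le_one hσ _

theorem isExtension_extension (hσ : 0 < σ) (hv : MemLp v 2) :
    IsExtension σ v (extension σ v) where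
  contDiffOn := contDiffOn_extension hv
  equation x y hy := by
    rw [← extensionOperator_mk (contDiffOn_extension hv) σ x hy]
    exact extensionOperator_extension hv _ hy
  bounded := by
    refine ⟨(eLpNorm v 2 volume).toNNReal, fun y hy => ?_⟩
    rw [ENNReal.coe_toNNReal hv.2.ne]
    exact eLpNorm_extension_le hσ hv hy
  boundary φ hφ := by
    have hc {y : ℝ} (hy : 0 < y) : MemLp (fun z => extension σ v z y) 2 :=
      (continuous_torus_slice (contDiffOn_extension hv) hy).memLp_of_hasCompactSupport
        (HasCompactSupport.of_compactSpace _)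
    -- The boundary value is attained even strongly in `L²`; Hölder's inequality against `φ` gives
    -- the weak convergence.
    refine tendsto_integral_of_L1' _ (hv.integrable_mul hφ).aestronglyMeasurable ?_ ?_
    · filter_upwards [self_mem_nhdsWithin] with y hy
      exact (hc hy).integrable_mul hφ
    · have h1 := ENNReal.Tendsto.mul_const (b := eLpNorm φ 2 volume)
        (tendsto_eLpNorm_extension hσ hv) (Or.inr hφ.2.ne)
      rw [zero_mul] at h1
      refine tendsto_of_tendsto_of_tendsto_of_le_of_le' tendsto_const_nhds h1
        (Eventually.of_forall fun _ => zero_le) ?_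
      filter_upwards [self_mem_nhdsWithin] with y hy
      have h2 := eLpNorm_smul_le_mul_eLpNorm (p := 2) (q := 2) (r := 1) hφ.1 ((hc hy).sub hv).1
      refine le_trans (le_of_eq ?_) h2
      congr 1
      ext z
      simp [sub_mul]

end Existence

/-! ### The Poisson kernel of the extension problem on `ℝⁿ` -/

section PoissonKernel

variable {n : ℕ}

/-- The Poisson kernel `A y^{2τ} (y² + |w|²)^{-(n/2 + τ)}` of the extension problem on `ℝⁿ`, with
`A` such that its integral in `w` is one. -/
noncomputable def extKernel (τ y : ℝ) (w : EuclideanSpace ℝ (Fin n)) : ℝ :=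
  Real.Gamma (n / 2 + τ) / (Real.Gamma τ * Real.pi ^ (n / 2 : ℝ)) * y ^ (2 * τ) *
    (y ^ 2 + ‖w‖ ^ 2) ^ (-(n / 2 + τ))

theorem extKernel_nonneg {τ y : ℝ} (hτ : 0 < τ) (hy : 0 < y)
    (w : EuclideanSpace ℝ (Fin n)) : 0 ≤ extKernel τ y w := by
  unfold extKernel
  have := Real.Gamma_pos_of_pos hτ
  have := Real.Gamma_pos_of_pos (show 0 < (n / 2 + τ : ℝ) by positivity)
  positivity

theorem extKernel_pos {τ y : ℝ} (hτ : 0 < τ) (hy : 0 < y)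
    (w : EuclideanSpace ℝ (Fin n)) : 0 < extKernel τ y w := by
  unfold extKernel
  have := Real.Gamma_pos_of_pos hτ
  have := Real.Gamma_pos_of_pos (show 0 < (n / 2 + τ : ℝ) by positivity)
  positivity

theorem continuous_extKernel (τ : ℝ) {y : ℝ} (hy : 0 < y) :
    Continuous (extKernel τ y : EuclideanSpace ℝ (Fin n) → ℝ) := by
  unfold extKernel
  refine continuous_const.mul (Continuous.rpow_const (by fun_prop) fun w => Or.inl ?_)
  positivity

theorem continuousAt_extKernel_left (τ : ℝ) {y : ℝ} (hy : 0 < y)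
    (w : EuclideanSpace ℝ (Fin n)) : ContinuousAt (fun y => extKernel τ y w) y := by
  unfold extKernel
  refine (continuousAt_const.mul (continuousAt_id.rpow_const (Or.inl hy.ne'))).mul
    (ContinuousAt.rpow_const (by fun_prop) (Or.inl ?_))
  positivity

theorem extKernel_eq_scale (τ : ℝ) {y : ℝ} (hy : 0 < y) (w : EuclideanSpace ℝ (Fin n)) :
    extKernel τ y w = (y ^ n)⁻¹ * extKernel τ 1 (y⁻¹ • w) := by
  unfold extKernel
  have h : y ^ 2 + ‖w‖ ^ 2 = y ^ 2 * (1 ^ 2 + ‖y⁻¹ • w‖ ^ 2) := by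
    rw [norm_smul, Real.norm_of_nonneg (inv_nonneg.2 hy.le)]
    field_simp
  have h2 : (y ^ 2) ^ (-(n / 2 + τ) : ℝ) = (y ^ n)⁻¹ * (y ^ (2 * τ))⁻¹ := by
    rw [← Real.rpow_natCast y 2, ← Real.rpow_mul hy.le, ← Real.rpow_natCast y n,
      ← Real.rpow_neg hy.le, ← Real.rpow_neg hy.le, ← Real.rpow_add hy]
    congr 1
    push_cast
    ring
  have : 0 < y ^ (2 * τ) := Real.rpow_pos_of_pos hy _
  rw [h, Real.mul_rpow (by positivity) (by positivity), h2, Real.one_rpow]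
  field_simp

/-- `extKernel τ 1` as a mixture of Gaussians. -/
theorem extKernel_one_eq {τ : ℝ} (hτ : 0 < τ) (w : EuclideanSpace ℝ (Fin n)) :
    extKernel τ 1 w = (Real.Gamma τ * Real.pi ^ (n / 2 : ℝ))⁻¹ *
      ∫ t in Set.Ioi (0 : ℝ), t ^ ((n / 2 + τ) - 1 : ℝ) * Real.exp (-((1 + ‖w‖ ^ 2) * t)) := by
  have h : (0 : ℝ) < 1 + ‖w‖ ^ 2 := by positivity
  rw [Real.integral_rpow_mul_exp_neg_mul_Ioi (by positivity) h, extKernel, Real.one_rpow,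
    one_pow, Real.rpow_neg h.le, one_div, Real.inv_rpow h.le]
  ring

/-- The factor `(π/t)^{n/2}` from the Gaussian cancels the `t^{n/2}` of the mixture. What is left is
exactly `besselKernel τ`, which is why the transform of the Poisson kernel is the profile in every
dimension. -/
theorem integral_gaussian_mul_cexp (τ : ℝ) (ξ : EuclideanSpace ℝ (Fin n)) {t : ℝ} (ht : 0 < t) :
    ∫ w : EuclideanSpace ℝ (Fin n),
      ((t ^ ((n / 2 + τ) - 1 : ℝ) * Real.exp (-((1 + ‖w‖ ^ 2) * t)) : ℝ) : ℂ) *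
        Complex.exp ((⟪ξ, w⟫_ℝ : ℂ) * Complex.I) =
      ((Real.pi ^ (n / 2 : ℝ) * besselKernel τ ‖ξ‖ t : ℝ) : ℂ) := by
  have h1 (w : EuclideanSpace ℝ (Fin n)) :
      ((t ^ ((n / 2 + τ) - 1 : ℝ) * Real.exp (-((1 + ‖w‖ ^ 2) * t)) : ℝ) : ℂ) *
        Complex.exp ((⟪ξ, w⟫_ℝ : ℂ) * Complex.I) =
      ((t ^ ((n / 2 + τ) - 1 : ℝ) * Real.exp (-t) : ℝ) : ℂ) *
        Complex.exp (-(t : ℂ) * ‖w‖ ^ 2 + Complex.I * ⟪ξ, w⟫_ℝ) := by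
    push_cast
    rw [mul_assoc, mul_assoc, ← Complex.exp_add, ← Complex.exp_add]
    congr 2
    ring
  simp_rw [h1]
  rw [integral_const_mul, GaussianFourier.integral_cexp_neg_mul_sq_norm_add (by simpa using ht),
    finrank_euclideanSpace_fin, Complex.I_sq, ← Complex.ofReal_div]
  have h2 : ((Real.pi / t : ℝ) : ℂ) ^ ((n : ℂ) / 2) = (((Real.pi / t) ^ (n / 2 : ℝ) : ℝ) : ℂ) := by
    rw [Complex.ofReal_cpow (by positivity)]
    simp
  have h3 : Complex.exp (-1 * (‖ξ‖ : ℂ) ^ 2 / (4 * t)) =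
      (Real.exp (-(‖ξ‖ ^ 2 / (4 * t))) : ℝ) := by
    push_cast
    congr 1
    ring
  rw [h2, h3, ← Complex.ofReal_mul, ← Complex.ofReal_mul, besselKernel,
    Real.div_rpow Real.pi_pos.le ht.le, sub_eq_add_neg (-t), Real.exp_add,
    show (n / 2 + τ - 1 : ℝ) = (n / 2 : ℝ) + (τ - 1) by ring, Real.rpow_add ht]
  have : 0 < t ^ (n / 2 : ℝ) := Real.rpow_pos_of_pos ht _
  congr 1
  field_simp

theorem integrable_gaussian (τ : ℝ) {t : ℝ} (ht : 0 < t) :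
    Integrable fun w : EuclideanSpace ℝ (Fin n) =>
      t ^ ((n / 2 + τ) - 1 : ℝ) * Real.exp (-((1 + ‖w‖ ^ 2) * t)) := by
  have h := (GaussianFourier.integrable_cexp_neg_mul_sq_norm_add (V := EuclideanSpace ℝ (Fin n))
    (b := t) (by simpa using ht) 0 0).norm.const_mul (t ^ ((n / 2 + τ) - 1 : ℝ) * Real.exp (-t))
  refine h.congr (Eventually.of_forall fun w => ?_)
  simp only [zero_mul, add_zero, Complex.norm_exp]
  rw [mul_assoc, ← Real.exp_add]
  congr 2
  norm_cast
  ring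

theorem integral_rpow_mul_gaussian (τ : ℝ) {t : ℝ} (ht : 0 < t) :
    ∫ w : EuclideanSpace ℝ (Fin n),
      t ^ ((n / 2 + τ) - 1 : ℝ) * Real.exp (-((1 + ‖w‖ ^ 2) * t)) =
      Real.pi ^ (n / 2 : ℝ) * besselKernel τ 0 t := by
  have h := integral_gaussian_mul_cexp τ (0 : EuclideanSpace ℝ (Fin n)) ht
  simp only [inner_zero_left, Complex.ofReal_zero, zero_mul, Complex.exp_zero, mul_one,
    norm_zero] at h
  rw [integral_complex_ofReal] at h
  exact_mod_cast h

/-- Justifies Fubini for the mixture of Gaussians: integrating the norm over `w` leaves a multiple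
of the integrand of `Γ(τ)`. -/
theorem integrable_prod_gaussian {τ : ℝ} (hτ : 0 < τ) (ξ : EuclideanSpace ℝ (Fin n)) :
    Integrable (fun p : EuclideanSpace ℝ (Fin n) × ℝ =>
      ((p.2 ^ ((n / 2 + τ) - 1 : ℝ) * Real.exp (-((1 + ‖p.1‖ ^ 2) * p.2)) : ℝ) : ℂ) *
        Complex.exp ((⟪ξ, p.1⟫_ℝ : ℂ) * Complex.I))
      (volume.prod (volume.restrict (Set.Ioi 0))) := by
  have hn (w : EuclideanSpace ℝ (Fin n)) {t : ℝ} (ht : 0 < t) :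
      ‖((t ^ ((n / 2 + τ) - 1 : ℝ) * Real.exp (-((1 + ‖w‖ ^ 2) * t)) : ℝ) : ℂ) *
        Complex.exp ((⟪ξ, w⟫_ℝ : ℂ) * Complex.I)‖ =
      t ^ ((n / 2 + τ) - 1 : ℝ) * Real.exp (-((1 + ‖w‖ ^ 2) * t)) := by
    rw [norm_mul, Complex.norm_exp_ofReal_mul_I, mul_one, Complex.norm_of_nonneg]
    positivity
  rw [integrable_prod_iff' (by
    refine Measurable.aestronglyMeasurable ?_
    fun_prop)]
  constructor
  · filter_upwards [ae_restrict_mem measurableSet_Ioi] with t ht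
    refine (integrable_gaussian (n := n) τ ht).mono' (by fun_prop) ?_
    exact Eventually.of_forall fun w => (hn w ht).le
  · have h0 : IntegrableOn (fun t => Real.pi ^ (n / 2 : ℝ) * besselKernel τ 0 t) (Set.Ioi 0) := by
      refine Integrable.const_mul ?_ _
      refine (Real.GammaIntegral_convergent hτ).congr_fun (fun t _ => ?_) measurableSet_Ioi
      simp [besselKernel]
    refine h0.congr ?_
    filter_upwards [ae_restrict_mem measurableSet_Ioi] with t ht
    rw [← integral_rpow_mul_gaussian τ ht]
    exact integral_congr_ae (Eventually.of_forall fun w => (hn w ht).symm)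

theorem extKernel_one_mul_cexp {τ : ℝ} (hτ : 0 < τ) (ξ w : EuclideanSpace ℝ (Fin n)) :
    (extKernel τ 1 w : ℂ) * Complex.exp ((⟪ξ, w⟫_ℝ : ℂ) * Complex.I) =
      ((Real.Gamma τ * Real.pi ^ (n / 2 : ℝ))⁻¹ : ℝ) * ∫ t in Set.Ioi (0 : ℝ),
        ((t ^ ((n / 2 + τ) - 1 : ℝ) * Real.exp (-((1 + ‖w‖ ^ 2) * t)) : ℝ) : ℂ) *
          Complex.exp ((⟪ξ, w⟫_ℝ : ℂ) * Complex.I) := by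
  rw [extKernel_one_eq hτ, integral_mul_const, integral_complex_ofReal]
  push_cast
  ring

theorem integrable_extKernel_one {τ : ℝ} (hτ : 0 < τ) :
    Integrable (extKernel τ 1 : EuclideanSpace ℝ (Fin n) → ℝ) := by
  have h := ((integrable_prod_gaussian (n := n) hτ 0).integral_prod_left).const_mul
    (((Real.Gamma τ * Real.pi ^ (n / 2 : ℝ))⁻¹ : ℝ) : ℂ)
  have h2 : Integrable fun w : EuclideanSpace ℝ (Fin n) => (extKernel τ 1 w : ℂ) := by
    refine h.congr (Eventually.of_forall fun w => ?_)
    exact (extKernel_one_mul_cexp hτ 0 w).symm.trans (by simp)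
  exact h2.re

theorem integral_extKernel_one_mul_cexp {τ : ℝ} (hτ : 0 < τ)
    (ξ : EuclideanSpace ℝ (Fin n)) :
    ∫ w, (extKernel τ 1 w : ℂ) * Complex.exp ((⟪ξ, w⟫_ℝ : ℂ) * Complex.I) =
      (extProfile τ ‖ξ‖ : ℂ) := by
  simp_rw [extKernel_one_mul_cexp hτ]
  rw [integral_const_mul, integral_integral_swap (integrable_prod_gaussian hτ ξ),
    setIntegral_congr_fun measurableSet_Ioi fun t ht => integral_gaussian_mul_cexp τ ξ ht,
    integral_complex_ofReal, integral_const_mul, ← Complex.ofReal_mul]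
  have : 0 < Real.pi ^ (n / 2 : ℝ) := by positivity
  have := Real.Gamma_pos_of_pos hτ
  congr 1
  change _ * (_ * besselInt τ ‖ξ‖) = besselInt τ ‖ξ‖ / _
  field_simp

theorem integrable_extKernel {τ y : ℝ} (hτ : 0 < τ) (hy : 0 < y) :
    Integrable (extKernel τ y : EuclideanSpace ℝ (Fin n) → ℝ) := by
  rw [funext (extKernel_eq_scale τ hy)]
  exact ((integrable_extKernel_one hτ).comp_smul (inv_ne_zero hy.ne')).const_mul _

/-- The Fourier transform of the Poisson kernel. -/
theorem integral_extKernel_mul_cexp {τ y : ℝ} (hτ : 0 < τ) (hy : 0 < y)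
    (ξ : EuclideanSpace ℝ (Fin n)) :
    ∫ w, (extKernel τ y w : ℂ) * Complex.exp ((⟪ξ, w⟫_ℝ : ℂ) * Complex.I) =
      (extProfile τ (‖ξ‖ * y) : ℂ) := by
  have h := Measure.integral_comp_inv_smul_of_nonneg volume (fun w : EuclideanSpace ℝ (Fin n) =>
    (extKernel τ 1 w : ℂ) * Complex.exp ((⟪y • ξ, w⟫_ℝ : ℂ) * Complex.I)) hy.le
  rw [integral_extKernel_one_mul_cexp hτ, norm_smul, Real.norm_of_nonneg hy.le,
    finrank_euclideanSpace_fin] at h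
  have h2 (w : EuclideanSpace ℝ (Fin n)) :
      (extKernel τ y w : ℂ) * Complex.exp ((⟪ξ, w⟫_ℝ : ℂ) * Complex.I) =
      ((y ^ n)⁻¹ : ℝ) * ((extKernel τ 1 (y⁻¹ • w) : ℂ) *
        Complex.exp ((⟪y • ξ, y⁻¹ • w⟫_ℝ : ℂ) * Complex.I)) := by
    rw [extKernel_eq_scale τ hy, inner_smul_left, inner_smul_right,
      RCLike.conj_to_real, mul_inv_cancel_left₀ hy.ne', Complex.ofReal_mul]
    ring
  simp_rw [h2]
  rw [integral_const_mul, h, mul_comm y, Complex.real_smul, ← mul_assoc, ← Complex.ofReal_mul,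
    inv_mul_cancel₀ (by positivity), Complex.ofReal_one, one_mul]

theorem integral_extKernel {τ y : ℝ} (hτ : 0 < τ) (hy : 0 < y) :
    ∫ w : EuclideanSpace ℝ (Fin n), extKernel τ y w = 1 := by
  have h := integral_extKernel_mul_cexp hτ hy (0 : EuclideanSpace ℝ (Fin n))
  simp only [inner_zero_left, Complex.ofReal_zero, zero_mul, Complex.exp_zero, mul_one,
    norm_zero] at h
  rw [integral_complex_ofReal, extProfile, besselInt_zero_right hτ,
    div_self (Real.Gamma_pos_of_pos hτ).ne'] at h
  exact_mod_cast h

/-- Comparison of the Poisson kernels at different heights. -/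
theorem extKernel_le {τ y a b : ℝ} (hτ : 0 < τ) (ha : 0 < a) (hay : a ≤ y) (hyb : y ≤ b)
    (w : EuclideanSpace ℝ (Fin n)) :
    extKernel τ y w ≤ b ^ (2 * τ) * (min 1 (a ^ 2)) ^ (-(n / 2 + τ) : ℝ) *
      extKernel τ 1 w := by
  have hm : 0 < min 1 (a ^ 2) := lt_min one_pos (by positivity)
  have h1 : min 1 (a ^ 2) * (1 ^ 2 + ‖w‖ ^ 2) ≤ y ^ 2 + ‖w‖ ^ 2 := by
    have : a ^ 2 ≤ y ^ 2 := by gcongr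
    have := min_le_left 1 (a ^ 2)
    have := min_le_right 1 (a ^ 2)
    nlinarith [sq_nonneg ‖w‖]
  have h2 : (y ^ 2 + ‖w‖ ^ 2) ^ (-(n / 2 + τ) : ℝ) ≤
      (min 1 (a ^ 2)) ^ (-(n / 2 + τ) : ℝ) * (1 ^ 2 + ‖w‖ ^ 2) ^ (-(n / 2 + τ) : ℝ) := by
    rw [← Real.mul_rpow hm.le (by positivity)]
    exact Real.rpow_le_rpow_of_nonpos (by positivity) h1 (by
      have : (0 : ℝ) ≤ n / 2 + τ := by positivity
      linarith)
  have h3 : y ^ (2 * τ) ≤ b ^ (2 * τ) :=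
    Real.rpow_le_rpow (ha.trans_le hay).le hyb (by positivity)
  have := Real.Gamma_pos_of_pos hτ
  have := Real.Gamma_pos_of_pos (show 0 < (n / 2 + τ : ℝ) by positivity)
  have hy : 0 < y := ha.trans_le hay
  have : 0 < b := hy.trans_le hyb
  unfold extKernel
  rw [Real.one_rpow, mul_one]
  calc _ ≤ Real.Gamma (n / 2 + τ) / (Real.Gamma τ * Real.pi ^ (n / 2 : ℝ)) * b ^ (2 * τ) *
      ((min 1 (a ^ 2)) ^ (-(n / 2 + τ) : ℝ) * (1 ^ 2 + ‖w‖ ^ 2) ^ (-(n / 2 + τ) : ℝ)) := by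
        gcongr
    _ = _ := by ring

/-- Away from the origin the Poisson kernel is small near the boundary. -/
theorem extKernel_le_of_le_norm {τ y δ : ℝ} (hτ : 0 < τ) (hy : 0 < y) (hδ : 0 < δ)
    {w : EuclideanSpace ℝ (Fin n)} (hw : δ ≤ ‖w‖) :
    extKernel τ y w ≤ y ^ (2 * τ) * (min (1 / 2) (δ ^ 2 / 2)) ^ (-(n / 2 + τ) : ℝ) *
      extKernel τ 1 w := by
  have hm : 0 < min (1 / 2) (δ ^ 2 / 2) := lt_min (by norm_num) (by positivity)
  -- Of the two halves of `‖w‖²`, one dominates `δ²/2` and the other supplies `‖w‖²/2`.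
  have h1 : min (1 / 2) (δ ^ 2 / 2) * (1 ^ 2 + ‖w‖ ^ 2) ≤ y ^ 2 + ‖w‖ ^ 2 := by
    have : δ ^ 2 ≤ ‖w‖ ^ 2 := by gcongr
    have := min_le_left (1 / 2) (δ ^ 2 / 2)
    have := min_le_right (1 / 2) (δ ^ 2 / 2)
    nlinarith [sq_nonneg ‖w‖, sq_nonneg y]
  have h2 : (y ^ 2 + ‖w‖ ^ 2) ^ (-(n / 2 + τ) : ℝ) ≤
      (min (1 / 2) (δ ^ 2 / 2)) ^ (-(n / 2 + τ) : ℝ) *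
        (1 ^ 2 + ‖w‖ ^ 2) ^ (-(n / 2 + τ) : ℝ) := by
    rw [← Real.mul_rpow hm.le (by positivity)]
    exact Real.rpow_le_rpow_of_nonpos (by positivity) h1 (by
      have : (0 : ℝ) ≤ n / 2 + τ := by positivity
      linarith)
  have := Real.Gamma_pos_of_pos hτ
  have := Real.Gamma_pos_of_pos (show 0 < (n / 2 + τ : ℝ) by positivity)
  unfold extKernel
  rw [Real.one_rpow, mul_one]
  calc _ ≤ Real.Gamma (n / 2 + τ) / (Real.Gamma τ * Real.pi ^ (n / 2 : ℝ)) * y ^ (2 * τ) *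
      ((min (1 / 2) (δ ^ 2 / 2)) ^ (-(n / 2 + τ) : ℝ) *
        (1 ^ 2 + ‖w‖ ^ 2) ^ (-(n / 2 + τ) : ℝ)) := by
        gcongr
    _ = _ := by ring

/-- The superlevel sets of the Poisson kernel are balls. -/
theorem setOf_lt_extKernel {τ y t : ℝ} (hτ : 0 < τ) (hy : 0 < y) (ht : 0 < t) :
    {w : EuclideanSpace ℝ (Fin n) | t < extKernel τ y w} = ∅ ∨
      ∃ r : ℝ, 0 < r ∧ {w : EuclideanSpace ℝ (Fin n) | t < extKernel τ y w} = Metric.ball 0 r := by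
  have := Real.Gamma_pos_of_pos hτ
  have hq : 0 < (n / 2 + τ : ℝ) := by positivity
  have := Real.Gamma_pos_of_pos hq
  set B := Real.Gamma (n / 2 + τ) / (Real.Gamma τ * Real.pi ^ (n / 2 : ℝ)) * y ^ (2 * τ) with hB
  have hB0 : 0 < B := by positivity
  have key (w : EuclideanSpace ℝ (Fin n)) :
      t < extKernel τ y w ↔ ‖w‖ ^ 2 < (B / t) ^ (n / 2 + τ : ℝ)⁻¹ - y ^ 2 := by
    have h : 0 < y ^ 2 + ‖w‖ ^ 2 := by positivity
    rw [extKernel, ← hB, Real.rpow_neg h.le, ← div_eq_mul_inv,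
      lt_div_iff₀ (Real.rpow_pos_of_pos h _), mul_comm, ← lt_div_iff₀ ht, lt_sub_iff_add_lt',
      Real.lt_rpow_inv_iff_of_pos h.le (by positivity) hq]
  rcases le_or_gt ((B / t) ^ (n / 2 + τ : ℝ)⁻¹ - y ^ 2) 0 with hD | hD
  · left
    ext w
    simp only [Set.mem_ofPred_eq, key, Set.mem_empty_iff_false, iff_false, not_lt]
    exact hD.trans (by positivity)
  · refine Or.inr ⟨_, Real.sqrt_pos.2 hD, ?_⟩
    ext w
    rw [Set.mem_ofPred_eq, key, mem_ball_zero_iff, Real.lt_sqrt (norm_nonneg w)]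

end PoissonKernel

/-! ### Convergence of Poisson integrals at Lebesgue points -/

section LebesguePoints

variable {n : ℕ}

theorem lintegral_extKernel {τ y : ℝ} (hτ : 0 < τ) (hy : 0 < y) :
    ∫⁻ w : EuclideanSpace ℝ (Fin n), ENNReal.ofReal (extKernel τ y w) = 1 := by
  rw [← ofReal_integral_eq_lintegral_ofReal (integrable_extKernel hτ hy)
    (Eventually.of_forall fun w => extKernel_nonneg hτ hy w), integral_extKernel hτ hy,
    ENNReal.ofReal_one]

/-- A measure dominated on centred balls by a multiple of the Lebesgue measure is dominated
likewise when tested against the Poisson kernel. -/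
theorem lintegral_extKernel_le {τ y : ℝ} (hτ : 0 < τ) (hy : 0 < y)
    (μ : Measure (EuclideanSpace ℝ (Fin n))) (ε : ℝ≥0∞)
    (h : ∀ r : ℝ, 0 < r → μ (Metric.ball 0 r) ≤
      ε * volume (Metric.ball (0 : EuclideanSpace ℝ (Fin n)) r)) :
    ∫⁻ w, ENNReal.ofReal (extKernel τ y w) ∂μ ≤ ε := by
  have hm : Measurable (extKernel τ y : EuclideanSpace ℝ (Fin n) → ℝ) :=
    (continuous_extKernel τ hy).measurable
  -- Layer-cake formula: only the measures of superlevel sets matter, and for this kernel they are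
  -- empty or centred balls.
  have key (ν : Measure (EuclideanSpace ℝ (Fin n))) :=
    lintegral_eq_lintegral_meas_lt ν (f := extKernel τ y)
      (Eventually.of_forall fun w => extKernel_nonneg hτ hy w) hm.aemeasurable
  calc ∫⁻ w, ENNReal.ofReal (extKernel τ y w) ∂μ
      ≤ ∫⁻ t in Set.Ioi 0, ε * volume {w : EuclideanSpace ℝ (Fin n) | t < extKernel τ y w} := by
        rw [key μ]
        refine setLIntegral_mono' measurableSet_Ioi fun t ht => ?_
        rcases setOf_lt_extKernel (n := n) hτ hy ht with hs | ⟨r, hr, hs⟩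
        · simp [hs]
        · rw [hs]
          exact h r hr
    _ = ε * ∫⁻ w : EuclideanSpace ℝ (Fin n), ENNReal.ofReal (extKernel τ y w) := by
        rw [key volume, lintegral_const_mul]
        exact Antitone.measurable fun a b hab => measure_mono fun w hw => lt_of_le_of_lt hab hw
    _ = ε := by rw [lintegral_extKernel hτ hy, mul_one]

/-- Convergence of Poisson integrals at a point where the averages over small balls tend to `0`. -/
theorem tendsto_lintegral_extKernel {τ : ℝ} (hτ : 0 < τ)
    {F : EuclideanSpace ℝ (Fin n) → ℝ≥0∞} (hF : Measurable F)
    (hF1 : ∫⁻ w, F w * ENNReal.ofReal (extKernel τ 1 w) ≠ ∞)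
    (hF0 : Tendsto (fun r => (∫⁻ w in Metric.closedBall 0 r, F w) /
      volume (Metric.closedBall (0 : EuclideanSpace ℝ (Fin n)) r)) (𝓝[>] 0) (𝓝 0)) :
    Tendsto (fun y => ∫⁻ w, F w * ENNReal.ofReal (extKernel τ y w)) (𝓝[>] 0) (𝓝 0) := by
  rw [ENNReal.tendsto_nhds_zero]
  intro ε hε
  have hε2 : 0 < ε / 2 := ENNReal.half_pos hε.ne'
  have h0 := (ENNReal.tendsto_nhds_zero.1 hF0) _ hε2
  obtain ⟨δ, hδ, hδ'⟩ := mem_nhdsGT_iff_exists_Ioo_subset.1 h0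
  have hδ : 0 < δ := hδ
  have hvol (r : ℝ) (hr : 0 < r) : volume (Metric.closedBall (0 : EuclideanSpace ℝ (Fin n)) r) =
      volume (Metric.ball (0 : EuclideanSpace ℝ (Fin n)) r) := by
    rw [Measure.addHaar_closedBall _ _ hr.le, Measure.addHaar_ball_of_pos _ _ hr]
  have hball (r : ℝ) (hr : 0 < r) (hrδ : r < δ) : ∫⁻ w in Metric.ball 0 r, F w ≤
      ε / 2 * volume (Metric.ball (0 : EuclideanSpace ℝ (Fin n)) r) := by
    have h := hδ' ⟨hr, hrδ⟩
    rw [Set.mem_ofPred_eq, ENNReal.div_le_iff_le_mul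
      (Or.inl (Metric.measure_closedBall_pos _ _ hr).ne')
      (Or.inl measure_closedBall_lt_top.ne), hvol r hr] at h
    exact (lintegral_mono_set Metric.ball_subset_closedBall).trans h
  -- The average bound holds for radii strictly below `δ`; halving makes it available at `δ'`
  -- itself.
  set δ' := δ / 2 with hδ2
  have hδ'0 : 0 < δ' := half_pos hδ
  have hlocal (y : ℝ) (hy : 0 < y) : ∫⁻ w in Metric.ball 0 δ',
      F w * ENNReal.ofReal (extKernel τ y w) ≤ ε / 2 := by
    have hm : Measurable (extKernel τ y : EuclideanSpace ℝ (Fin n) → ℝ) :=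
      (continuous_extKernel τ hy).measurable
    -- Cutting the density off at radius `δ'` makes the ball estimate hold for every radius, large
    -- ones included.
    have h := lintegral_extKernel_le hτ hy ((volume.restrict (Metric.ball 0 δ')).withDensity F)
      (ε / 2) fun r hr => ?_
    · rw [lintegral_withDensity_eq_lintegral_mul _ hF hm.ennreal_ofReal] at h
      exact h
    · rw [withDensity_apply _ Metric.isOpen_ball.measurableSet,
        Measure.restrict_restrict Metric.isOpen_ball.measurableSet]
      rcases le_total r δ' with h | h
      · rw [Set.inter_eq_left.2 (Metric.ball_subset_ball h)]
        exact hball r hr (by linarith)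
      · rw [Set.inter_eq_right.2 (Metric.ball_subset_ball h)]
        refine (hball δ' hδ'0 (by linarith)).trans ?_
        gcongr
  set K := (min (1 / 2) (δ' ^ 2 / 2)) ^ (-(n / 2 + τ) : ℝ) with hK
  set I := ∫⁻ w, F w * ENNReal.ofReal (extKernel τ 1 w) with hI
  -- Away from the origin the kernel is `y^{2τ}` times a fixed multiple of the kernel at height one,
  -- against which `F` is integrable.
  have htail (y : ℝ) (hy : 0 < y) : ∫⁻ w in (Metric.ball 0 δ')ᶜ,
      F w * ENNReal.ofReal (extKernel τ y w) ≤ ENNReal.ofReal (y ^ (2 * τ) * K) * I := by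
    have hm : Measurable (extKernel τ 1 : EuclideanSpace ℝ (Fin n) → ℝ) :=
      (continuous_extKernel τ one_pos).measurable
    have hm' : Measurable fun w => F w * ENNReal.ofReal (extKernel τ 1 w) :=
      hF.mul hm.ennreal_ofReal
    rw [hI, ← lintegral_const_mul _ hm']
    refine (setLIntegral_mono' Metric.isOpen_ball.measurableSet.compl fun w hw => ?_).trans
      (setLIntegral_le_lintegral _ _)
    have hw' : δ' ≤ ‖w‖ := by simpa using hw
    rw [mul_left_comm, ← ENNReal.ofReal_mul (by positivity)]
    gcongr
    exact extKernel_le_of_le_norm hτ hy hδ'0 hw'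
  have hlim : Tendsto (fun y : ℝ => ENNReal.ofReal (y ^ (2 * τ) * K) * I) (𝓝[>] 0) (𝓝 0) := by
    have h1 : Tendsto (fun y : ℝ => y ^ (2 * τ) * K) (𝓝[>] 0) (𝓝 0) := by
      have h := ((Real.continuous_rpow_const (show 0 ≤ 2 * τ by positivity)).mul_const K).tendsto 0
      rw [Real.zero_rpow (by positivity), zero_mul] at h
      exact h.mono_left nhdsWithin_le_nhds
    have h2 := ENNReal.Tendsto.mul_const (ENNReal.tendsto_ofReal h1) (Or.inr hF1)
    simpa using h2
  filter_upwards [(ENNReal.tendsto_nhds_zero.1 hlim) _ hε2, self_mem_nhdsWithin] with y hy hy0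
  rw [← lintegral_add_compl _ (Metric.isOpen_ball (x := (0 : EuclideanSpace ℝ (Fin n)))
    (ε := δ')).measurableSet, ← ENNReal.add_halves ε]
  exact add_le_add (hlocal y hy0) ((htail y hy0).trans hy)

/-- The kernel has mass one, so the error is the integral of `f - c` against it, and only the
averages of `‖f - c‖` over small balls matter. -/
theorem tendsto_integral_mul_extKernel {τ : ℝ} (hτ : 0 < τ)
    {f : EuclideanSpace ℝ (Fin n) → ℂ} (hf : Measurable f) (c : ℂ)
    (hf1 : Integrable fun w => f w * (extKernel τ 1 w : ℂ))
    (hf0 : Tendsto (fun r => (∫⁻ w in Metric.closedBall 0 r, ‖f w - c‖ₑ) /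
      volume (Metric.closedBall (0 : EuclideanSpace ℝ (Fin n)) r)) (𝓝[>] 0) (𝓝 0)) :
    Tendsto (fun y => ∫ w, f w * (extKernel τ y w : ℂ)) (𝓝[>] 0) (𝓝 c) := by
  have hcoe {y : ℝ} (hy : 0 < y) : Integrable fun w : EuclideanSpace ℝ (Fin n) =>
    c * (extKernel τ y w : ℂ) := ((integrable_extKernel hτ hy).ofReal).const_mul c
  have henorm {y : ℝ} (hy : 0 < y) (w : EuclideanSpace ℝ (Fin n)) :
      ‖(f w - c) * (extKernel τ y w : ℂ)‖ₑ = ‖f w - c‖ₑ * ENNReal.ofReal (extKernel τ y w) := by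
    rw [enorm_mul, enorm_eq_nnnorm (extKernel τ y w : ℂ), Complex.nnnorm_real,
      ← enorm_eq_nnnorm, Real.enorm_of_nonneg (extKernel_nonneg hτ hy w)]
  have hfin : ∫⁻ w, ‖f w - c‖ₑ * ENNReal.ofReal (extKernel τ 1 w) ≠ ∞ := by
    have h := (hf1.sub (hcoe one_pos)).2
    rw [hasFiniteIntegral_iff_enorm] at h
    refine ne_of_lt (lt_of_eq_of_lt (lintegral_congr fun w => ?_) h)
    rw [← henorm one_pos, sub_mul]
    rfl
  have hlim := tendsto_lintegral_extKernel hτ (by fun_prop) hfin hf0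
  rw [tendsto_iff_edist_tendsto_0]
  refine tendsto_of_tendsto_of_tendsto_of_le_of_le' tendsto_const_nhds hlim
    (Eventually.of_forall fun y => zero_le) ?_
  filter_upwards [Ioo_mem_nhdsGT one_pos] with y hy
  have hfy : Integrable fun w => f w * (extKernel τ y w : ℂ) := by
    have hm : Measurable (extKernel τ y : EuclideanSpace ℝ (Fin n) → ℝ) :=
      (continuous_extKernel τ hy.1).measurable
    refine (hf1.norm.const_mul ((1 : ℝ) ^ (2 * τ) * (min 1 (y ^ 2)) ^ (-(n / 2 + τ) : ℝ))).mono'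
      (by fun_prop) (Eventually.of_forall fun w => ?_)
    rw [norm_mul, norm_mul, Complex.norm_of_nonneg (extKernel_nonneg hτ hy.1 w),
      Complex.norm_of_nonneg (extKernel_nonneg hτ one_pos w), mul_left_comm]
    exact mul_le_mul_of_nonneg_left (extKernel_le hτ hy.1 le_rfl hy.2.le w) (norm_nonneg _)
  have hc : ∫ w : EuclideanSpace ℝ (Fin n), c * (extKernel τ y w : ℂ) = c := by
    rw [integral_const_mul, integral_complex_ofReal, integral_extKernel hτ hy.1,
      Complex.ofReal_one, mul_one]
  have hsub : (∫ w, f w * (extKernel τ y w : ℂ)) - c = ∫ w, (f w - c) * (extKernel τ y w : ℂ) := by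
    simp_rw [sub_mul]
    rw [integral_sub hfy (hcoe hy.1), hc]
  rw [edist_eq_enorm_sub, hsub]
  refine (enorm_integral_le_lintegral_enorm _).trans (lintegral_mono fun w => ?_)
  rw [henorm hy.1]

end LebesguePoints

/-! ### Poisson integrals on the torus -/

section TorusPoisson

variable {n : ℕ}

/-- The periodic Poisson integral of `u`. -/
noncomputable def torusPoisson (τ : ℝ) (u : Torus n → ℂ) (y : ℝ) (z : Torus n) : ℂ :=
  ∫ w, u (z - Torus.mk w) * (extKernel τ y w : ℂ)

theorem measurable_extKernel (τ : ℝ) {y : ℝ} (hy : 0 < y) :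
    Measurable (extKernel τ y : EuclideanSpace ℝ (Fin n) → ℝ) :=
  (continuous_extKernel τ hy).measurable

theorem Torus.measurable_mk : Measurable (Torus.mk : EuclideanSpace ℝ (Fin n) → Torus n) :=
  Torus.continuous_mk.measurable

theorem integrable_prod_extKernel {τ y : ℝ} (hτ : 0 < τ) (hy : 0 < y) {u : Torus n → ℂ}
    (hu : Measurable u) (hui : Integrable u) :
    Integrable (fun p : Torus n × EuclideanSpace ℝ (Fin n) =>
      u (p.1 - Torus.mk p.2) * (extKernel τ y p.2 : ℂ)) (volume.prod volume) := by
  have hm := measurable_extKernel (n := n) τ hy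
  have hmk := Torus.measurable_mk (n := n)
  rw [integrable_prod_iff' (Measurable.aestronglyMeasurable (by fun_prop))]
  refine ⟨Eventually.of_forall fun w => ?_, ?_⟩
  · exact (hui.comp_sub_right (Torus.mk w)).mul_const (extKernel τ y w : ℂ)
  refine ((integrable_extKernel hτ hy).const_mul (∫ z, ‖u z‖)).congr
    (Eventually.of_forall fun w => ?_)
  simp only [norm_mul, Complex.norm_of_nonneg (extKernel_nonneg hτ hy w)]
  rw [integral_mul_const, integral_sub_right_eq_self (fun z => ‖u z‖)]

theorem integrable_torusPoisson {τ y : ℝ} (hτ : 0 < τ) (hy : 0 < y) {u : Torus n → ℂ}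
    (hu : Measurable u) (hui : Integrable u) : Integrable (torusPoisson τ u y) :=
  (integrable_prod_extKernel hτ hy hu hui).integral_prod_left

theorem norm_toLp_int (k : Fin n → ℤ) :
    ‖(WithLp.toLp 2 fun i => -(k i : ℝ) : EuclideanSpace ℝ (Fin n))‖ = freqNorm k := by
  rw [EuclideanSpace.norm_eq, freqNorm]
  simp

theorem torusExp_neg_mk (k : Fin n → ℤ) (w : EuclideanSpace ℝ (Fin n)) :
    torusExp k (-Torus.mk w) = Complex.exp
      ((⟪(WithLp.toLp 2 fun i => -(k i : ℝ) : EuclideanSpace ℝ (Fin n)), w⟫_ℝ : ℂ) *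
        Complex.I) := by
  rw [show -Torus.mk w = Torus.mk (-w) by ext i; simp [Torus.mk], torusExp_mk]
  congr 3
  simp [PiLp.inner_apply, mul_comm]

/-- By Fubini each translate of `u` by `-w` contributes `e^{-ik·w}`. Averaging over `w` gives the
Fourier transform of the kernel at `-k`, which depends only on `|k|`. -/
theorem torusFourierCoeff_torusPoisson {τ y : ℝ} (hτ : 0 < τ) (hy : 0 < y) {u : Torus n → ℂ}
    (hu : Measurable u) (hui : Integrable u) (k : Fin n → ℤ) :
    torusFourierCoeff (torusPoisson τ u y) k =
      (extProfile τ (freqNorm k * y) : ℂ) * torusFourierCoeff u k := by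
  have hint : Integrable (fun p : Torus n × EuclideanSpace ℝ (Fin n) =>
      u (p.1 - Torus.mk p.2) * (extKernel τ y p.2 : ℂ) * torusExp (-k) p.1)
      (volume.prod volume) := by
    have h := integrable_prod_extKernel hτ hy hu hui
    refine h.mono (h.aestronglyMeasurable.mul (Continuous.aestronglyMeasurable
      ((torusExp (-k)).continuous.comp continuous_fst))) (Eventually.of_forall fun p => ?_)
    rw [norm_mul, norm_torusExp, mul_one]
  have hinner (w : EuclideanSpace ℝ (Fin n)) : ((2 * Real.pi : ℝ) : ℂ)⁻¹ ^ n *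
      ∫ z, u (z - Torus.mk w) * (extKernel τ y w : ℂ) * torusExp (-k) z =
      (extKernel τ y w : ℂ) * Complex.exp
        ((⟪(WithLp.toLp 2 fun i => -(k i : ℝ) : EuclideanSpace ℝ (Fin n)), w⟫_ℝ : ℂ) *
        Complex.I) * torusFourierCoeff u k := by
    rw [← torusExp_neg_mk, mul_assoc, ← torusFourierCoeff_comp_add_right, torusFourierCoeff,
      mul_left_comm (extKernel τ y w : ℂ), ← integral_const_mul (extKernel τ y w : ℂ)]
    congr 2
    funext z
    rw [sub_eq_add_neg]
    ring
  calc torusFourierCoeff (torusPoisson τ u y) k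
      = ((2 * Real.pi : ℝ) : ℂ)⁻¹ ^ n * ∫ z, ∫ w, u (z - Torus.mk w) * (extKernel τ y w : ℂ) *
          torusExp (-k) z := by
        simp_rw [torusFourierCoeff, torusPoisson, integral_mul_const]
    _ = ∫ w, ((2 * Real.pi : ℝ) : ℂ)⁻¹ ^ n * ∫ z, u (z - Torus.mk w) * (extKernel τ y w : ℂ) *
          torusExp (-k) z := by
        rw [integral_integral_swap hint, integral_const_mul]
    _ = _ := by
        simp_rw [hinner]
        rw [integral_mul_const, integral_extKernel_mul_cexp hτ hy, norm_toLp_int]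

/-- Integrability at height one is enough, since kernels at nearby heights are dominated by a
multiple of that one. -/
theorem continuousOn_torusPoisson {τ : ℝ} (hτ : 0 < τ) {u : Torus n → ℂ} (hu : Measurable u)
    {z : Torus n} (hz : Integrable fun w => u (z - Torus.mk w) * (extKernel τ 1 w : ℂ)) :
    ContinuousOn (fun y => torusPoisson τ u y z) (Set.Ioi 0) := by
  intro y hy
  have hy : 0 < y := hy
  have hmk := Torus.measurable_mk (n := n)
  refine ContinuousAt.continuousWithinAt ?_
  have hnhds : Set.Ioo (y / 2) (2 * y) ∈ 𝓝 y := Ioo_mem_nhds (by linarith) (by linarith)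
  refine continuousAt_of_dominated ?_ ?_ (hz.norm.const_mul
    ((2 * y) ^ (2 * τ) * (min 1 ((y / 2) ^ 2)) ^ (-(n / 2 + τ) : ℝ))) ?_
  · filter_upwards [hnhds] with x hx
    have hm := measurable_extKernel (n := n) τ (show 0 < x by linarith [hx.1])
    exact Measurable.aestronglyMeasurable (by fun_prop)
  · filter_upwards [hnhds] with x hx
    refine Eventually.of_forall fun w => ?_
    rw [norm_mul, norm_mul, Complex.norm_of_nonneg (extKernel_nonneg hτ one_pos w),
      Complex.norm_of_nonneg (extKernel_nonneg hτ (by linarith [hx.1]) w), mul_left_comm]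
    exact mul_le_mul_of_nonneg_left
      (extKernel_le hτ (half_pos hy) hx.1.le hx.2.le w) (norm_nonneg _)
  · exact Eventually.of_forall fun w => continuousAt_const.mul
      (Complex.continuous_ofReal.continuousAt.comp (continuousAt_extKernel_left τ hy w))

/-- A measurable section of the covering `ℝⁿ → 𝕋ⁿ` that does not charge null sets. -/
theorem Torus.exists_quasiMeasurePreserving_section :
    ∃ g : Torus n → EuclideanSpace ℝ (Fin n),
      Measure.QuasiMeasurePreserving g volume volume ∧ ∀ z, Torus.mk (g z) = z := by
  have h1 : MeasurePreserving
      (fun t : AddCircle (2 * Real.pi) => (AddCircle.equivIoc (2 * Real.pi) 0 t : ℝ))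
      volume (volume.restrict (Set.Ioc 0 (0 + 2 * Real.pi))) :=
    (measurePreserving_subtype_coe measurableSet_Ioc).comp
      (AddCircle.measurePreserving_equivIoc (2 * Real.pi))
  have h2 := measurePreserving_pi (fun _ : Fin n => (volume : Measure (AddCircle (2 * Real.pi))))
    (fun _ => volume.restrict (Set.Ioc 0 (0 + 2 * Real.pi))) (fun _ => h1)
  rw [← Measure.restrict_pi_pi, ← volume_pi, ← volume_pi] at h2
  refine ⟨fun z => WithLp.toLp 2 fun i => (AddCircle.equivIoc (2 * Real.pi) 0 (z i) : ℝ),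
    (PiLp.volume_preserving_toLp (Fin n)).quasiMeasurePreserving.comp
      (h2.quasiMeasurePreserving.mono_right Measure.restrict_le_self.absolutelyContinuous),
    fun z => ?_⟩
  ext i
  exact (AddCircle.equivIoc (2 * Real.pi) 0).symm_apply_apply (z i)

/-- A property of the points `z₀ - w`, for almost every `w` in `ℝⁿ`, holds almost everywhere on
the torus. -/
theorem Torus.ae_of_ae_sub_mk {p : Torus n → Prop} (z₀ : Torus n)
    (h : ∀ᵐ w : EuclideanSpace ℝ (Fin n), p (z₀ - Torus.mk w)) : ∀ᵐ z, p z := by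
  obtain ⟨g, hg, hgz⟩ := Torus.exists_quasiMeasurePreserving_section (n := n)
  have h1 := hg.ae ((Measure.measurePreserving_neg volume).quasiMeasurePreserving.ae h)
  have hneg (x : EuclideanSpace ℝ (Fin n)) : Torus.mk (-x) = -Torus.mk x := by
    ext i; simp [Torus.mk]
  simp_rw [hneg, hgz, sub_neg_eq_add] at h1
  have h2 := (measurePreserving_add_left (volume : Measure (Torus n))
    (-z₀)).quasiMeasurePreserving.ae h1
  simpa using h2

/-- Poisson integrals on the torus converge almost everywhere to their boundary values. -/
theorem ae_tendsto_torusPoisson {τ : ℝ} (hτ : 0 < τ) {u : Torus n → ℂ}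
    (hu : Measurable u) (hui : Integrable u) :
    ∀ᵐ z, ContinuousOn (fun y => torusPoisson τ u y z) (Set.Ioi 0) ∧
      Tendsto (fun y => torusPoisson τ u y z) (𝓝[>] 0) (𝓝 (u z)) := by
  have hmk := Torus.measurable_mk (n := n)
  have hz := (integrable_prod_extKernel hτ one_pos hu hui).prod_right_ae
  -- A single base point suffices, because the points `z₀ - w` cover the torus. Dividing by the
  -- positive continuous kernel shows that the lift of `u` based at `z₀` is locally integrable, so
  -- Lebesgue differentiation on `ℝⁿ` applies to it.
  obtain ⟨z₀, hz₀⟩ := hz.exists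
  have hloc : LocallyIntegrable fun w : EuclideanSpace ℝ (Fin n) => u (z₀ - Torus.mk w) := by
    rw [locallyIntegrable_iff]
    intro K hK
    have hc : ContinuousOn (fun w : EuclideanSpace ℝ (Fin n) => ((extKernel τ 1 w : ℂ))⁻¹) K :=
      ((Complex.continuous_ofReal.comp (continuous_extKernel τ one_pos)).inv₀ fun w =>
        Complex.ofReal_ne_zero.2 (extKernel_pos hτ one_pos w).ne').continuousOn
    refine (hz₀.integrableOn.continuousOn_mul hc hK).congr (Eventually.of_forall fun w => ?_)
    have : (extKernel τ 1 w : ℂ) ≠ 0 := Complex.ofReal_ne_zero.2 (extKernel_pos hτ one_pos w).ne'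
    field_simp
  have hleb := (Besicovitch.vitaliFamily (volume : Measure (EuclideanSpace ℝ (Fin n)))
    ).ae_tendsto_lintegral_enorm_sub_div hloc
  have hgood : ∀ᵐ z : Torus n, Tendsto (fun r =>
      (∫⁻ w in Metric.closedBall 0 r, ‖u (z - Torus.mk w) - u z‖ₑ) /
      volume (Metric.closedBall (0 : EuclideanSpace ℝ (Fin n)) r)) (𝓝[>] 0) (𝓝 0) := by
    refine Torus.ae_of_ae_sub_mk z₀ ?_
    filter_upwards [hleb] with w hw
    -- A Lebesgue point `w` of the lift is recentred at the origin by `x ↦ w + x`, which gives the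
    -- condition at `z = z₀ - w`.
    refine (hw.comp (Besicovitch.tendsto_filterAt volume w)).congr fun r => ?_
    have hpre : (fun x => w + x) ⁻¹' Metric.closedBall w r = Metric.closedBall 0 r := by
      ext x
      simp
    simp only [Function.comp_apply]
    rw [← (measurePreserving_add_left volume w).setLIntegral_comp_preimage
      Metric.isClosed_closedBall.measurableSet (by fun_prop), hpre, ← hpre,
      measure_preimage_add]
    simp_rw [Torus.mk_add, sub_add_eq_sub_sub]
  filter_upwards [hz, hgood] with z hz hgood
  refine ⟨continuousOn_torusPoisson hτ hu hz, ?_⟩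
  exact tendsto_integral_mul_extKernel hτ (by fun_prop) (u z) hz hgood

end TorusPoisson

/-! ### Almost everywhere convergence of the conormal derivative. -/

section PointwiseLimit

variable {n : ℕ} {σ : ℝ} {v : Torus n → ℝ} {V : Torus n → ℝ → ℝ}

theorem IsExtension.conormal_ae_eq (hV : IsExtension σ v V) (hσ0 : 0 < σ) (hσ1 : σ < 1)
    (hv : MemDomFracLaplacian σ v) {u : Torus n → ℂ}
    (hu : u = fun z => (extConst σ : ℂ) * fracLaplacian σ v z) (hum : Measurable u)
    (hui : Integrable u) {y : ℝ} (hy : 0 < y) :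
    conormal σ V y =ᵐ[volume] torusPoisson (1 - σ) u y := by
  have hτ : 0 < 1 - σ := by linarith
  refine ae_eq_of_torusFourierCoeff (integrable_of_continuous_torus (hV.continuous_conormal hy))
    (integrable_torusPoisson hτ hy hum hui) fun k => ?_
  rw [hV.coeff_conormal hσ0 hσ1 hv k hy, torusFourierCoeff_torusPoisson hτ hy hum hui, hu]

/-- The conormal derivative converges almost everywhere. -/
theorem IsExtension.ae_tendsto_conormal (hV : IsExtension σ v V) (hσ0 : 0 < σ) (hσ1 : σ < 1)
    (hv : MemDomFracLaplacian σ v) :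
    ∀ᵐ z, Tendsto (fun y => conormal σ V y z) (𝓝[>] 0)
      (𝓝 ((extConst σ : ℂ) * fracLaplacian σ v z)) := by
  have hτ : 0 < 1 - σ := by linarith
  set u : Torus n → ℂ := fun z => (extConst σ : ℂ) * fracLaplacian σ v z with hu
  have hum : Measurable u := ((Lp.stronglyMeasurable (fracLaplacian σ v)).const_mul _).measurable
  have hui : Integrable u := ((Lp.memLp (fracLaplacian σ v)).integrable one_le_two).const_mul _
  -- The exceptional null set depends on the height, so the identity is first collected over
  -- countably many heights.
  have hq : ∀ᵐ z, ∀ q : ℚ, 0 < (q : ℝ) →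
      conormal σ V q z = torusPoisson (1 - σ) u q z := by
    refine ae_all_iff.2 fun q => ?_
    by_cases hq : 0 < (q : ℝ)
    · filter_upwards [hV.conormal_ae_eq hσ0 hσ1 hv hu hum hui hq] with z hz _ using hz
    · exact Eventually.of_forall fun z h => absurd h hq
  filter_upwards [hq, ae_tendsto_torusPoisson hτ hum hui] with z hz hz'
  refine hz'.2.congr' ?_
  filter_upwards [self_mem_nhdsWithin] with y hy
  -- Both sides are continuous in `y > 0` for this fixed `z`, so agreement at the positive rationals
  -- extends to all heights.
  have hd : Set.EqOn (fun y => torusPoisson (1 - σ) u y z) (fun y => conormal σ V y z)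
      (Set.Ioi 0) := by
    refine Set.EqOn.of_subset_closure (s := Set.Ioi 0 ∩ Set.range ((↑) : ℚ → ℝ)) ?_ hz'.1
      (hV.continuousOn_conormal z) Set.inter_subset_left ?_
    · rintro _ ⟨hx, q, rfl⟩
      exact (hz q hx).symm
    · exact (Rat.denseRange_cast (𝕜 := ℝ)).open_subset_closure_inter isOpen_Ioi
  exact hd hy

end PointwiseLimit

theorem mainTheorem4 (n : ℕ) (σ : ℝ) (hσ0 : 0 < σ) (hσ1 : σ < 1) (v : Torus n → ℝ)
    (hv : MemDomFracLaplacian σ v) :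
    0 < extConst σ ∧
    (∃ V : Torus n → ℝ → ℝ, IsExtension σ v V) ∧
    (∀ V W : Torus n → ℝ → ℝ, IsExtension σ v V → IsExtension σ v W →
      ∀ (z : Torus n) (y : ℝ), 0 < y → V z y = W z y) ∧
    ∀ V : Torus n → ℝ → ℝ, IsExtension σ v V →
      Tendsto (fun y : ℝ => eLpNorm (fun z : Torus n =>
          ((-(y ^ (1 - 2 * σ) * deriv (V z) y) : ℝ) : ℂ)
            - (extConst σ : ℂ) * fracLaplacian σ v z) 2 volume) (𝓝[>] 0) (𝓝 0) ∧
      ∀ᵐ z : Torus n, Tendsto (fun y : ℝ => ((-(y ^ (1 - 2 * σ) * deriv (V z) y) : ℝ) : ℂ))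
        (𝓝[>] 0) (𝓝 ((extConst σ : ℂ) * fracLaplacian σ v z)) :=
  ⟨extConst_pos hσ0 hσ1, ⟨_, isExtension_extension hσ0 hv.1⟩,
    fun _ _ hV hW z _ hy => hV.unique hW hσ0 hv.1 z hy,
    fun _ hV => ⟨hV.tendsto_eLpNorm_conormal hσ0 hσ1 hv, hV.ae_tendsto_conormal hσ0 hσ1 hv⟩⟩
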